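/- **System.** Let $N\ge 1$ nodes $0,\dots,N-1$ form a ring, $i+1$ being taken modulo $N$. Every two distinct nodes communicate through reliable channels; messages may overtake each other. Nodes may crash at any time; a crashed node never does anything again. Messages already sent by a node stay in transit after it crashes. A *basic algorithm* runs on the nodes: an alive node is active or passive; an active node may send basic messages to other nodes or become passive; a passive node becomes active only by receiving a basic message (see RBM below). Any set of nodes may be active initially. Besides it, the following *control algorithm* runs. **Variables.** Node $i$ has $count_i^j\in\mathbb Z$ ($0\le j<N$, initially $0$), $black_i$ (initially $i$), $seq_i$ (initially $0$), $next_i$ (initially $i+1$), and sets $C_i$ (crashes reported already) and $R_i$ (detected crashes that are still to be reported), initially empty. A token $t$ carries $count_t^j\in\mathbb Z$, a node $black_t$, a number $seq_t$ and a set $C_t$ of nodes. Each node stores the last token it forwarded; initially this is a token with $count_t^j=0$, $black_t=i$, $C_t=\emptyset$. Initially node $0$ holds a token with $count_t^j=0$, $black_t=N-1$, $seq_t=1$, $C_t=\emptyset$, and has accepted it in RT. Let $furthest_i(j,k)$ be $k$ if $i\le j\le k$ or $k<i\le j$ or $j\le k<i$, and $j$ otherwise. **Procedures** of node $i$ (executed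 without interruption, except that SBM, RBM and FD may be executed while $i$ waits to become passive; *Announce* ends the control algorithm of $i$, except that RBM still applies): * SBM (send a basic message $m$ to $j\neq i$; allowed only if $j\notin C_i\cup R_i\cup C_t$, where $t$ is the token held by $i$, or else the stored one): $m$ carries $seq_m=seq_i$, and $count_i^j$ is increased by $1$. * RBM (receive $m$ from $j$): if $j\in C_i$ the message is ignored. Otherwise $i$ becomes active; if $seq_m=seq_i+1$, or $j>i$ and $seq_m=seq_i$, then $black_i\leftarrow furthest_i(black_i,j)$; and $count_i^j$ is decreased by $1$. * RT (receive a token $t$): ignore $t$ unless $seq_t=seq_i+1$. Wait until $i$ is passive. Then $black_i\leftarrow furthest_i(black_i,black_t)$; $C_t\leftarrow C_t\setminus C_i$; $C_i\leftarrow C_i\cup C_t$; $R_i\leftarrow R_i\setminus C_t$. If $black_i=i$ or $R_i=\emptyset$, put $count_t^i\leftarrow\sum_{j\notin C_i}count_i^j$. If $black_i=i$ and $\sum_{j\notin C_i}count_t^j=0$, Announce. Otherwise: if $next_i\in C_t$, do NS. If $next_i<i$, increase $seq_t$ by $1$. If $R_i\ne\emptyset$, put $C_t\leftarrow C_t\cup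 R_i$, $black_t\leftarrow i$, $C_i\leftarrow C_i\cup R_i$, $R_i\leftarrow\emptyset$; else $black_t\leftarrow furthest_i(black_i,next_i)$. Send $t$ to $next_i$ and store it; $black_i\leftarrow i$; increase $seq_i$ by $1$. * FD (the failure detector reports to $i$ that $j$ crashed): if $j\in C_i\cup R_i$, do nothing. Otherwise add $j$ to $R_i$. If moreover $j=next_i$, do NS and after that, if $seq_i>0$ or $next_i<i$, send a backup token: in the stored token put $C_t\leftarrow C_t\cup R_i$, $black_t\leftarrow i$, and, if $next_i<i$, $seq_t\leftarrow seq_i+1$; send it to $next_i$. * NS (new successor): increase $next_i$ by $1$ modulo $N$, once and then as long as $next_i\in C_i\cup R_i$. If now $next_i=i$: wait until $i$ is passive, put $C_i\leftarrow C_i\cup R_i$, $R_i\leftarrow\emptyset$, and Announce. Otherwise, if $black_i\ne i$, put $black_i\leftarrow furthest_i(black_i,next_i)$. **Assumptions.** The failure detector is perfect: it reports only nodes that have crashed, and every crash eventually becomes known to each node $i$ that never crashes (it gets into $C_i\cup R_i$) unless $i$ announces. For nodes that never crash, tokens in transit are eventually received, and a passive waiting node eventually proceeds. (Only liveness needs the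 assumptions on what eventually happens.) The basic algorithm *has terminated* in a state if all alive nodes are passive and for every basic message in transit, sent by $j$ to $k$, either $k$ has crashed or $k$ knows that $j$ crashed, i.e. $j\in C_k$. **Theorem.** In every run of this system: * *Liveness.* If the basic algorithm has terminated at some moment and some node never crashes, then at that moment or later there is an alive node that has announced termination. * *Safety.* Whenever some node has announced termination (in particular, at the moment of the announcement), the basic algorithm has terminated. -/

import Mathlib

namespace FTSafra

open Finset

/-! Nodes are the elements of `Fin N`, arranged in a ring by `i ↦ i + 1` (addition modulo `N`). -/

/-- The token of the control algorithm. -/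
structure Token (N : ℕ) where
  /-- `count j`: the count of node `j`, as far as recorded in the token -/
  count : Fin N → ℤ
  /-- the nodes visited from now on, up to and not including `black`, are black -/
  black : Fin N
  /-- sequence number -/
  seq : ℕ
  /-- crashed nodes that are being reported -/
  crashed : Finset (Fin N)

/-- A basic message; its contents play no role. -/
structure BasicMsg (N : ℕ) where
  sender : Fin N
  receiver : Fin N
  /-- sequence number piggybacked by the sender -/
  seq : ℕ

/-- Where a node is in the execution of the control algorithm. -/
inductive Phase (N : ℕ) where
  /-- not executing a procedure -/
  | idle
  /-- in `ReceiveToken`, having accepted the token `t` and waiting to become passive -/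
  | waitToken (t : Token N)
  /-- in `NewSuccessor`, all other nodes being known to have crashed, waiting to become passive -/
  | waitAlone
  /-- has called `Announce`, which ends its control algorithm -/
  | announced

/-- Local state of a node. A crashed node keeps its last state, with `alive = false`. -/
structure NodeState (N : ℕ) where
  alive : Bool
  active : Bool
  /-- `count j`: number of basic messages sent to `j` minus number received from `j` -/
  count : Fin N → ℤ
  black : Fin N
  seq : ℕ
  next : Fin N
  /-- detected crashes that have been reported through the token -/
  crashed : Finset (Fin N)
  /-- detected crashes that still have to be reported -/
  report : Finset (Fin N)
  phase : Phase N
  /-- the last token forwarded by the node, kept for sending backup tokens -/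
  stored : Token N

/-- Global state: local states of the nodes, basic messages in transit, and tokens in transit
together with their destinations. Messages may overtake each other. -/
structure State (N : ℕ) where
  nodes : Fin N → NodeState N
  msgs : Multiset (BasicMsg N)
  tokens : Multiset (Fin N × Token N)

variable {N : ℕ}

/-- Which of `j` and `k` is furthest away from `i` in the ring. -/
def furthest (i j k : Fin N) : Fin N :=
  if (i ≤ j ∧ j ≤ k) ∨ (k < i ∧ i ≤ j) ∨ (j ≤ k ∧ k < i) then k else j

/-- The loop `while j ∈ S do j := (j + 1) mod N`, with at most `fuel` iterations. -/
def skip [NeZero N] (S : Finset (Fin N)) : ℕ → Fin N → Fin N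
  | 0, j => j
  | fuel + 1, j => if j ∈ S then skip S fuel (j + 1) else j

/-- The procedure `NewSuccessor` of node `i` in local state `x`. The loop needs fewer than `N`
iterations, as `i` itself is not among the crashed nodes. If no other node is left then `i` waits
to become passive; the announcement that follows is the separate step `announceAlone`. -/
def newSuccessor [NeZero N] (i : Fin N) (x : NodeState N) : NodeState N :=
  let nx := skip (x.crashed ∪ x.report) N (x.next + 1)
  if nx = i then { x with next := nx, phase := .waitAlone }
  else { x with next := nx, black := if x.black ≠ i then furthest i x.black nx else x.black }

/-- The procedure `SendBasicMessage` refers to the set of crashed nodes in the local copy of the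
token: the token being held, or else the last token forwarded. -/
def localToken (x : NodeState N) : Token N :=
  match x.phase with
  | .waitToken t => t
  | _ => x.stored

/-- Effect of `ReceiveBasicMessage` at node `i`, for a message from `j` with number `sq`. A message
from a node in `crashed` is ignored; any other message makes the receiver active. -/
def receiveBasic (i j : Fin N) (sq : ℕ) (x : NodeState N) : NodeState N :=
  if j ∈ x.crashed then x
  else
    { x with
      active := true
      black := if sq = x.seq + 1 ∨ (i < j ∧ sq = x.seq) then furthest i x.black j else x.black
      count := Function.update x.count j (x.count j - 1) }

/-- The first line of `ReceiveToken`: the token `t` arrives at a node that is idle. -/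
def acceptToken (t : Token N) (x : NodeState N) : NodeState N :=
  if t.seq = x.seq + 1 then { x with phase := .waitToken t } else x

/-- The part of `ReceiveToken` after the node `i` has become passive, with accepted token `t`:
the new local state and, if any, the token that is sent with its destination. -/
def processToken [NeZero N] (i : Fin N) (t : Token N) (x : NodeState N) :
    NodeState N × Option (Fin N × Token N) :=
  let ct := t.crashed \ x.crashed
  let y : NodeState N :=
    { x with
      phase := .idle
      black := furthest i x.black t.black
      crashed := x.crashed ∪ ct
      report := x.report \ ct }
  let cnt : Fin N → ℤ :=
    if y.black = i ∨ y.report = ∅ then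
      Function.update t.count i (∑ j ∈ univ \ y.crashed, y.count j)
    else t.count
  if y.black = i ∧ ∑ j ∈ univ \ y.crashed, cnt j = 0 then
    ({ y with phase := .announced }, none)
  else
    let z := if y.next ∈ ct then newSuccessor i y else y
    match z.phase with
    | .waitAlone => (z, none)
    | _ =>
      let sq := if z.next < i then t.seq + 1 else t.seq
      let t' : Token N :=
        if z.report ≠ ∅ then ⟨cnt, i, sq, ct ∪ z.report⟩
        else ⟨cnt, furthest i z.black z.next, sq, ct⟩
      ({ z with
          crashed := z.crashed ∪ z.report
          report := ∅
          black := i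
          seq := z.seq + 1
          stored := t' },
        some (z.next, t'))

/-- The procedure `FailureDetector` of node `i`, invoked for the crashed node `j`. The backup token
is the last token forwarded, suitably updated. -/
def detectCrash [NeZero N] (i j : Fin N) (x : NodeState N) :
    NodeState N × Option (Fin N × Token N) :=
  if j ∈ x.crashed ∪ x.report then (x, none)
  else
    let y : NodeState N := { x with report := insert j x.report }
    if j = y.next then
      let z := newSuccessor i y
      match z.phase with
      | .waitAlone => (z, none)
      | _ =>
        if 0 < z.seq ∨ z.next < i then
          let t' : Token N :=
            { z.stored with
              crashed := z.stored.crashed ∪ z.report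
              black := i
              seq := if z.next < i then z.seq + 1 else z.stored.seq }
          ({ z with stored := t' }, some (z.next, t'))
        else (z, none)
    else (y, none)

/-- Replace the local state of node `i`. -/
def State.setNode (s : State N) (i : Fin N) (x : NodeState N) : State N :=
  { s with nodes := Function.update s.nodes i x }

/-- Replace the local state of node `i`, and put the token `o` (if any) in transit. -/
def State.setNodeSend (s : State N) (i : Fin N) (r : NodeState N × Option (Fin N × Token N)) :
    State N :=
  { s.setNode i r.1 with tokens := s.tokens + (r.2.elim 0 fun d => {d}) }

/-- The steps of the system: the basic algorithm (an arbitrary one), crashes, the failure detector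
(which only reports nodes that have crashed) and the control algorithm. Procedures are executed
without interruption, except while waiting to become passive. -/
inductive Step [NeZero N] : State N → State N → Prop
  /-- an active node terminates locally -/
  | becomePassive (s : State N) (i : Fin N)
      (alive : (s.nodes i).alive = true) (active : (s.nodes i).active = true) :
      Step s (s.setNode i { s.nodes i with active := false })
  /-- an active node `i` sends a basic message to `j`, unless it knows that `j` has crashed -/
  | sendBasic (s : State N) (i j : Fin N) (ne : j ≠ i)
      (alive : (s.nodes i).alive = true) (active : (s.nodes i).active = true)
      (known : j ∉ (s.nodes i).crashed ∪ (s.nodes i).report ∪ (localToken (s.nodes i)).crashed) :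
      Step s
        { s.setNode i { s.nodes i with
            count := Function.update (s.nodes i).count j ((s.nodes i).count j + 1) } with
          msgs := s.msgs + {⟨i, j, (s.nodes i).seq⟩} }
  /-- a basic message `m` arrives at an alive node -/
  | receiveBasic (s : State N) (m : BasicMsg N) (rest : Multiset (BasicMsg N))
      (inTransit : s.msgs = m ::ₘ rest) (alive : (s.nodes m.receiver).alive = true) :
      Step s
        { s.setNode m.receiver
            (FTSafra.receiveBasic m.receiver m.sender m.seq (s.nodes m.receiver)) with
          msgs := rest }
  /-- a node crashes, for good -/
  | crash (s : State N) (i : Fin N) (alive : (s.nodes i).alive = true) :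
      Step s (s.setNode i { s.nodes i with alive := false })
  /-- the failure detector of `i` reports that `j` crashed; `i` may be idle or waiting -/
  | detect (s : State N) (i j : Fin N)
      (alive : (s.nodes i).alive = true) (crashed : (s.nodes j).alive = false)
      (running : (s.nodes i).phase ≠ .announced) :
      Step s (s.setNodeSend i (detectCrash i j (s.nodes i)))
  /-- a token `t` arrives at an alive node `i` that is ready to handle it -/
  | receiveToken (s : State N) (i : Fin N) (t : Token N) (rest : Multiset (Fin N × Token N))
      (inTransit : s.tokens = (i, t) ::ₘ rest)
      (alive : (s.nodes i).alive = true) (idle : (s.nodes i).phase = .idle) :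
      Step s { s.setNode i (acceptToken t (s.nodes i)) with tokens := rest }
  /-- a node waiting in `ReceiveToken` is passive, and executes the rest of the procedure -/
  | processToken (s : State N) (i : Fin N) (t : Token N)
      (alive : (s.nodes i).alive = true) (passive : (s.nodes i).active = false)
      (waiting : (s.nodes i).phase = .waitToken t) :
      Step s (s.setNodeSend i (FTSafra.processToken i t (s.nodes i)))
  /-- a node waiting in `NewSuccessor` is passive, updates `crashed`, and announces -/
  | announceAlone (s : State N) (i : Fin N)
      (alive : (s.nodes i).alive = true) (passive : (s.nodes i).active = false)
      (waiting : (s.nodes i).phase = .waitAlone) :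
      Step s (s.setNode i { s.nodes i with
        crashed := (s.nodes i).crashed ∪ (s.nodes i).report
        report := ∅
        phase := .announced })

/-- The node with the highest number, `N - 1`. -/
def lastNode (N : ℕ) [NeZero N] : Fin N := ⟨N - 1, Nat.sub_one_lt (NeZero.ne N)⟩

/-- The local state of node `i` after initialization. Node `0` holds the first token. -/
def initNode [NeZero N] (i : Fin N) (active : Bool) : NodeState N where
  alive := true
  active := active
  count := 0
  black := i
  seq := 0
  next := i + 1
  crashed := ∅
  report := ∅
  phase := if i = 0 then .waitToken ⟨0, lastNode N, 1, ∅⟩ else .idle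
  -- the sequence number of this token is never used
  stored := ⟨0, i, 0, ∅⟩

/-- Initially any set of nodes may be active, and nothing is in transit. -/
def IsInit [NeZero N] (s : State N) : Prop :=
  (∃ active : Fin N → Bool, ∀ i, s.nodes i = initNode i (active i)) ∧ s.msgs = 0 ∧ s.tokens = 0

/-- A run. Steps in which nothing happens are allowed, so finite executions are included. -/
def IsRun [NeZero N] (σ : ℕ → State N) : Prop :=
  IsInit (σ 0) ∧ ∀ n, σ (n + 1) = σ n ∨ Step (σ n) (σ (n + 1))

/-- The basic algorithm has terminated: all alive nodes are passive, and every basic message in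
transit has a receiver that has crashed or knows that the sender has crashed. -/
def Terminated (s : State N) : Prop :=
  (∀ i, (s.nodes i).alive = true → (s.nodes i).active = false) ∧
  ∀ m ∈ s.msgs,
    (s.nodes m.receiver).alive = false ∨ m.sender ∈ (s.nodes m.receiver).crashed

/-- Node `i` has announced termination. -/
def Announced (s : State N) (i : Fin N) : Prop := (s.nodes i).phase = .announced

/-- Node `i` waits to become passive. -/
def Waiting (s : State N) (i : Fin N) : Prop :=
  (s.nodes i).phase = .waitAlone ∨ ∃ t, (s.nodes i).phase = .waitToken t

/-- Node `i` never crashes in the run `σ`. -/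
def Correct (σ : ℕ → State N) (i : Fin N) : Prop := ∀ n, ((σ n).nodes i).alive = true

/-- The progress guarantees of the system, for nodes `i` that never crash. -/
structure Fair (σ : ℕ → State N) : Prop where
  /-- a token sent to `i` does not stay in transit forever, if `i` is ready for it again and
  again -/
  delivery : ∀ i, Correct σ i → ∀ t : Token N,
    ¬ ((∃ n, ∀ m ≥ n, (i, t) ∈ (σ m).tokens) ∧
        ∀ n, ∃ m ≥ n, ((σ m).nodes i).phase = .idle)
  /-- `i` does not stay waiting forever while it is passive -/
  progress : ∀ i, Correct σ i →
    ¬ ∃ n, ∀ m ≥ n, Waiting (σ m) i ∧ ((σ m).nodes i).active = false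
  /-- every crash is eventually known to `i` (unless `i` ends its control algorithm) -/
  detection : ∀ i, Correct σ i → ∀ j n, ((σ n).nodes j).alive = false →
    ∃ m, j ∈ ((σ m).nodes i).crashed ∪ ((σ m).nodes i).report ∨ Announced (σ m) i

end FTSafra

namespace FTSafra

open Finset

variable {N : ℕ}

/-! Uniqueness of the token. The number `seq` of a node counts how often it has forwarded a token.
It divides the history of the node into intervals, and a choice of one number per node is a cut of
the run. All valid tokens are at one node `w` (`ControlInv.valid_unique`), since the numbers reveal
its position: alive nodes below `w` are one visit ahead of `w`, and alive nodes above `w` are level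
with it. A backup token is therefore either stale or a substitute at the node where the token is
awaited. It is a good substitute because, as long as `b` has not been visited since `p` forwarded,
neither have the nodes from `b` round to `p`. Their crash sets are unchanged, and the token stored
by `p` still describes them (`StoredOK`, `tokenCore_of_stored`).

Safety. The log of all messages is added as a history variable. For the nodes in its window, those
visited since the token was black, the token holds the counts at their latest visits (`TokenLog`).
No message between window nodes crosses this cut backwards, that is, is sent after it and received
before it: by its number such a message would have kept its receiver black up to its sender
(`LogInv.back_at`). When `w` announces, the window contains every other node not known to have
crashed, and all of them have the same crash set. Without backward messages every ordered pair of
nodes contributes a nonnegative amount to the sum of the counts. As the sum is zero, no message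
crosses the cut forwards (`LogInv.no_forward`). All nodes were passive at the cut, and only a
forward message could have started new activity (`LogInv.inactive`), so there was none
(`terminated_of_announce`). Termination is stable (`Terminated.step`), so only the first
announcement needs this argument.

Liveness. By `LiveInv` the token does not get lost: a running successor that is due has a valid
token. Suppose that after termination no alive node announces. From some time on only correct nodes
are alive, they know all crashes, and tokens are the only activity (`Settled`). Fairness keeps the
token moving. After each node has been visited, nothing is left to report and all nodes are white.
Every further hop shortens the black stretch of the token, so it becomes white too. One more lap
makes its counts exact, and they add up to zero by `Inv.total_count`. The next node to process the
token would have to announce, a contradiction (`Settled.false`). -/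

/-! ### Distances in the ring. -/

/-- Clockwise distance from `i` to `j` in the ring; it is `0` if `j = i`. -/
def cdist (i j : Fin N) : ℕ := if i.val ≤ j.val then j.val - i.val else j.val + N - i.val

/-- Positive clockwise distance from `i` to `j` in the ring; it is `N` if `j = i`. -/
def sdist (i j : Fin N) : ℕ := if i.val < j.val then j.val - i.val else j.val + N - i.val

/-- The three cyclic orderings in `furthest` amount to one comparison of clockwise distances, so
that `furthest i` acts as a maximum. -/
lemma furthest_eq (i j k : Fin N) :
    furthest i j k = if cdist i j ≤ cdist i k then k else j := by
  have hi := i.isLt; have hj := j.isLt; have hk := k.isLt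
  unfold furthest cdist
  simp only [Fin.le_def, Fin.lt_def]
  congr 1
  apply propext
  split_ifs <;> omega

lemma cdist_furthest (i j k : Fin N) :
    cdist i (furthest i j k) = max (cdist i j) (cdist i k) := by
  rw [furthest_eq]
  split_ifs <;> omega

lemma cdist_inj {i j k : Fin N} (h : cdist i j = cdist i k) : j = k := by
  have hi := i.isLt; have hj := j.isLt; have hk := k.isLt
  unfold cdist at h
  apply Fin.ext
  split_ifs at h <;> omega

lemma sdist_inj {i j k : Fin N} (h : sdist i j = sdist i k) : j = k := by
  have hi := i.isLt; have hj := j.isLt; have hk := k.isLt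
  unfold sdist at h
  apply Fin.ext
  split_ifs at h <;> omega

@[simp] lemma cdist_self (i : Fin N) : cdist i i = 0 := by simp [cdist]

lemma cdist_eq_zero {i j : Fin N} : cdist i j = 0 ↔ j = i :=
  ⟨fun h => cdist_inj (i := i) (by simpa using h), fun h => by simp [h]⟩

lemma cdist_lt (i j : Fin N) : cdist i j < N := by
  have hi := i.isLt; have hj := j.isLt
  unfold cdist; split_ifs <;> omega

@[simp] lemma sdist_self (i : Fin N) : sdist i i = N := by simp [sdist]

lemma sdist_le (i j : Fin N) : sdist i j ≤ N := by
  have hi := i.isLt; have hj := j.isLt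
  unfold sdist; split_ifs <;> omega

lemma sdist_pos (i j : Fin N) : 0 < sdist i j := by
  have hi := i.isLt; have hj := j.isLt
  unfold sdist; split_ifs <;> omega

lemma sdist_eq_cdist {i j : Fin N} (h : j ≠ i) : sdist i j = cdist i j := by
  have hi := i.isLt; have hj := j.isLt
  have : j.val ≠ i.val := fun e => h (Fin.ext e)
  unfold cdist sdist; split_ifs <;> omega

lemma eq_of_sdist {i j : Fin N} (h : N ≤ sdist i j) : j = i := by
  apply sdist_inj (i := i)
  have := sdist_le i j
  simp; omega

/-- On the lap that starts just after `p` and ends at `p`, nodes come in the order of `sdist p`, and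
distances along the lap subtract. -/
lemma cdist_of_sdist_le {p b z : Fin N} (h : sdist p b ≤ sdist p z) :
    cdist b z = sdist p z - sdist p b := by
  have hi := p.isLt; have hj := b.isLt; have hk := z.isLt
  unfold cdist; unfold sdist at *
  split_ifs at * <;> omega

lemma sdist_succ [NeZero N] {i j : Fin N} (h : j ≠ i) : sdist i (j + 1) = sdist i j + 1 := by
  have hi := i.isLt; have hj := j.isLt
  have hne : j.val ≠ i.val := fun e => h (Fin.ext e)
  have hv : (j + 1).val = if j.val + 1 = N then 0 else j.val + 1 := by
    rw [Fin.val_add]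
    rw [Fin.val_one', Nat.add_mod_mod]
    split_ifs with h1
    · rw [h1]; simp
    · exact Nat.mod_eq_of_lt (by omega)
  unfold sdist
  rw [hv]
  split_ifs <;> omega

/-! ### Effects of the procedures on a single node. -/

/-- As `i ∉ S`, the loop never runs past `i`, where `sdist i` would drop from `N` to `1`. -/
lemma sdist_skip [NeZero N] {S : Finset (Fin N)} {i : Fin N} (hi : i ∉ S) (fuel : ℕ) :
    ∀ j, (∀ z, sdist i z < sdist i j → z ∈ S) →
      ∀ z, sdist i z < sdist i (skip S fuel j) → z ∈ S := by
  induction fuel with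
  | zero => intro j h z hz; exact h z hz
  | succ n ih =>
    intro j h z hz
    unfold skip at hz
    split_ifs at hz with hj
    · refine ih (j + 1) ?_ z hz
      intro w hw
      have hji : j ≠ i := fun e => hi (e ▸ hj)
      rw [sdist_succ hji] at hw
      rcases Nat.lt_or_ge (sdist i w) (sdist i j) with h1 | h1
      · exact h w h1
      · have : w = j := sdist_inj (i := i) (by omega)
        exact this ▸ hj
    · exact h z hz

/-- The loop stops at `i` at the latest, which is `N - sdist i j` iterations away from `j`. -/
lemma skip_notMem [NeZero N] {S : Finset (Fin N)} {i : Fin N} (hi : i ∉ S) (fuel : ℕ) :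
    ∀ j, N ≤ fuel + sdist i j → skip S fuel j ∉ S := by
  induction fuel with
  | zero =>
    intro j h
    have : j = i := eq_of_sdist (by omega)
    simpa [skip, this] using hi
  | succ n ih =>
    intro j h
    unfold skip
    split_ifs with hj
    · have hji : j ≠ i := fun e => hi (e ▸ hj)
      apply ih
      rw [sdist_succ hji]
      omega
    · exact hj

/-- The nodes strictly between `i` and its successor are known to `i` to have crashed, and the
successor is not. -/
structure GoodNext (i : Fin N) (x : NodeState N) : Prop where
  gap : ∀ z, sdist i z < sdist i x.next → z ∈ x.crashed ∪ x.report
  notMem : x.next ∉ x.crashed ∪ x.report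

/-- The control state of a node, apart from the values of `next`, `black` and `phase`. -/
structure SameCore (x y : NodeState N) : Prop where
  alive : y.alive = x.alive
  active : y.active = x.active
  count : y.count = x.count
  seq : y.seq = x.seq
  crashed : y.crashed = x.crashed
  report : y.report = x.report
  stored : y.stored = x.stored

structure NewSuccessorSpec (i : Fin N) (x y : NodeState N) : Prop extends SameCore x y where
  good : GoodNext i y
  black : cdist i x.black ≤ cdist i y.black
  phase : (y.next = i ∧ y.phase = .waitAlone) ∨ (y.next ≠ i ∧ y.phase = x.phase)
  further : sdist i x.next < sdist i y.next

lemma newSuccessor_spec [NeZero N] {i : Fin N} {x : NodeState N}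
    (hi : i ∉ x.crashed ∪ x.report) (hn : x.next ∈ x.crashed ∪ x.report)
    (gap : ∀ z, sdist i z < sdist i x.next → z ∈ x.crashed ∪ x.report) :
    NewSuccessorSpec i x (newSuccessor i x) := by
  have hni : x.next ≠ i := fun e => hi (e ▸ hn)
  have hgap : ∀ z, sdist i z < sdist i (skip (x.crashed ∪ x.report) N (x.next + 1)) →
      z ∈ x.crashed ∪ x.report := by
    apply sdist_skip hi
    intro z hz
    rw [sdist_succ hni] at hz
    rcases Nat.lt_or_ge (sdist i z) (sdist i x.next) with h1 | h1
    · exact gap z h1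
    · have : z = x.next := sdist_inj (i := i) (by omega)
      exact this ▸ hn
  have hnot : skip (x.crashed ∪ x.report) N (x.next + 1) ∉ x.crashed ∪ x.report :=
    skip_notMem hi N _ (by omega)
  have hfur : sdist i x.next < sdist i (skip (x.crashed ∪ x.report) N (x.next + 1)) := by
    by_contra hc
    rcases Nat.lt_or_ge (sdist i (skip (x.crashed ∪ x.report) N (x.next + 1)))
      (sdist i x.next) with h1 | h1
    · exact hnot (gap _ h1)
    · exact hnot (by rw [sdist_inj (i := i) (le_antisymm (not_lt.mp hc) h1)]; exact hn)
  unfold newSuccessor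
  by_cases h : skip (x.crashed ∪ x.report) N (x.next + 1) = i
  · simp only [h, if_true]
    rw [h] at hgap hnot hfur
    exact ⟨⟨rfl, rfl, rfl, rfl, rfl, rfl, rfl⟩, ⟨hgap, hnot⟩, le_rfl, Or.inl ⟨rfl, rfl⟩, hfur⟩
  · simp only [h, if_false]
    refine ⟨⟨rfl, rfl, rfl, rfl, rfl, rfl, rfl⟩, ⟨hgap, hnot⟩, ?_, Or.inr ⟨h, rfl⟩, hfur⟩
    dsimp only
    split_ifs
    · rw [cdist_furthest]; exact le_max_left _ _
    · exact le_rfl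

/-- Effect on node `i` in local state `x` of detecting the crash of `j`. -/
structure DetectSpec (i j : Fin N) (x : NodeState N)
    (r : NodeState N × Option (Fin N × Token N)) : Prop where
  alive : r.1.alive = x.alive
  active : r.1.active = x.active
  count : r.1.count = x.count
  seq : r.1.seq = x.seq
  crashed : r.1.crashed = x.crashed
  report : r.1.report = insert j x.report
  good : GoodNext i r.1
  black : cdist i x.black ≤ cdist i r.1.black
  phase : (r.1.next = i ∧ r.1.phase = .waitAlone) ∨ r.1.phase = x.phase
  self : r.1.next = i → r.1.phase = .waitAlone ∨ x.next = i
  -- If no backup is sent, then the node is left alone, or its successor is unchanged, or it has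
  -- never forwarded a token and its new successor is not below it, so that this successor is not
  -- due.
  send :
    (r.1.stored = x.stored ∧ r.2 = none ∧
      ((r.1.next = i ∧ r.1.phase = .waitAlone) ∨ r.1.next = x.next ∨
        (x.seq = 0 ∧ ¬ r.1.next < i))) ∨
    (r.2 = some (r.1.next, r.1.stored) ∧ r.1.next ≠ i ∧
      r.1.stored.crashed = x.stored.crashed ∪ r.1.report ∧ r.1.stored.black = i ∧
      (r.1.next < i ∨ 0 < x.seq) ∧ sdist i x.next < sdist i r.1.next ∧
      r.1.stored.seq = if r.1.next < i then x.seq + 1 else x.stored.seq)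

lemma detectCrash_spec [NeZero N] {i j : Fin N} {x : NodeState N} (hij : i ≠ j)
    (hi : i ∉ x.crashed ∪ x.report) (hj : j ∉ x.crashed ∪ x.report) (good : GoodNext i x)
    (hph : x.phase ≠ .waitAlone) :
    DetectSpec i j x (detectCrash i j x) := by
  unfold detectCrash
  simp only [hj, if_false]
  set y : NodeState N := { x with report := insert j x.report } with hy
  have hsub : ∀ z, z ∈ x.crashed ∪ x.report → z ∈ y.crashed ∪ y.report := by
    intro z hz
    simp only [hy, mem_union, mem_insert] at hz ⊢
    tauto
  have hiy : i ∉ y.crashed ∪ y.report := by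
    simp only [hy, mem_union, mem_insert] at hi ⊢
    tauto
  have hjy : j ∈ y.crashed ∪ y.report := by simp [hy]
  by_cases hn : j = x.next
  · have hn' : j = y.next := hn
    rw [if_pos hn']
    have spec := newSuccessor_spec (x := y) hiy (hn' ▸ hjy) (fun z hz => hsub z (good.gap z hz))
    set z := newSuccessor i y with hz
    rcases spec.phase with ⟨h1, h2⟩ | ⟨h1, h2⟩
    · simp only [h2]
      exact ⟨spec.alive, spec.active, spec.count, spec.seq, spec.crashed, spec.report, spec.good,
        spec.black, Or.inl ⟨h1, h2⟩, fun _ => Or.inl h2, Or.inl ⟨spec.stored, rfl, Or.inl ⟨h1, h2⟩⟩⟩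
    · have h3 : z.phase ≠ .waitAlone := by rw [h2]; exact hph
      have hs : z.seq = x.seq := spec.seq
      split
      · contradiction
      · by_cases h4 : 0 < z.seq ∨ z.next < i
        · rw [if_pos h4]
          have hst : z.stored = x.stored := spec.stored
          refine ⟨spec.alive, spec.active, spec.count, spec.seq, spec.crashed, spec.report,
            ⟨spec.good.gap, spec.good.notMem⟩, spec.black, Or.inr h2,
            fun h => absurd h h1, Or.inr ⟨rfl, h1, ?_, rfl, ?_, spec.further, ?_⟩⟩
          · simp only [hst]
          · rw [← hs]; tauto
          · simp only [hst, hs]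
        · rw [if_neg h4]
          refine ⟨spec.alive, spec.active, spec.count, spec.seq, spec.crashed, spec.report,
            spec.good, spec.black, Or.inr h2, fun h => absurd h h1,
            Or.inl ⟨spec.stored, rfl, Or.inr (Or.inr ?_)⟩⟩
          rw [← hs]
          push Not at h4
          exact ⟨by omega, by simpa using h4.2⟩
  · have hn' : ¬ j = y.next := hn
    rw [if_neg hn']
    refine ⟨rfl, rfl, rfl, rfl, rfl, rfl, ⟨fun z hz => hsub z (good.gap z hz), ?_⟩, le_rfl,
      Or.inr rfl, Or.inr, Or.inl ⟨rfl, rfl, Or.inr (Or.inl rfl)⟩⟩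
    have := good.notMem
    simp only [hy, mem_union, mem_insert] at this ⊢
    tauto

/-- The sum over the nodes `j` outside `S` of the counts for `j`. -/
def countOutside (S : Finset (Fin N)) (c : Fin N → ℤ) : ℤ := ∑ j ∈ univ \ S, c j

structure AnnounceSpec (i : Fin N) (t : Token N) (x : NodeState N)
    (r : NodeState N × Option (Fin N × Token N)) : Prop where
  alive : r.1.alive = x.alive
  active : r.1.active = x.active
  count : r.1.count = x.count
  seq : r.1.seq = x.seq
  next : r.1.next = x.next
  stored : r.1.stored = x.stored
  crashed : r.1.crashed = x.crashed ∪ t.crashed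
  report : r.1.report = x.report \ (t.crashed \ x.crashed)
  phase : r.1.phase = .announced
  send : r.2 = none
  black : x.black = i
  tokenBlack : t.black = i
  sum : countOutside (x.crashed ∪ t.crashed) (Function.update t.count i
    (countOutside (x.crashed ∪ t.crashed) x.count)) = 0

structure AloneSpec (i : Fin N) (t : Token N) (x : NodeState N)
    (r : NodeState N × Option (Fin N × Token N)) : Prop where
  alive : r.1.alive = x.alive
  active : r.1.active = x.active
  count : r.1.count = x.count
  seq : r.1.seq = x.seq
  next : r.1.next = i
  stored : r.1.stored = x.stored
  crashed : r.1.crashed = x.crashed ∪ t.crashed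
  report : r.1.report = x.report \ (t.crashed \ x.crashed)
  good : GoodNext i r.1
  phase : r.1.phase = .waitAlone
  send : r.2 = none
  black : cdist i x.black ≤ cdist i r.1.black

structure ForwardSpec (i : Fin N) (t : Token N) (x : NodeState N)
    (r : NodeState N × Option (Fin N × Token N)) : Prop where
  alive : r.1.alive = x.alive
  active : r.1.active = x.active
  count : r.1.count = x.count
  seq : r.1.seq = x.seq + 1
  crashed : r.1.crashed = x.crashed ∪ t.crashed ∪ x.report
  report : r.1.report = ∅
  black : r.1.black = i
  good : GoodNext i r.1
  phase : r.1.phase = .idle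
  send : r.2 = some (r.1.next, r.1.stored)
  tokenSeq : r.1.stored.seq = if r.1.next < i then t.seq + 1 else t.seq
  tokenCrashed : r.1.stored.crashed = (t.crashed \ x.crashed) ∪ x.report
  tokenCount : ∀ k ≠ i, r.1.stored.count k = t.count k
  -- Either the token becomes black for a whole lap, or `i` has nothing to report beyond the token,
  -- and the token carries the current count of `i`.
  tokenBlack : r.1.stored.black = i ∨
    (x.report ⊆ t.crashed \ x.crashed ∧ cdist i x.black ≤ cdist i r.1.stored.black ∧
      cdist i t.black ≤ cdist i r.1.stored.black ∧
      cdist i r.1.next ≤ cdist i r.1.stored.black ∧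
      r.1.stored.count i = countOutside (x.crashed ∪ t.crashed) x.count)
  self : r.1.next = i → x.next = i
  not_announce : x.black = i → t.black = i → countOutside (x.crashed ∪ t.crashed)
    (Function.update t.count i (countOutside (x.crashed ∪ t.crashed) x.count)) ≠ 0
  -- For liveness bounds do not suffice: the black distance must be known exactly in order to see it
  -- decrease.
  reported : x.report = ∅ → x.next ∉ t.crashed → r.1.next = x.next ∧
    r.1.stored.count i = countOutside (x.crashed ∪ t.crashed) x.count ∧
    cdist i r.1.stored.black = max (max (cdist i x.black) (cdist i t.black)) (cdist i x.next)

-- The outcomes are an announcement, being left alone, and forwarding. The invariants are checked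
-- against these specifications instead of the code.
set_option maxHeartbeats 1000000 in
lemma processToken_spec [NeZero N] {i : Fin N} {t : Token N} {x : NodeState N}
    (hi : i ∉ x.crashed ∪ x.report) (hit : i ∉ t.crashed) (good : GoodNext i x) :
    AnnounceSpec i t x (processToken i t x) ∨ AloneSpec i t x (processToken i t x) ∨
      ForwardSpec i t x (processToken i t x) := by
  have hC : x.crashed ∪ (t.crashed \ x.crashed) = x.crashed ∪ t.crashed := by
    ext z; simp only [mem_union, mem_sdiff]; tauto
  unfold processToken
  simp only [hC]
  set y : NodeState N :=
    { x with
      phase := .idle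
      black := furthest i x.black t.black
      crashed := x.crashed ∪ t.crashed
      report := x.report \ (t.crashed \ x.crashed) } with hy
  have hblack : cdist i y.black = max (cdist i x.black) (cdist i t.black) := cdist_furthest _ _ _
  set cnt : Fin N → ℤ := if y.black = i ∨ y.report = ∅ then
      Function.update t.count i (∑ j ∈ univ \ (x.crashed ∪ t.crashed), y.count j)
    else t.count with hcnt
  by_cases hA : y.black = i ∧ ∑ j ∈ univ \ (x.crashed ∪ t.crashed), cnt j = 0
  · left
    rw [if_pos hA]
    have hb := hA.1
    rw [← cdist_eq_zero, hblack] at hb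
    refine ⟨rfl, rfl, rfl, rfl, rfl, rfl, rfl, rfl, rfl, rfl, cdist_eq_zero.mp (by omega),
      cdist_eq_zero.mp (by omega), ?_⟩
    have h2 := hA.2
    rw [hcnt, if_pos (Or.inl hA.1)] at h2
    exact h2
  · right
    rw [if_neg hA]
    have hsub : ∀ z, z ∈ x.crashed ∪ x.report → z ∈ y.crashed ∪ y.report := by
      intro z hz
      simp only [hy, mem_union, mem_sdiff] at hz ⊢
      tauto
    have hsub' : ∀ z, z ∈ y.crashed ∪ y.report ↔ z ∈ x.crashed ∪ t.crashed ∪ x.report := by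
      intro z
      simp only [hy, mem_union, mem_sdiff]
      tauto
    have hiy : i ∉ y.crashed ∪ y.report := by
      simp only [hsub', mem_union] at hi ⊢
      tauto
    set z : NodeState N := if y.next ∈ t.crashed \ x.crashed then newSuccessor i y else y with hz
    have hzs : SameCore y z ∧ GoodNext i z ∧ cdist i y.black ≤ cdist i z.black ∧
        ((z.next = i ∧ z.phase = .waitAlone) ∨ (z.phase = .idle ∧ (z.next = i → x.next = i))) ∧
        (x.next ∉ t.crashed → z = y) := by
      by_cases hn : y.next ∈ t.crashed \ x.crashed
      · have hyn : y.next ∈ y.crashed ∪ y.report := by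
          rw [hsub']; simp only [mem_sdiff, mem_union] at hn ⊢; tauto
        have sp := newSuccessor_spec (x := y) hiy hyn (fun z hz => hsub z (good.gap z hz))
        rw [hz, if_pos hn]
        refine ⟨sp.toSameCore, sp.good, sp.black, ?_, fun h => absurd (mem_sdiff.mp hn).1 h⟩
        rcases sp.phase with h | h
        · exact Or.inl h
        · exact Or.inr ⟨h.2, fun h' => absurd h' h.1⟩
      · rw [hz, if_neg hn]
        refine ⟨⟨rfl, rfl, rfl, rfl, rfl, rfl, rfl⟩,
          ⟨fun z hz => hsub z (good.gap z hz), ?_⟩, le_rfl, Or.inr ⟨rfl, id⟩, fun _ => rfl⟩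
        have := good.notMem
        rw [hsub']
        simp only [hy, mem_sdiff, mem_union] at hn this ⊢
        tauto
    obtain ⟨core, hgood, hbl, hph, hzy⟩ := hzs
    rcases hph with ⟨h1, h2⟩ | ⟨h2, hself⟩
    · left
      simp only [h2]
      exact ⟨core.alive, core.active, core.count, core.seq, h1, core.stored, core.crashed,
        core.report, hgood, h2, rfl, le_trans (by omega) hbl⟩
    · right
      have hcr : z.crashed ∪ z.report = x.crashed ∪ t.crashed ∪ x.report := by
        rw [core.crashed, core.report]; ext w; exact hsub' w
      split
      · next h3 => rw [h2] at h3; cases h3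
      · refine ⟨core.alive, core.active, core.count, ?_, hcr, rfl, rfl, ⟨?_, ?_⟩, h2, rfl, ?_, ?_,
          ?_, ?_, hself, ?_, ?_⟩
        · simp only [core.seq]; rfl
        · intro w hw
          simpa using hgood.gap w hw
        · simpa using hgood.notMem
        · simp only; split_ifs <;> rfl
        · have hr : z.report = x.report \ (t.crashed \ x.crashed) := core.report
          by_cases h4 : z.report = ∅
          · simp only [if_neg (not_not.mpr h4)]
            rw [hr, sdiff_eq_empty_iff_subset] at h4
            exact (union_eq_left.mpr h4).symm
          · simp only [if_pos h4]
            rw [hr]; ext w; simp only [mem_union, mem_sdiff]; tauto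
        · intro k hk
          simp only
          have hck : cnt k = t.count k := by
            rw [hcnt]; split_ifs
            · exact Function.update_of_ne hk _ _
            · rfl
          split_ifs <;> exact hck
        · have hr : z.report = x.report \ (t.crashed \ x.crashed) := core.report
          by_cases h4 : z.report = ∅
          · simp only [if_neg (not_not.mpr h4)]
            right
            have h5 : x.report ⊆ t.crashed \ x.crashed := by
              rw [hr, sdiff_eq_empty_iff_subset] at h4; exact h4
            have hm := cdist_furthest i z.black z.next
            refine ⟨h5, ?_, ?_, ?_, ?_⟩
            · omega
            · omega
            · omega
            · rw [hcnt, if_pos (Or.inr (by rw [← h4, hr]))]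
              simp [countOutside, hy]
          · simp only [if_pos h4]
            exact Or.inl trivial
        · intro hb1 hb2 hs
          have hyb : y.black = i := by
            rw [← cdist_eq_zero, hblack, hb1, hb2, cdist_self]; rfl
          refine hA ⟨hyb, ?_⟩
          rw [hcnt, if_pos (Or.inl hyb)]
          exact hs
        · intro hr hn
          have hz0 := hzy hn
          have hr' : y.report = ∅ := by simp [hy, hr]
          have hzr : z.report = ∅ := by rw [hz0, hr']
          simp only [if_neg (not_not.mpr hzr)]
          refine ⟨by rw [hz0], ?_, ?_⟩
          · rw [hcnt, if_pos (Or.inr hr')]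
            simp [countOutside, hy]
          · rw [cdist_furthest, hz0, hblack]

/-! ### The invariant of the control algorithm. -/

/-- The node is alive, and its control algorithm still handles tokens. -/
def NodeState.Running (x : NodeState N) : Prop :=
  x.alive = true ∧ (x.phase = .idle ∨ ∃ t, x.phase = .waitToken t)

def TokenAt (s : State N) (b : Fin N) (t : Token N) : Prop :=
  (b, t) ∈ s.tokens ∨ (s.nodes b).phase = .waitToken t

/-- The token `t` is held by `b`, or it will be accepted if it is received next. -/
def Valid (s : State N) (b : Fin N) (t : Token N) : Prop :=
  (s.nodes b).Running ∧ t.seq = (s.nodes b).seq + 1 ∧ TokenAt s b t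

/-- `p` has forwarded the token in the round in which `b` still has to receive it. -/
def Due (s : State N) (p b : Fin N) : Prop :=
  b ≠ p ∧ (b < p → (s.nodes b).seq = (s.nodes p).seq) ∧
    (p < b → (s.nodes b).seq + 1 = (s.nodes p).seq)

/-- The nodes `z` range over those that the token and `b` do not know to have crashed; they need not
be alive. By `agree`, crash sets differ only in crashes that the token is reporting. By `segment`,
such a crash is known on a final stretch of the lap that starts at `b`: the nodes that the report
has already passed. -/
structure TokenCore (s : State N) (b : Fin N) (t : Token N) : Prop where
  seq_lt : ∀ z ∉ (s.nodes b).crashed ∪ t.crashed, z < b → (s.nodes b).seq + 1 ≤ (s.nodes z).seq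
  seq_le : ∀ z ∉ (s.nodes b).crashed ∪ t.crashed, (s.nodes b).seq ≤ (s.nodes z).seq
  agree : ∀ z ∉ (s.nodes b).crashed ∪ t.crashed, ∀ x ∉ t.crashed,
    (x ∈ (s.nodes b).crashed ↔ x ∈ (s.nodes z).crashed)
  segment : ∀ z ∉ (s.nodes b).crashed ∪ t.crashed, ∀ z' ∉ (s.nodes b).crashed ∪ t.crashed,
    ∀ x ∈ t.crashed, cdist b z ≤ cdist b z' → x ∈ (s.nodes z).crashed → x ∈ (s.nodes z').crashed

/-- The nodes visited since the last time that the token was black at its destination, and known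
to be alive by the token, know all crashes that the token reports. -/
def TokenWindow (s : State N) (b : Fin N) (t : Token N) : Prop :=
  ∀ z ∉ (s.nodes b).crashed ∪ t.crashed, cdist b t.black < cdist b z →
    t.crashed ⊆ (s.nodes z).crashed

/-- These are the facts that make the stored token of `p` a valid replacement at `b`. They concern
the nodes from `b` round to `p`, which the token has not reached since `p` forwarded it. Crashes in
`report` were detected after that, so by `fresh` these nodes cannot have learnt of them from the
token. -/
structure StoredOK (s : State N) (p b : Fin N) : Prop where
  segment : ∀ z ∉ (s.nodes p).crashed ∪ (s.nodes p).report,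
    ∀ z' ∉ (s.nodes p).crashed ∪ (s.nodes p).report,
    ∀ x ∈ (s.nodes p).stored.crashed, sdist p b ≤ sdist p z → sdist p z ≤ sdist p z' →
      x ∈ (s.nodes z).crashed → x ∈ (s.nodes z').crashed
  fresh : ∀ z ∉ (s.nodes p).crashed ∪ (s.nodes p).report, ∀ x ∈ (s.nodes p).report,
    sdist p b ≤ sdist p z → x ∉ (s.nodes z).crashed
  agree : ∀ z ∉ (s.nodes p).crashed ∪ (s.nodes p).report,
    ∀ x ∉ (s.nodes p).stored.crashed, x ∉ (s.nodes p).report → sdist p b ≤ sdist p z →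
      (x ∈ (s.nodes p).crashed ↔ x ∈ (s.nodes z).crashed)

/-- The invariant of the control algorithm. -/
structure ControlInv (s : State N) : Prop where
  dead : ∀ i, ∀ z ∈ (s.nodes i).crashed ∪ (s.nodes i).report, (s.nodes z).alive = false
  token_dead : ∀ b t, TokenAt s b t → ∀ z ∈ t.crashed, (s.nodes z).alive = false
  stored_sub : ∀ p, (s.nodes p).stored.crashed ⊆ (s.nodes p).crashed ∪ (s.nodes p).report
  good : ∀ p, (s.nodes p).alive = true → (s.nodes p).phase ≠ .announced → GoodNext p (s.nodes p)
  alone : ∀ p, (s.nodes p).phase = .waitAlone → (s.nodes p).next = p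
  held_seq : ∀ p t, (s.nodes p).phase = .waitToken t → t.seq = (s.nodes p).seq + 1
  stored_seq : ∀ p, (s.nodes p).alive = true → 0 < (s.nodes p).seq → p < (s.nodes p).next →
    (s.nodes p).stored.seq = (s.nodes p).seq
  -- In the upper bounds `z` may have crashed: messages that it sent earlier can still arrive at
  -- `b`.
  upper_lt : ∀ b z, (s.nodes b).alive = true → b < z → (s.nodes z).seq ≤ (s.nodes b).seq
  upper : ∀ b z, (s.nodes b).alive = true → (s.nodes z).seq ≤ (s.nodes b).seq + 1
  -- In the lower bounds nodes known to have crashed are excluded, since their numbers lag behind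
  -- without limit.
  lower_lt : ∀ p z, (s.nodes p).alive = true → z ∉ (s.nodes p).crashed → z < p →
    (s.nodes p).seq ≤ (s.nodes z).seq
  lower : ∀ p z, (s.nodes p).alive = true → z ∉ (s.nodes p).crashed →
    (s.nodes p).seq ≤ (s.nodes z).seq + 1
  -- Tokens in transit may be stale, but never belong to a future visit of their destination.
  token_le : ∀ b t, (b, t) ∈ s.tokens → (s.nodes b).alive = true → t.seq ≤ (s.nodes b).seq + 1
  token : ∀ b t, Valid s b t → TokenCore s b t
  window : ∀ b t, Valid s b t → TokenWindow s b t
  stored : ∀ p b, (s.nodes p).Running → (s.nodes b).Running → Due s p b → StoredOK s p b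

/-! ### The position of the valid token, read off from the sequence numbers. -/

section Frontier
variable {s : State N}

lemma ControlInv.notMem (h : ControlInv s) {i z : Fin N} (hz : (s.nodes z).alive = true) :
    z ∉ (s.nodes i).crashed ∪ (s.nodes i).report := by
  intro hm
  rw [h.dead i z hm] at hz
  cases hz

lemma ControlInv.notMem_crashed (h : ControlInv s) {i z : Fin N}
    (hz : (s.nodes z).alive = true) : z ∉ (s.nodes i).crashed :=
  fun hm => h.notMem hz (mem_union_left _ hm)

lemma ControlInv.notMem_token (h : ControlInv s) {i z : Fin N} {t : Token N} (ht : TokenAt s i t)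
    (hz : (s.nodes z).alive = true) : z ∉ t.crashed := by
  intro hm
  rw [h.token_dead i t ht z hm] at hz
  cases hz

lemma ControlInv.notMem_excluded (h : ControlInv s) {i z : Fin N} {t : Token N}
    (ht : TokenAt s i t) (hz : (s.nodes z).alive = true) :
    z ∉ (s.nodes i).crashed ∪ t.crashed := by
  rw [mem_union]
  rintro (hm | hm)
  · exact h.notMem_crashed hz hm
  · exact h.notMem_token ht hz hm

/-- Below the position of a valid token, alive nodes are one round ahead. -/
lemma ControlInv.seq_of_lt (h : ControlInv s) {w b : Fin N} {t : Token N} (hv : Valid s w t)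
    (hb : (s.nodes b).alive = true) (hlt : b < w) :
    (s.nodes b).seq = (s.nodes w).seq + 1 :=
  le_antisymm (h.upper w b hv.1.1)
    ((h.token w t hv).seq_lt b (h.notMem_excluded hv.2.2 hb) hlt)

lemma ControlInv.seq_of_gt (h : ControlInv s) {w b : Fin N} {t : Token N} (hv : Valid s w t)
    (hb : (s.nodes b).alive = true) (hlt : w < b) :
    (s.nodes b).seq = (s.nodes w).seq :=
  le_antisymm (h.upper_lt w b hv.1.1 hlt)
    ((h.token w t hv).seq_le b (h.notMem_excluded hv.2.2 hb))

/-- Valid tokens are at the same node. -/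
lemma ControlInv.valid_unique (h : ControlInv s) {w b : Fin N} {t t' : Token N}
    (hv : Valid s w t) (hb : Valid s b t') : b = w := by
  rcases lt_trichotomy b w with hlt | rfl | hlt
  · have h1 := h.seq_of_lt hv hb.1.1 hlt
    have h2 := h.seq_of_gt hb hv.1.1 hlt
    omega
  · rfl
  · have h1 := h.seq_of_gt hv hb.1.1 hlt
    have h2 := h.seq_of_lt hb hv.1.1 hlt
    omega

/-- The token has left `p` and has not been processed at `b`, so it is at `b` or strictly between
them on the way from `p`. In the second case a visit to `w` leaves the nodes from `b` round to `p`
untouched. -/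
lemma ControlInv.due_of_valid (h : ControlInv s) {w p b : Fin N} {t : Token N}
    (hv : Valid s w t) (hp : (s.nodes p).alive = true) (hb : (s.nodes b).alive = true)
    (hd : Due s p b) : b = w ∨ (p ≠ w ∧ sdist p w < sdist p b) := by
  obtain ⟨hne, hd1, hd2⟩ := hd
  by_cases hbw : b = w
  · exact Or.inl hbw
  right
  have b1 := h.seq_of_lt hv hb
  have b2 := h.seq_of_gt hv hb
  have p1 := h.seq_of_lt hv hp
  have p2 := h.seq_of_gt hv hp
  have hbw' : b.val ≠ w.val := fun e => hbw (Fin.ext e)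
  have hbp : b.val ≠ p.val := fun e => hne (Fin.ext e)
  have hpN := p.isLt; have hbN := b.isLt; have hwN := w.isLt
  simp only [Fin.lt_def] at *
  refine ⟨?_, ?_⟩
  · rintro rfl
    omega
  · unfold sdist
    by_cases hpw : p = w
    · subst hpw
      omega
    · have hpw' : p.val ≠ w.val := fun e => hpw (Fin.ext e)
      split_ifs <;> omega

end Frontier

/-! ### Preservation of the control invariant. -/

/-- A step that leaves the control variables alone, except that a token may be accepted or lost. -/
structure Quiet (s s' : State N) : Prop where
  alive : ∀ z, (s'.nodes z).alive = true → (s.nodes z).alive = true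
  seq : ∀ z, (s'.nodes z).seq = (s.nodes z).seq
  next : ∀ z, (s'.nodes z).next = (s.nodes z).next
  crashed : ∀ z, (s'.nodes z).crashed = (s.nodes z).crashed
  report : ∀ z, (s'.nodes z).report = (s.nodes z).report
  stored : ∀ z, (s'.nodes z).stored = (s.nodes z).stored
  alone : ∀ z, (s'.nodes z).phase = .waitAlone ↔ (s.nodes z).phase = .waitAlone
  announced : ∀ z, (s'.nodes z).phase = .announced ↔ (s.nodes z).phase = .announced
  held : ∀ z t, (s'.nodes z).phase = .waitToken t → t.seq = (s.nodes z).seq + 1 ∨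
    (s.nodes z).phase = .waitToken t
  tokens : ∀ b t, (b, t) ∈ s'.tokens → (b, t) ∈ s.tokens
  tokenAt : ∀ b t, TokenAt s' b t → TokenAt s b t

lemma running_iff (x : NodeState N) :
    x.Running ↔ x.alive = true ∧ x.phase ≠ .waitAlone ∧ x.phase ≠ .announced := by
  unfold NodeState.Running
  cases x.phase <;> simp

lemma Quiet.running {s s' : State N} (q : Quiet s s') {z : Fin N} (h : (s'.nodes z).Running) :
    (s.nodes z).Running := by
  rw [running_iff] at h ⊢
  rw [Ne, Ne, ← q.alone, ← q.announced]
  exact ⟨q.alive z h.1, h.2⟩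

lemma Quiet.valid {s s' : State N} (q : Quiet s s') {b : Fin N} {t : Token N}
    (h : Valid s' b t) : Valid s b t :=
  ⟨q.running h.1, by rw [← q.seq]; exact h.2.1, q.tokenAt _ _ h.2.2⟩

lemma dead_of_alive_imp {x y : NodeState N} (h : y.alive = true → x.alive = true)
    (hx : x.alive = false) : y.alive = false := by
  by_contra hc
  rw [Bool.not_eq_false] at hc
  rw [h hc] at hx
  cases hx

lemma ControlInv.quiet {s s' : State N} (h : ControlInv s) (q : Quiet s s') : ControlInv s' where
  dead i z hz := by
    rw [q.crashed, q.report] at hz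
    exact dead_of_alive_imp (q.alive z) (h.dead i z hz)
  token_dead b t ht z hz := dead_of_alive_imp (q.alive z) (h.token_dead b t (q.tokenAt b t ht) z hz)
  stored_sub p := by rw [q.crashed, q.report, q.stored]; exact h.stored_sub p
  good p hp hph := by
    have := h.good p (q.alive p hp) (by rwa [Ne, ← q.announced])
    refine ⟨?_, ?_⟩
    · rw [q.next, q.crashed, q.report]; exact this.gap
    · rw [q.next, q.crashed, q.report]; exact this.notMem
  alone p hp := by rw [q.next]; exact h.alone p ((q.alone p).mp hp)
  held_seq p t ht := by
    rw [q.seq]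
    rcases q.held p t ht with h1 | h1
    · exact h1
    · exact h.held_seq p t h1
  stored_seq p hp := by
    rw [q.seq, q.next, q.stored]; exact h.stored_seq p (q.alive p hp)
  upper_lt b z hb := by rw [q.seq, q.seq]; exact h.upper_lt b z (q.alive b hb)
  upper b z hb := by rw [q.seq, q.seq]; exact h.upper b z (q.alive b hb)
  lower_lt p z hp := by rw [q.seq, q.seq, q.crashed]; exact h.lower_lt p z (q.alive p hp)
  lower p z hp := by rw [q.seq, q.seq, q.crashed]; exact h.lower p z (q.alive p hp)
  token_le b t ht hb := by rw [q.seq]; exact h.token_le b t (q.tokens b t ht) (q.alive b hb)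
  token b t hv := by
    have := h.token b t (q.valid hv)
    constructor
    · simp only [q.seq, q.crashed]; exact this.seq_lt
    · simp only [q.seq, q.crashed]; exact this.seq_le
    · simp only [q.crashed]; exact this.agree
    · simp only [q.crashed]; exact this.segment
  window b t hv := by
    have := h.window b t (q.valid hv)
    unfold TokenWindow at *
    simpa only [q.crashed] using this
  stored p b hp hb hd := by
    have := h.stored p b (q.running hp) (q.running hb) (by simpa only [Due, q.seq] using hd)
    constructor
    · simp only [q.crashed, q.report, q.stored]; exact this.segment
    · simp only [q.crashed, q.report]; exact this.fresh
    · simp only [q.crashed, q.report, q.stored]; exact this.agree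

/-- The token that `p` sends to its successor. -/
lemma tokenCore_of_stored {s : State N} {p b : Fin N}
    (dead : ∀ i, ∀ z ∈ (s.nodes i).crashed ∪ (s.nodes i).report, (s.nodes z).alive = false)
    (gap : ∀ z, sdist p z < sdist p b → z ∈ (s.nodes p).crashed ∪ (s.nodes p).report)
    (lower_lt : ∀ z, z ∉ (s.nodes p).crashed → z < p → (s.nodes p).seq ≤ (s.nodes z).seq)
    (lower : ∀ z, z ∉ (s.nodes p).crashed → (s.nodes p).seq ≤ (s.nodes z).seq + 1)
    (sub : (s.nodes p).report ⊆ (s.nodes p).stored.crashed)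
    (ok : StoredOK s p b) (due : Due s p b) (hb : (s.nodes b).alive = true) :
    TokenCore s b (s.nodes p).stored ∧
      ∀ z ∉ (s.nodes b).crashed ∪ (s.nodes p).stored.crashed,
        z ∉ (s.nodes p).crashed ∪ (s.nodes p).report ∧ sdist p b ≤ sdist p z := by
  have hbn : b ∉ (s.nodes p).crashed ∪ (s.nodes p).report := by
    intro hm
    rw [dead p b hm] at hb
    cases hb
  -- Nodes skipped between `p` and `b` are known to have crashed, so every node that the token does
  -- not exclude lies from `b` round to `p`, where `StoredOK` applies.
  have key : ∀ z ∉ (s.nodes b).crashed ∪ (s.nodes p).stored.crashed,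
      z ∉ (s.nodes p).crashed ∪ (s.nodes p).report ∧ sdist p b ≤ sdist p z := by
    intro z hz
    rw [mem_union, not_or] at hz
    have h1 : z ∉ (s.nodes p).report := fun h => hz.2 (sub h)
    have h2 : z ∉ (s.nodes p).crashed := fun h =>
      hz.1 ((ok.agree b hbn z hz.2 h1 le_rfl).mp h)
    have h3 : z ∉ (s.nodes p).crashed ∪ (s.nodes p).report := by
      rw [mem_union, not_or]; exact ⟨h2, h1⟩
    exact ⟨h3, not_lt.mp fun h => h3 (gap z h)⟩
  obtain ⟨hne, hd1, hd2⟩ := due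
  have hbp : b.val ≠ p.val := fun e => hne (Fin.ext e)
  have hpN := p.isLt; have hbN := b.isLt
  refine ⟨⟨?_, ?_, ?_, ?_⟩, key⟩
  · intro z hz hlt
    obtain ⟨h1, h2⟩ := key z hz
    have hzN := z.isLt
    have l1 := lower_lt z (fun h => h1 (mem_union_left _ h))
    simp only [Fin.lt_def] at *
    unfold sdist at h2
    by_cases hzp : z.val = p.val
    · have : z = p := Fin.ext hzp
      subst this
      omega
    · split_ifs at h2 <;> omega
  · intro z hz
    obtain ⟨h1, h2⟩ := key z hz
    have hzN := z.isLt
    have l1 := lower_lt z (fun h => h1 (mem_union_left _ h))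
    have l2 := lower z (fun h => h1 (mem_union_left _ h))
    simp only [Fin.lt_def] at *
    unfold sdist at h2
    by_cases hzp : z.val = p.val
    · have : z = p := Fin.ext hzp
      subst this
      omega
    · split_ifs at h2 <;> omega
  · intro z hz x hx
    obtain ⟨h1, h2⟩ := key z hz
    have hxr : x ∉ (s.nodes p).report := fun h => hx (sub h)
    rw [← ok.agree b hbn x hx hxr le_rfl, ok.agree z h1 x hx hxr h2]
  · intro z hz z' hz' x hx hle
    obtain ⟨h1, h2⟩ := key z hz
    obtain ⟨h1', h2'⟩ := key z' hz'
    rw [cdist_of_sdist_le h2, cdist_of_sdist_le h2'] at hle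
    exact ok.segment z h1 z' h1' x hx h2 (by omega)

lemma setNodeSend_self (s : State N) (w : Fin N) (r : NodeState N × Option (Fin N × Token N)) :
    (s.setNodeSend w r).nodes w = r.1 := by
  simp [State.setNodeSend, State.setNode]

lemma setNodeSend_of_ne (s : State N) {w z : Fin N} (r : NodeState N × Option (Fin N × Token N))
    (h : z ≠ w) : (s.setNodeSend w r).nodes z = s.nodes z := by
  simp [State.setNodeSend, State.setNode, h]

lemma mem_setNodeSend (s : State N) {w b : Fin N} {t : Token N}
    (r : NodeState N × Option (Fin N × Token N)) :
    (b, t) ∈ (s.setNodeSend w r).tokens ↔ (b, t) ∈ s.tokens ∨ r.2 = some (b, t) := by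
  unfold State.setNodeSend
  rcases r.2 with _ | d
  · simp
  · simp [eq_comm]

lemma setNode_self (s : State N) (w : Fin N) (y : NodeState N) :
    (s.setNode w y).nodes w = y := by
  simp [State.setNode]

lemma setNode_of_ne (s : State N) {w z : Fin N} (y : NodeState N)
    (h : z ≠ w) : (s.setNode w y).nodes z = s.nodes z := by
  simp [State.setNode, h]

/-- A node waiting alone knows that all others have crashed, so it has no crash left to detect. -/
lemma ControlInv.detect_ne_alone {s : State N} (h : ControlInv s) {w j : Fin N}
    (hw : (s.nodes w).alive = true) (hj : (s.nodes j).alive = false)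
    (hn : j ∉ (s.nodes w).crashed ∪ (s.nodes w).report) : (s.nodes w).phase ≠ .waitAlone := by
  intro hp
  have hg := h.good w hw (by rw [hp]; simp)
  have hjw : j ≠ w := by rintro rfl; rw [hw] at hj; cases hj
  apply hn
  apply hg.gap
  rw [h.alone w hp, sdist_self]
  by_contra hc
  exact hjw (eq_of_sdist (not_lt.mp hc))

lemma ControlInv.detectSpec {s : State N} [NeZero N] (h : ControlInv s) {w j : Fin N}
    (hw : (s.nodes w).alive = true) (hj : (s.nodes j).alive = false)
    (hr : (s.nodes w).phase ≠ .announced)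
    (hn : j ∉ (s.nodes w).crashed ∪ (s.nodes w).report) :
    DetectSpec w j (s.nodes w) (detectCrash w j (s.nodes w)) :=
  detectCrash_spec (by rintro rfl; rw [hw] at hj; cases hj) (h.notMem hw) hn (h.good w hw hr)
    (h.detect_ne_alone hw hj hn)

lemma detectCrash_of_mem [NeZero N] {w j : Fin N} {x : NodeState N}
    (hn : j ∈ x.crashed ∪ x.report) : detectCrash w j x = (x, none) := by
  unfold detectCrash; rw [if_pos hn]

lemma setNodeSend_none (s : State N) (w : Fin N) :
    s.setNodeSend w (s.nodes w, none) = s := by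
  simp [State.setNodeSend, State.setNode]

/-- The facts about the backup token that a node sends. -/
lemma ControlInv.backup_due {s : State N} (h : ControlInv s) {w : Fin N}
    {r : NodeState N × Option (Fin N × Token N)} (hw : (s.nodes w).alive = true)
    (hne : r.1.next ≠ w) (hfur : sdist w (s.nodes w).next < sdist w r.1.next)
    (hs : r.1.next < w ∨ 0 < (s.nodes w).seq)
    (hseq : r.1.stored.seq = if r.1.next < w then (s.nodes w).seq + 1
      else (s.nodes w).stored.seq) :
    (r.1.next < w ∧ r.1.stored.seq = (s.nodes w).seq + 1) ∨
      (w < r.1.next ∧ r.1.stored.seq = (s.nodes w).seq) := by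
  by_cases hlt : r.1.next < w
  · left; rw [if_pos hlt] at hseq; exact ⟨hlt, hseq⟩
  · right
    rw [if_neg hlt] at hseq
    have hgt : w < r.1.next := lt_of_le_of_ne (not_lt.mp hlt) (Ne.symm hne)
    -- The successor moved away from `w` and is still above `w`, so the old one was above `w` too,
    -- and the stored token was numbered for the round that `w` has just handled.
    refine ⟨hgt, hseq.trans (h.stored_seq w hw (by tauto) ?_)⟩
    have hwN := w.isLt; have hnN := (s.nodes w).next.isLt; have h1 := r.1.next.isLt
    unfold sdist at hfur
    simp only [Fin.lt_def] at *
    split_ifs at hfur <;> omega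

/-- Seen from `b`, the last node of the stretch from `b` round to `p` is `p`. Hence a token that is
black up to its sender `p` has an empty window. -/
lemma not_lt_cdist_of_sdist_le {p b z : Fin N} (h : sdist p b ≤ sdist p z) :
    ¬ cdist b p < cdist b z := by
  rw [cdist_of_sdist_le h,
    cdist_of_sdist_le (p := p) (z := p) (by rw [sdist_self]; exact sdist_le _ _), sdist_self]
  have := sdist_le p z
  omega

/-- A token that becomes valid by a detection is a backup token sent by the detector. -/
lemma ControlInv.detect_valid {s : State N} [NeZero N] (h : ControlInv s) {w j : Fin N}
    (hw : (s.nodes w).alive = true) (hj : (s.nodes j).alive = false)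
    (hr : (s.nodes w).phase ≠ .announced)
    (hn : j ∉ (s.nodes w).crashed ∪ (s.nodes w).report)
    {s' : State N} (hs' : s' = s.setNodeSend w (detectCrash w j (s.nodes w)))
    {b : Fin N} {t : Token N} (hv : Valid s' b t) :
    Valid s b t ∨ (b = (s'.nodes w).next ∧ t = (s'.nodes w).stored ∧ (s'.nodes w).Running ∧
      Due s' w b ∧ (s'.nodes w).report ⊆ (s'.nodes w).stored.crashed ∧
      (s'.nodes w).stored.black = w) := by
  have spec := h.detectSpec hw hj hr hn
  set r := detectCrash w j (s.nodes w) with hrdef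
  have sw : s'.nodes w = r.1 := by rw [hs']; exact setNodeSend_self s w r
  have so : ∀ z ≠ w, s'.nodes z = s.nodes z := by
    intro z hz; rw [hs']; exact setNodeSend_of_ne s r hz
  have sq : ∀ z, (s'.nodes z).seq = (s.nodes z).seq := by
    intro z; by_cases hz : z = w
    · rw [hz, sw, spec.seq]
    · rw [so z hz]
  have run : (s'.nodes b).Running → (s.nodes b).Running := by
    by_cases hz : b = w
    · subst hz
      rw [sw, running_iff, running_iff, spec.alive]
      rintro ⟨h1, h2, h3⟩
      rcases spec.phase with h4 | h4
      · exact absurd h4.2 h2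
      · rw [h4] at h2 h3; exact ⟨h1, h2, h3⟩
    · rw [so b hz]; exact id
  obtain ⟨hb, hsq, hat⟩ := hv
  rcases hat with hat | hat
  · rw [hs', mem_setNodeSend] at hat
    rcases hat with h1 | h1
    · exact Or.inl ⟨run hb, by rw [hsq, sq], Or.inl h1⟩
    · right
      rcases spec.send with h2 | ⟨h2, hne, hcr, hbl, hs, hfur, hseq⟩
      · rw [h2.2.1] at h1; cases h1
      rw [h2] at h1
      simp only [Option.some.injEq, Prod.mk.injEq] at h1
      obtain ⟨rfl, rfl⟩ := h1
      rw [sw]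
      refine ⟨rfl, rfl, ?_, ?_, ?_, hbl⟩
      · have h4 : r.1.phase = (s.nodes w).phase := by
          rcases spec.phase with h4 | h4
          · exact absurd h4.1 hne
          · exact h4
        rw [running_iff, h4, spec.alive]
        exact ⟨hw, h.detect_ne_alone hw hj hn, hr⟩
      · refine ⟨hne, ?_⟩
        rw [sq, sq]
        rw [sq] at hsq
        rcases h.backup_due hw hne hfur hs hseq with ⟨h3, h4⟩ | ⟨h3, h4⟩
        · exact ⟨fun _ => by omega, fun h5 => absurd h3 (lt_asymm h5)⟩
        · exact ⟨fun h5 => absurd h3 (lt_asymm h5), fun _ => by omega⟩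
      · rw [hcr]; exact subset_union_right
  · refine Or.inl ⟨run hb, by rw [hsq, sq], Or.inr ?_⟩
    by_cases hz : b = w
    · subst hz
      rw [sw] at hat
      rcases spec.phase with h4 | h4
      · rw [h4.2] at hat; cases hat
      · rw [h4] at hat; exact hat
    · rw [so b hz] at hat; exact hat

/-- No crash set and no sequence number changes, so old valid tokens keep their properties. A backup
token gets its core from `StoredOK`, and its window is empty because it is black up to `w`. -/
lemma ControlInv.detect {s : State N} [NeZero N] (h : ControlInv s) {w j : Fin N}
    (hw : (s.nodes w).alive = true) (hj : (s.nodes j).alive = false)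
    (hr : (s.nodes w).phase ≠ .announced) :
    ControlInv (s.setNodeSend w (detectCrash w j (s.nodes w))) := by
  by_cases hn : j ∈ (s.nodes w).crashed ∪ (s.nodes w).report
  · rw [detectCrash_of_mem hn, setNodeSend_none]; exact h
  have spec := h.detectSpec hw hj hr hn
  set r := detectCrash w j (s.nodes w) with hrdef
  set s' := s.setNodeSend w r with hs'
  have sw : s'.nodes w = r.1 := setNodeSend_self s w r
  have so : ∀ z ≠ w, s'.nodes z = s.nodes z := fun z hz => setNodeSend_of_ne s r hz
  have al : ∀ z, (s'.nodes z).alive = (s.nodes z).alive := by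
    intro z; by_cases hz : z = w
    · rw [hz, sw, spec.alive]
    · rw [so z hz]
  have sq : ∀ z, (s'.nodes z).seq = (s.nodes z).seq := by
    intro z; by_cases hz : z = w
    · rw [hz, sw, spec.seq]
    · rw [so z hz]
  have cr : ∀ z, (s'.nodes z).crashed = (s.nodes z).crashed := by
    intro z; by_cases hz : z = w
    · rw [hz, sw, spec.crashed]
    · rw [so z hz]
  have rw' : (s'.nodes w).report = insert j (s.nodes w).report := by rw [sw, spec.report]
  have run : ∀ z, (s'.nodes z).Running → (s.nodes z).Running := by
    intro z; by_cases hz : z = w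
    · subst hz
      rw [sw, running_iff, running_iff, spec.alive]
      rintro ⟨h1, h2, h3⟩
      rcases spec.phase with h4 | h4
      · exact absurd h4.2 h2
      · rw [h4] at h2 h3; exact ⟨h1, h2, h3⟩
    · rw [so z hz]; exact id
  have held : ∀ z t, (s'.nodes z).phase = .waitToken t → (s.nodes z).phase = .waitToken t := by
    intro z t; by_cases hz : z = w
    · subst hz
      rw [sw]
      rcases spec.phase with h4 | h4
      · rw [h4.2]; intro h5; cases h5
      · rw [h4]; exact id
    · rw [so z hz]; exact id
  have tok : ∀ b t, (b, t) ∈ s'.tokens → (b, t) ∈ s.tokens ∨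
      (b = r.1.next ∧ t = r.1.stored ∧ r.2 = some (r.1.next, r.1.stored)) := by
    intro b t ht
    rcases (mem_setNodeSend s r).mp ht with h1 | h1
    · exact Or.inl h1
    · rcases spec.send with h2 | h2
      · rw [h2.2.1] at h1; cases h1
      · rw [h2.1] at h1
        simp only [Option.some.injEq, Prod.mk.injEq] at h1
        exact Or.inr ⟨h1.1.symm, h1.2.symm, h2.1⟩
  have dead' : ∀ i, ∀ z ∈ (s'.nodes i).crashed ∪ (s'.nodes i).report,
      (s'.nodes z).alive = false := by
    intro i z hz
    rw [al]
    by_cases hi : i = w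
    · subst hi
      rw [cr, rw'] at hz
      simp only [mem_union, mem_insert] at hz
      rcases hz with hz | rfl | hz
      · exact h.dead i z (mem_union_left _ hz)
      · exact hj
      · exact h.dead i z (mem_union_right _ hz)
    · rw [so i hi] at hz; exact h.dead i z hz
  have sub' : ∀ p, (s'.nodes p).stored.crashed ⊆ (s'.nodes p).crashed ∪ (s'.nodes p).report := by
    intro p
    by_cases hp : p = w
    · subst hp
      rw [cr, rw', sw]
      have h0 := h.stored_sub p
      intro z hz
      simp only [mem_union, mem_insert]
      rcases spec.send with h2 | h2
      · rw [h2.1] at hz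
        have := h0 hz
        rw [mem_union] at this
        tauto
      · rw [h2.2.2.1, spec.report] at hz
        simp only [mem_union, mem_insert] at hz
        rcases hz with hz | hz
        · have := h0 hz
          rw [mem_union] at this
          tauto
        · tauto
    · rw [so p hp]; exact h.stored_sub p
  have stored' : ∀ p b, (s'.nodes p).Running → (s'.nodes b).Running → Due s' p b →
      StoredOK s' p b := by
    intro p b hp hb hd
    have ok := h.stored p b (run p hp) (run b hb) (by simpa only [Due, sq] using hd)
    by_cases hpw : p = w
    · subst hpw
      have hnm : ∀ z, z ∉ (s'.nodes p).crashed ∪ (s'.nodes p).report →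
          z ∉ (s.nodes p).crashed ∪ (s.nodes p).report := by
        intro z
        rw [cr, rw']
        simp only [mem_union, mem_insert]
        tauto
      have fresh : ∀ z ∉ (s'.nodes p).crashed ∪ (s'.nodes p).report,
          ∀ x ∈ (s'.nodes p).report, sdist p b ≤ sdist p z → x ∉ (s'.nodes z).crashed := by
        intro z hz x hx hle
        rw [rw', mem_insert] at hx
        rw [cr]
        -- The newly detected crash is neither in the stored token nor known to `w`; by `agree` the
        -- nodes that are still to be visited do not know it either.
        rcases hx with rfl | hx
        · have h1 : x ∉ (s.nodes p).stored.crashed := fun hm => hn (h.stored_sub p hm)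
          rw [mem_union, not_or] at hn
          rw [← ok.agree z (hnm z hz) x h1 hn.2 hle]
          exact hn.1
        · exact ok.fresh z (hnm z hz) x hx hle
      refine ⟨?_, fresh, ?_⟩
      · intro z hz z' hz' x hx hle hle' hxz
        by_cases hxr : x ∈ (s'.nodes p).report
        · exact absurd hxz (fresh z hz x hxr hle)
        · rw [cr] at hxz ⊢
          refine ok.segment z (hnm z hz) z' (hnm z' hz') x ?_ hle hle' hxz
          rw [sw] at hx hxr
          rcases spec.send with h2 | h2
          · rwa [h2.1] at hx
          · rw [h2.2.2.1, mem_union] at hx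
            exact hx.resolve_right hxr
      · intro z hz x hx hxr hle
        rw [cr, cr]
        refine ok.agree z (hnm z hz) x ?_ ?_ hle
        · intro hm
          apply hx
          rw [sw]
          rcases spec.send with h2 | h2
          · rwa [h2.1]
          · rw [h2.2.2.1, mem_union]; exact Or.inl hm
        · intro hm
          apply hxr
          rw [rw', mem_insert]
          exact Or.inr hm
    · constructor
      · simp only [cr, so p hpw]; exact ok.segment
      · simp only [cr, so p hpw]; exact ok.fresh
      · simp only [cr, so p hpw]; exact ok.agree
  have newTok : ∀ b t, Valid s' b t → Valid s b t ∨
      (TokenCore s' b t ∧ TokenWindow s' b t) := by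
    intro b t hv
    rcases h.detect_valid hw hj hr hn hs' hv with h1 | ⟨rfl, rfl, hrw, hdue, hsub, hbl⟩
    · exact Or.inl h1
    right
    have := tokenCore_of_stored dead' (p := w) (b := (s'.nodes w).next)
      (by rw [sw]; exact spec.good.gap)
      (by intro z; rw [sq, sq, cr]; exact h.lower_lt w z hw)
      (by intro z; rw [sq, sq, cr]; exact h.lower w z hw)
      hsub (stored' w _ hrw hv.1 hdue) hdue hv.1.1
    refine ⟨this.1, ?_⟩
    intro z hz hlt
    have h3 := (this.2 z hz).2
    rw [hbl] at hlt
    exact absurd hlt (not_lt_cdist_of_sdist_le h3)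
  refine ⟨dead', ?_, sub', ?_, ?_, ?_, ?_, ?_, ?_, ?_, ?_, ?_, ?_, ?_, stored'⟩
  · intro b t hat z hz
    rcases hat with hat | hat
    · rcases tok b t hat with h1 | ⟨rfl, rfl, h1⟩
      · rw [al]; exact h.token_dead b t (Or.inl h1) z hz
      · have := sub' w
        rw [sw] at this
        exact dead' w z (by rw [sw]; exact this hz)
    · rw [al]; exact h.token_dead b t (Or.inr (held b t hat)) z hz
  · intro p hp hph
    by_cases hpw : p = w
    · subst hpw; rw [sw]; exact spec.good
    · rw [so p hpw] at hp hph ⊢; exact h.good p hp hph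
  · intro p hp
    by_cases hpw : p = w
    · subst hpw
      rw [sw] at hp ⊢
      rcases spec.phase with h4 | h4
      · exact h4.1
      · rw [h4] at hp
        exact absurd hp (h.detect_ne_alone hw hj hn)
    · rw [so p hpw] at hp ⊢; exact h.alone p hp
  · intro p t hp
    rw [sq]; exact h.held_seq p t (held p t hp)
  · intro p hp hpos hlt
    by_cases hpw : p = w
    · subst hpw
      rw [sq] at hpos ⊢
      rw [sw] at hlt ⊢
      rcases spec.send with ⟨h2, -, h3⟩ | ⟨-, hne, hcr, hbl, hs, hfur, hseq⟩
      · rw [h2]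
        rcases h3 with h3 | h3 | h3
        · rw [h3.1] at hlt; exact absurd hlt (lt_irrefl _)
        · rw [h3] at hlt; exact h.stored_seq p hw hpos hlt
        · omega
      · rcases h.backup_due hw hne hfur hs hseq with ⟨h3, h4⟩ | ⟨h3, h4⟩
        · exact absurd hlt (lt_asymm h3)
        · exact h4
    · rw [so p hpw] at *; exact h.stored_seq p hp hpos hlt
  · intro b z hb; rw [al] at hb; rw [sq, sq]; exact h.upper_lt b z hb
  · intro b z hb; rw [al] at hb; rw [sq, sq]; exact h.upper b z hb
  · intro b z hb; rw [al] at hb; rw [sq, sq, cr]; exact h.lower_lt b z hb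
  · intro b z hb; rw [al] at hb; rw [sq, sq, cr]; exact h.lower b z hb
  · intro b t hat hb
    rw [al] at hb
    rw [sq]
    rcases tok b t hat with h1 | ⟨rfl, rfl, h1⟩
    · exact h.token_le b t h1 hb
    · rcases spec.send with h2 | ⟨-, hne, hcr, hbl, hs, hfur, hseq⟩
      · rw [h2.2.1] at h1; cases h1
      rcases h.backup_due hw hne hfur hs hseq with ⟨h3, h4⟩ | ⟨h3, h4⟩
      · have := h.upper_lt _ _ hb h3; omega
      · have := h.upper _ w hb; omega
  · intro b t hv
    rcases newTok b t hv with h1 | h1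
    · have := h.token b t h1
      constructor
      · simp only [sq, cr]; exact this.seq_lt
      · simp only [sq, cr]; exact this.seq_le
      · simp only [cr]; exact this.agree
      · simp only [cr]; exact this.segment
    · exact h1.1
  · intro b t hv
    rcases newTok b t hv with h1 | h1
    · have := h.window b t h1
      unfold TokenWindow at *
      simpa only [cr] using this
    · exact h1.2

/-- The control algorithm of `w` stops, or waits to do so. -/
structure StopSpec (w : Fin N) (x y : NodeState N) : Prop where
  alive : y.alive = x.alive
  seq : y.seq = x.seq
  stored : y.stored = x.stored
  crashed : x.crashed ⊆ y.crashed
  known : x.crashed ∪ x.report ⊆ y.crashed ∪ y.report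
  next : y.next = w ∨ y.next = x.next
  phase : y.phase = .announced ∨ (y.phase = .waitAlone ∧ y.next = w ∧ GoodNext w y)

/-- A node stops either at the only place where tokens are valid, or as the sole survivor. -/
lemma ControlInv.not_valid_of_stopSpec {s s' : State N} (h : ControlInv s) {w : Fin N}
    {y : NodeState N} (sw : s'.nodes w = y) (so : ∀ z ≠ w, s'.nodes z = s.nodes z)
    (st : s'.tokens = s.tokens) (spec : StopSpec w (s.nodes w) y)
    (hwhy : (∃ t, Valid s w t) ∨ ∀ z, (s.nodes z).alive = true → z = w) :
    ∀ b t, ¬ Valid s' b t := by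
  have nr : ¬ (s'.nodes w).Running := by
    rw [running_iff, sw]
    rcases spec.phase with h1 | h1
    · simp [h1]
    · simp [h1.1]
  have held : ∀ z t, (s'.nodes z).phase = .waitToken t → (s.nodes z).phase = .waitToken t := by
    intro z t; by_cases hz : z = w
    · subst hz
      rw [sw]
      rcases spec.phase with h1 | h1
      · rw [h1]; intro h2; cases h2
      · rw [h1.1]; intro h2; cases h2
    · rw [so z hz]; exact id
  rintro b t ⟨hb, hsq, hat⟩
  have hbw : b ≠ w := by rintro rfl; exact nr hb
  rw [so b hbw] at hb hsq
  rcases hwhy with ⟨t', ht'⟩ | ho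
  · apply hbw
    apply h.valid_unique ht' (t' := t)
    refine ⟨hb, hsq, ?_⟩
    rcases hat with h1 | h1
    · rw [st] at h1; exact Or.inl h1
    · exact Or.inr (held b t h1)
  · exact hbw (ho b hb.1)

/-- The crash set of `w` may grow here without a visit being counted. This is harmless: no token
remains valid, and for every pair of running nodes that is due, `w` lies outside the stretch that
`StoredOK` is about. -/
lemma ControlInv.of_stopSpec {s s' : State N} (h : ControlInv s) {w : Fin N} {y : NodeState N}
    (hw : (s.nodes w).alive = true)
    (sw : s'.nodes w = y) (so : ∀ z ≠ w, s'.nodes z = s.nodes z) (st : s'.tokens = s.tokens)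
    (spec : StopSpec w (s.nodes w) y)
    (hdead : ∀ z ∈ y.crashed ∪ y.report, (s.nodes z).alive = false)
    (hwhy : (∃ t, Valid s w t) ∨ ∀ z, (s.nodes z).alive = true → z = w) : ControlInv s' := by
  have al : ∀ z, (s'.nodes z).alive = (s.nodes z).alive := by
    intro z; by_cases hz : z = w
    · rw [hz, sw, spec.alive]
    · rw [so z hz]
  have sq : ∀ z, (s'.nodes z).seq = (s.nodes z).seq := by
    intro z; by_cases hz : z = w
    · rw [hz, sw, spec.seq]
    · rw [so z hz]
  have cr : ∀ z, (s.nodes z).crashed ⊆ (s'.nodes z).crashed := by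
    intro z; by_cases hz : z = w
    · rw [hz, sw]; exact spec.crashed
    · rw [so z hz]
  have nr : ¬ (s'.nodes w).Running := by
    rw [running_iff, sw]
    rcases spec.phase with h1 | h1
    · simp [h1]
    · simp [h1.1]
  have held : ∀ z t, (s'.nodes z).phase = .waitToken t → (s.nodes z).phase = .waitToken t := by
    intro z t; by_cases hz : z = w
    · subst hz
      rw [sw]
      rcases spec.phase with h1 | h1
      · rw [h1]; intro h2; cases h2
      · rw [h1.1]; intro h2; cases h2
    · rw [so z hz]; exact id
  have noValid := h.not_valid_of_stopSpec sw so st spec hwhy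
  refine ⟨?_, ?_, ?_, ?_, ?_, ?_, ?_, ?_, ?_, ?_, ?_, ?_, fun b t hv => absurd hv (noValid b t),
    fun b t hv => absurd hv (noValid b t), ?_⟩
  · intro i z hz
    rw [al]
    by_cases hi : i = w
    · subst hi; rw [sw] at hz; exact hdead z hz
    · rw [so i hi] at hz; exact h.dead i z hz
  · intro b t hat z hz
    rw [al]
    refine h.token_dead b t ?_ z hz
    rcases hat with h1 | h1
    · rw [st] at h1; exact Or.inl h1
    · exact Or.inr (held b t h1)
  · intro p
    by_cases hp : p = w
    · subst hp; rw [sw, spec.stored]; exact (h.stored_sub p).trans spec.known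
    · rw [so p hp]; exact h.stored_sub p
  · intro p hp hph
    by_cases hpw : p = w
    · subst hpw
      rw [sw] at hph ⊢
      rcases spec.phase with h1 | h1
      · exact absurd h1 hph
      · exact h1.2.2
    · rw [so p hpw] at hp hph ⊢; exact h.good p hp hph
  · intro p hp
    by_cases hpw : p = w
    · subst hpw
      rw [sw] at hp ⊢
      rcases spec.phase with h1 | h1
      · rw [h1] at hp; cases hp
      · exact h1.2.1
    · rw [so p hpw] at hp ⊢; exact h.alone p hp
  · intro p t hp
    rw [sq]; exact h.held_seq p t (held p t hp)
  · intro p hp hpos hlt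
    by_cases hpw : p = w
    · subst hpw
      rw [sw] at hlt
      rw [sq] at hpos ⊢
      rw [sw, spec.stored]
      rcases spec.next with h1 | h1
      · rw [h1] at hlt; exact absurd hlt (lt_irrefl _)
      · rw [h1] at hlt; exact h.stored_seq p hw hpos hlt
    · rw [so p hpw] at *; exact h.stored_seq p hp hpos hlt
  · intro b z hb; rw [al] at hb; rw [sq, sq]; exact h.upper_lt b z hb
  · intro b z hb; rw [al] at hb; rw [sq, sq]; exact h.upper b z hb
  · intro b z hb hz; rw [al] at hb; rw [sq, sq]
    exact h.lower_lt b z hb (fun hm => hz (cr b hm))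
  · intro b z hb hz; rw [al] at hb; rw [sq, sq]
    exact h.lower b z hb (fun hm => hz (cr b hm))
  · intro b t hat hb
    rw [al] at hb
    rw [st] at hat
    rw [sq]; exact h.token_le b t hat hb
  · intro p b hp hb hd
    have hpw : p ≠ w := by rintro rfl; exact nr hp
    have hbw : b ≠ w := by rintro rfl; exact nr hb
    rw [so p hpw] at hp
    rw [so b hbw] at hb
    have hd' : Due s p b := by simpa only [Due, sq] using hd
    have ok := h.stored p b hp hb hd'
    rcases hwhy with ⟨t', ht'⟩ | ho
    · have hlt : sdist p w < sdist p b :=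
        ((h.due_of_valid ht' hp.1 hb.1 hd').resolve_left hbw).2
      have hz : ∀ z, sdist p b ≤ sdist p z → s'.nodes z = s.nodes z := by
        intro z hz; apply so; rintro rfl; omega
      constructor
      · rw [so p hpw]
        intro z hz1 z' hz2 x hx h1 h2
        rw [hz z h1, hz z' (h1.trans h2)]
        exact ok.segment z hz1 z' hz2 x hx h1 h2
      · rw [so p hpw]
        intro z hz1 x hx h1
        rw [hz z h1]
        exact ok.fresh z hz1 x hx h1
      · rw [so p hpw]
        intro z hz1 x hx hx' h1
        rw [hz z h1]
        exact ok.agree z hz1 x hx hx' h1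
    · exact absurd (ho p hp.1) hpw

lemma AnnounceSpec.stopSpec {w : Fin N} {t : Token N} {x : NodeState N}
    {r : NodeState N × Option (Fin N × Token N)} (a : AnnounceSpec w t x r) :
    StopSpec w x r.1 where
  alive := a.alive
  seq := a.seq
  stored := a.stored
  crashed := by rw [a.crashed]; exact subset_union_left
  known := by
    intro z; rw [a.crashed, a.report]; simp only [mem_union, mem_sdiff]; tauto
  next := Or.inr a.next
  phase := Or.inl a.phase

lemma AloneSpec.stopSpec {w : Fin N} {t : Token N} {x : NodeState N}
    {r : NodeState N × Option (Fin N × Token N)} (a : AloneSpec w t x r) :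
    StopSpec w x r.1 where
  alive := a.alive
  seq := a.seq
  stored := a.stored
  crashed := by rw [a.crashed]; exact subset_union_left
  known := by
    intro z; rw [a.crashed, a.report]; simp only [mem_union, mem_sdiff]; tauto
  next := Or.inl a.next
  phase := Or.inr ⟨a.phase, a.next, a.good⟩

section Forward
variable {s : State N} {w : Fin N} {t : Token N} {r : NodeState N × Option (Fin N × Token N)}

lemma ControlInv.valid_of_held (h : ControlInv s) (hw : (s.nodes w).alive = true)
    (hp : (s.nodes w).phase = .waitToken t) : Valid s w t :=
  ⟨⟨hw, Or.inr ⟨t, hp⟩⟩, h.held_seq w t hp, Or.inr hp⟩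

/-- After `w` forwarded a token, only this token can be valid. -/
lemma ControlInv.valid_forward (h : ControlInv s) (hv : Valid s w t)
    (spec : ForwardSpec w t (s.nodes w) r) {b : Fin N} {t' : Token N}
    (hv' : Valid (s.setNodeSend w r) b t') :
    b = r.1.next ∧ t' = r.1.stored ∧ b ≠ w ∧ Due (s.setNodeSend w r) w b := by
  have sw : (s.setNodeSend w r).nodes w = r.1 := setNodeSend_self s w r
  have so : ∀ z ≠ w, (s.setNodeSend w r).nodes z = s.nodes z :=
    fun z hz => setNodeSend_of_ne s r hz
  obtain ⟨hb, hsq, hat⟩ := hv'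
  have hnew : r.2 = some (b, t') := by
    by_contra hc
    by_cases hbw : b = w
    · subst hbw
      rw [sw, spec.seq] at hsq
      rcases hat with h1 | h1
      · rcases (mem_setNodeSend s r).mp h1 with h2 | h2
        · have := h.token_le b t' h2 hv.1.1
          omega
        · exact hc h2
      · rw [sw, spec.phase] at h1; cases h1
    · apply hbw
      rw [so b hbw] at hb hsq
      refine h.valid_unique hv (t' := t') ⟨hb, hsq, ?_⟩
      rcases hat with h1 | h1
      · rcases (mem_setNodeSend s r).mp h1 with h2 | h2
        · exact Or.inl h2
        · exact absurd h2 hc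
      · rw [so b hbw] at h1; exact Or.inr h1
  rw [spec.send] at hnew
  simp only [Option.some.injEq, Prod.mk.injEq] at hnew
  obtain ⟨h1, h2⟩ := hnew
  -- A token that `w` sends to itself keeps its number and is stale on arrival.
  have hbw : b ≠ w := by
    rintro rfl
    have h3 := spec.tokenSeq
    rw [h1, if_neg (lt_irrefl _), h2, hsq, sw, spec.seq, hv.2.1] at h3
    omega
  refine ⟨h1.symm, h2.symm, hbw, hbw, ?_⟩
  have h3 := spec.tokenSeq
  rw [h1, h2, hsq, hv.2.1] at h3
  rw [sw, spec.seq]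
  constructor
  · intro hlt
    rw [if_pos hlt] at h3; omega
  · intro hlt
    rw [if_neg (lt_asymm hlt)] at h3; omega

/-- Two facts carry this. What the processed token says about all nodes turns into the stored facts
of `w`, from which the core of the sent token follows. For any other sender `p`, the visited node
`w` lies before the stretch that the stored facts of `p` are about. -/
lemma ControlInv.forward (h : ControlInv s) (hw : (s.nodes w).alive = true)
    (hp : (s.nodes w).phase = .waitToken t)
    (spec : ForwardSpec w t (s.nodes w) r) : ControlInv (s.setNodeSend w r) := by
  have hv := h.valid_of_held hw hp
  have htd := h.token_dead w t hv.2.2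
  have core := h.token w t hv
  have win := h.window w t hv
  have uniq := fun b t' => h.valid_forward hv spec (b := b) (t' := t')
  set s' := s.setNodeSend w r with hs'
  have sw : s'.nodes w = r.1 := setNodeSend_self s w r
  have so : ∀ z ≠ w, s'.nodes z = s.nodes z := fun z hz => setNodeSend_of_ne s r hz
  have al : ∀ z, (s'.nodes z).alive = (s.nodes z).alive := by
    intro z; by_cases hz : z = w
    · rw [hz, sw, spec.alive]
    · rw [so z hz]
  have sq : ∀ z, (s.nodes z).seq ≤ (s'.nodes z).seq := by
    intro z; by_cases hz : z = w
    · rw [hz, sw, spec.seq]; omega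
    · rw [so z hz]
  have sqw : (s'.nodes w).seq = (s.nodes w).seq + 1 := by rw [sw, spec.seq]
  have crw : (s'.nodes w).crashed = (s.nodes w).crashed ∪ t.crashed ∪ (s.nodes w).report := by
    rw [sw, spec.crashed]
  have rpw : (s'.nodes w).report = ∅ := by rw [sw, spec.report]
  have stw : (s'.nodes w).stored.crashed = (t.crashed \ (s.nodes w).crashed) ∪
      (s.nodes w).report := by rw [sw, spec.tokenCrashed]
  have run : ∀ z, (s'.nodes z).Running → (s.nodes z).Running := by
    intro z; by_cases hz : z = w
    · subst hz; exact fun _ => hv.1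
    · rw [so z hz]; exact id
  have held : ∀ z t', (s'.nodes z).phase = .waitToken t' → z ≠ w ∧
      (s.nodes z).phase = .waitToken t' := by
    intro z t'; by_cases hz : z = w
    · subst hz; rw [sw, spec.phase]; intro h1; cases h1
    · rw [so z hz]; exact fun h1 => ⟨hz, h1⟩
  have tok : ∀ b t', (b, t') ∈ s'.tokens → (b, t') ∈ s.tokens ∨
      (b = r.1.next ∧ t' = r.1.stored) := by
    intro b t' ht
    rcases (mem_setNodeSend s r).mp ht with h1 | h1
    · exact Or.inl h1
    · rw [spec.send] at h1
      simp only [Option.some.injEq, Prod.mk.injEq] at h1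
      exact Or.inr ⟨h1.1.symm, h1.2.symm⟩
  have notE : ∀ z, z ∉ (s'.nodes w).crashed → z ∉ (s.nodes w).crashed ∪ t.crashed := by
    intro z hz hm; apply hz; rw [crw]; exact mem_union_left _ hm
  have dead' : ∀ i, ∀ z ∈ (s'.nodes i).crashed ∪ (s'.nodes i).report,
      (s'.nodes z).alive = false := by
    intro i z hz
    rw [al]
    by_cases hi : i = w
    · subst hi
      rw [crw, rpw] at hz
      simp only [mem_union, notMem_empty, or_false] at hz
      rcases hz with (hz | hz) | hz
      · exact h.dead i z (mem_union_left _ hz)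
      · exact htd z hz
      · exact h.dead i z (mem_union_right _ hz)
    · rw [so i hi] at hz; exact h.dead i z hz
  have sub' : ∀ p, (s'.nodes p).stored.crashed ⊆ (s'.nodes p).crashed ∪ (s'.nodes p).report := by
    intro p
    by_cases hp : p = w
    · subst hp
      rw [crw, rpw, stw]
      intro z
      simp only [mem_union, mem_sdiff]
      tauto
    · rw [so p hp]; exact h.stored_sub p
  have lower_lt' : ∀ p z, (s'.nodes p).alive = true → z ∉ (s'.nodes p).crashed → z < p →
      (s'.nodes p).seq ≤ (s'.nodes z).seq := by
    intro p z hpa hz hlt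
    by_cases hpw : p = w
    · subst hpw
      rw [sqw]
      exact (core.seq_lt z (notE z hz) hlt).trans (sq z)
    · rw [so p hpw] at *
      exact (h.lower_lt p z hpa hz hlt).trans (sq z)
  have lower' : ∀ p z, (s'.nodes p).alive = true → z ∉ (s'.nodes p).crashed →
      (s'.nodes p).seq ≤ (s'.nodes z).seq + 1 := by
    intro p z hpa hz
    by_cases hpw : p = w
    · subst hpw
      rw [sqw]
      have := core.seq_le z (notE z hz)
      have := sq z
      omega
    · rw [so p hpw] at *
      have := h.lower p z hpa hz
      have := sq z
      omega
  have stored_w : ∀ b, StoredOK s' w b := by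
    intro b
    have hnot : ∀ z, z ∉ (s'.nodes w).crashed ∪ (s'.nodes w).report →
        z ∉ (s'.nodes w).crashed := fun z hz hm => hz (mem_union_left _ hm)
    refine ⟨?_, ?_, ?_⟩
    · intro z hz z' hz' x hx _ hle hxz
      have hz := hnot z hz
      have hz' := hnot z' hz'
      by_cases hzw' : z' = w
      · rw [hzw']
        rw [stw] at hx
        rw [crw]
        simp only [mem_union, mem_sdiff] at hx ⊢
        tauto
      have hzw : z ≠ w := by
        rintro rfl
        rw [sdist_self] at hle
        exact hzw' (eq_of_sdist hle)
      by_cases hxr : x ∈ t.crashed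
      · rw [so z hzw] at hxz
        rw [so z' hzw']
        refine core.segment z (notE z hz) z' (notE z' hz') x hxr ?_ hxz
        rwa [← sdist_eq_cdist hzw, ← sdist_eq_cdist hzw']
      · rw [so z hzw, ← core.agree z (notE z hz) x hxr] at hxz
        rw [so z' hzw', ← core.agree z' (notE z' hz') x hxr]
        exact hxz
    · intro z _ x hx
      rw [rpw] at hx
      simp at hx
    · intro z hz x hx _ _
      have hz := hnot z hz
      by_cases hzw : z = w
      · rw [hzw]
      rw [stw] at hx
      rw [crw, so z hzw]
      simp only [mem_union, mem_sdiff, not_or, not_and, not_not] at hx ⊢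
      by_cases hxt : x ∈ t.crashed
      · have hxw := hx.1 hxt
        have h1 : w ∉ (s.nodes w).crashed ∪ t.crashed := h.notMem_excluded hv.2.2 hw
        have := core.segment w h1 z (notE z hz) x hxt (by rw [cdist_self]; omega) hxw
        tauto
      · have := core.agree z (notE z hz) x hxt
        tauto
  refine ⟨dead', ?_, sub', ?_, ?_, ?_, ?_, ?_, ?_, lower_lt', lower', ?_, ?_, ?_, ?_⟩
  · intro b t' hat z hz
    rcases hat with hat | hat
    · rcases tok b t' hat with h1 | ⟨rfl, rfl⟩
      · rw [al]; exact h.token_dead b t' (Or.inl h1) z hz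
      · have := sub' w
        rw [sw] at this
        exact dead' w z (by rw [sw]; exact this hz)
    · rw [al]; exact h.token_dead b t' (Or.inr (held b t' hat).2) z hz
  · intro p hpa hph
    by_cases hpw : p = w
    · subst hpw; rw [sw]; exact spec.good
    · rw [so p hpw] at hpa hph ⊢; exact h.good p hpa hph
  · intro p hpa
    by_cases hpw : p = w
    · subst hpw
      rw [sw, spec.phase] at hpa
      cases hpa
    · rw [so p hpw] at hpa ⊢; exact h.alone p hpa
  · intro p t' hpa
    have := held p t' hpa
    rw [so p this.1]
    exact h.held_seq p t' this.2
  · intro p hpa hpos hlt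
    by_cases hpw : p = w
    · subst hpw
      rw [sw] at hlt ⊢
      rw [spec.tokenSeq, if_neg (lt_asymm hlt), hv.2.1, spec.seq]
    · rw [so p hpw] at *; exact h.stored_seq p hpa hpos hlt
  · intro b z hb hlt
    rw [al] at hb
    by_cases hzw : z = w
    · subst hzw
      rw [sqw, so b hlt.ne, h.seq_of_lt hv hb hlt]
    · rw [so z hzw]; exact (h.upper_lt b z hb hlt).trans (sq b)
  · intro b z hb
    rw [al] at hb
    by_cases hzw : z = w
    · subst hzw
      rw [sqw]
      by_cases hbw : b = z
      · subst hbw; rw [sqw]; omega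
      · rw [so b hbw]
        rcases lt_or_gt_of_ne hbw with hlt | hlt
        · have := h.seq_of_lt hv hb hlt; omega
        · have := h.seq_of_gt hv hb hlt; omega
    · rw [so z hzw]
      have := h.upper b z hb
      have := sq b
      omega
  · intro b t' hat hb
    rw [al] at hb
    rcases tok b t' hat with h1 | ⟨rfl, rfl⟩
    · have := h.token_le b t' h1 hb
      have := sq b
      omega
    · rw [spec.tokenSeq, hv.2.1]
      by_cases hbw : r.1.next = w
      · rw [hbw, if_neg (lt_irrefl _), sqw]
        omega
      · rw [so _ hbw]
        rcases lt_or_gt_of_ne hbw with hlt | hlt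
        · have := h.seq_of_lt hv hb hlt
          rw [if_pos hlt]; omega
        · have := h.seq_of_gt hv hb hlt
          rw [if_neg (lt_asymm hlt)]; omega
  · intro b t' hv'
    obtain ⟨rfl, rfl, hbw, hdue⟩ := uniq b t' hv'
    have := tokenCore_of_stored dead' (p := w) (b := r.1.next)
      (by rw [sw]; exact spec.good.gap)
      (fun z => lower_lt' w z (by rw [al]; exact hw))
      (fun z => lower' w z (by rw [al]; exact hw))
      (by rw [rpw]; exact empty_subset _) (stored_w _) hdue hv'.1.1
    rw [sw] at this
    exact this.1
  · intro b t' hv'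
    obtain ⟨rfl, rfl, hbw, hdue⟩ := uniq b t' hv'
    have := (tokenCore_of_stored dead' (p := w) (b := r.1.next)
      (by rw [sw]; exact spec.good.gap)
      (fun z => lower_lt' w z (by rw [al]; exact hw))
      (fun z => lower' w z (by rw [al]; exact hw))
      (by rw [rpw]; exact empty_subset _) (stored_w _) hdue hv'.1.1).2
    intro z hz hlt
    have hz' := this z (by rw [sw]; exact hz)
    have hzC : z ∉ (s'.nodes w).crashed := fun hm => hz'.1 (mem_union_left _ hm)
    rcases spec.tokenBlack with hb | ⟨hsub, hb1, hb2, hb3, -⟩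
    · rw [hb] at hlt
      exact absurd hlt (not_lt_cdist_of_sdist_le hz'.2)
    · have htc : r.1.stored.crashed ⊆ t.crashed := by
        rw [spec.tokenCrashed]
        intro x hx
        rw [mem_union] at hx
        have : x ∈ t.crashed \ (s.nodes w).crashed := hx.elim id (fun h1 => hsub h1)
        exact (mem_sdiff.mp this).1
      by_cases hzw : z = w
      · subst hzw
        rw [crw]
        exact htc.trans (subset_union_right.trans subset_union_left)
      · rw [so z hzw]
        refine htc.trans (win z (notE z hzC) ?_)
        -- The token is black at least up to its next destination, which differs from `w`. So
        -- distances from `w` may be measured by `sdist`, and the new window, apart from `w`, lies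
        -- in the old one.
        have hne : r.1.stored.black ≠ w := by
          intro he
          rw [he, cdist_self] at hb3
          exact hbw (cdist_eq_zero.mp (by omega))
        rw [← sdist_eq_cdist hbw, ← sdist_eq_cdist hne] at hb3
        rw [cdist_of_sdist_le hb3, cdist_of_sdist_le hz'.2, sdist_eq_cdist hne,
          sdist_eq_cdist hzw] at hlt
        omega
  · intro p b hpr hbr hd
    by_cases hpw : p = w
    · subst hpw; exact stored_w b
    have hpa := (run p hpr).1
    have hba := (run b hbr).1
    -- Having been visited, `w` is no longer due with respect to any other node.
    have hbw : b ≠ w := by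
      rintro rfl
      obtain ⟨-, hd1, hd2⟩ := hd
      rw [sqw, so p hpw] at hd1 hd2
      rcases lt_or_gt_of_ne hpw with hlt | hlt
      · have := h.seq_of_lt hv hpa hlt; have := hd2 hlt; omega
      · have := h.seq_of_gt hv hpa hlt; have := hd1 hlt; omega
    have hd' : Due s p b := by
      simpa only [Due, so p hpw, so b hbw] using hd
    have ok := h.stored p b (run p hpr) (run b hbr) hd'
    have hlt : sdist p w < sdist p b :=
      ((h.due_of_valid hv hpa hba hd').resolve_left hbw).2
    have hz : ∀ z, sdist p b ≤ sdist p z → s'.nodes z = s.nodes z := by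
      intro z hz; apply so; rintro rfl; omega
    constructor
    · rw [so p hpw]
      intro z hz1 z' hz2 x hx h1 h2
      rw [hz z h1, hz z' (h1.trans h2)]
      exact ok.segment z hz1 z' hz2 x hx h1 h2
    · rw [so p hpw]
      intro z hz1 x hx h1
      rw [hz z h1]
      exact ok.fresh z hz1 x hx h1
    · rw [so p hpw]
      intro z hz1 x hx hx' h1
      rw [hz z h1]
      exact ok.agree z hz1 x hx hx' h1

end Forward

lemma quiet_setNode (s : State N) (i : Fin N) (y : NodeState N)
    (halive : y.alive = true → (s.nodes i).alive = true)
    (hseq : y.seq = (s.nodes i).seq) (hnext : y.next = (s.nodes i).next)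
    (hcr : y.crashed = (s.nodes i).crashed) (hre : y.report = (s.nodes i).report)
    (hst : y.stored = (s.nodes i).stored) (hph : y.phase = (s.nodes i).phase)
    (msgs : Multiset (BasicMsg N)) :
    Quiet s { s.setNode i y with msgs := msgs } := by
  set s' : State N := { s.setNode i y with msgs := msgs } with hs'
  have sw : s'.nodes i = y := setNode_self s i y
  have so : ∀ z ≠ i, s'.nodes z = s.nodes z := fun z hz => setNode_of_ne s y hz
  have ph : ∀ z, (s'.nodes z).phase = (s.nodes z).phase := by
    intro z; by_cases hz : z = i
    · rw [hz, sw, hph]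
    · rw [so z hz]
  refine ⟨?_, ?_, ?_, ?_, ?_, ?_, ?_, ?_, ?_, ?_, ?_⟩
  · intro z; by_cases hz : z = i
    · rw [hz, sw]; exact halive
    · rw [so z hz]; exact id
  · intro z; by_cases hz : z = i
    · rw [hz, sw, hseq]
    · rw [so z hz]
  · intro z; by_cases hz : z = i
    · rw [hz, sw, hnext]
    · rw [so z hz]
  · intro z; by_cases hz : z = i
    · rw [hz, sw, hcr]
    · rw [so z hz]
  · intro z; by_cases hz : z = i
    · rw [hz, sw, hre]
    · rw [so z hz]
  · intro z; by_cases hz : z = i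
    · rw [hz, sw, hst]
    · rw [so z hz]
  · intro z; rw [ph]
  · intro z; rw [ph]
  · intro z t; rw [ph]; exact Or.inr
  · intro b t hb; exact hb
  · intro b t hb
    rcases hb with hb | hb
    · exact Or.inl hb
    · rw [ph] at hb; exact Or.inr hb

lemma receiveBasic_fields (i j : Fin N) (q : ℕ) (x : NodeState N) :
    (receiveBasic i j q x).alive = x.alive ∧ (receiveBasic i j q x).seq = x.seq ∧
    (receiveBasic i j q x).next = x.next ∧ (receiveBasic i j q x).crashed = x.crashed ∧
    (receiveBasic i j q x).report = x.report ∧ (receiveBasic i j q x).stored = x.stored ∧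
    (receiveBasic i j q x).phase = x.phase := by
  unfold receiveBasic
  split_ifs <;> simp

lemma quiet_receiveBasic (s : State N) (m : BasicMsg N) (rest : Multiset (BasicMsg N)) :
    Quiet s { s.setNode m.receiver
            (FTSafra.receiveBasic m.receiver m.sender m.seq (s.nodes m.receiver)) with
          msgs := rest } := by
  obtain ⟨h1, h2, h3, h4, h5, h6, h7⟩ :=
    receiveBasic_fields m.receiver m.sender m.seq (s.nodes m.receiver)
  exact quiet_setNode s _ _ (by rw [h1]; exact id) h2 h3 h4 h5 h6 h7 rest

lemma quiet_receiveToken (s : State N) (i : Fin N) (t : Token N)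
    (rest : Multiset (Fin N × Token N)) (hin : s.tokens = (i, t) ::ₘ rest)
    (idle : (s.nodes i).phase = .idle) :
    Quiet s { s.setNode i (acceptToken t (s.nodes i)) with tokens := rest } := by
  set s' : State N := { s.setNode i (acceptToken t (s.nodes i)) with tokens := rest } with hs'
  have sw : s'.nodes i = acceptToken t (s.nodes i) := setNode_self s i _
  have so : ∀ z ≠ i, s'.nodes z = s.nodes z := fun z hz => setNode_of_ne s _ hz
  have hmem : ∀ b t', (b, t') ∈ s'.tokens → (b, t') ∈ s.tokens := by
    intro b t' hb
    rw [hin]; exact Multiset.mem_cons_of_mem hb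
  have hall : (acceptToken t (s.nodes i)).alive = (s.nodes i).alive ∧
      (acceptToken t (s.nodes i)).seq = (s.nodes i).seq ∧
      (acceptToken t (s.nodes i)).next = (s.nodes i).next ∧
      (acceptToken t (s.nodes i)).crashed = (s.nodes i).crashed ∧
      (acceptToken t (s.nodes i)).report = (s.nodes i).report ∧
      (acceptToken t (s.nodes i)).stored = (s.nodes i).stored ∧
      ((acceptToken t (s.nodes i)).phase = .idle ∨ (t.seq = (s.nodes i).seq + 1 ∧
        (acceptToken t (s.nodes i)).phase = .waitToken t)) := by
    unfold acceptToken
    split_ifs with h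
    · simp [h]
    · simp [idle]
  obtain ⟨h1, h2, h3, h4, h5, h6, h7⟩ := hall
  refine ⟨?_, ?_, ?_, ?_, ?_, ?_, ?_, ?_, ?_, hmem, ?_⟩
  · intro z; by_cases hz : z = i
    · rw [hz, sw, h1]; exact id
    · rw [so z hz]; exact id
  · intro z; by_cases hz : z = i
    · rw [hz, sw, h2]
    · rw [so z hz]
  · intro z; by_cases hz : z = i
    · rw [hz, sw, h3]
    · rw [so z hz]
  · intro z; by_cases hz : z = i
    · rw [hz, sw, h4]
    · rw [so z hz]
  · intro z; by_cases hz : z = i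
    · rw [hz, sw, h5]
    · rw [so z hz]
  · intro z; by_cases hz : z = i
    · rw [hz, sw, h6]
    · rw [so z hz]
  · intro z; by_cases hz : z = i
    · rw [hz, sw, idle]; rcases h7 with h7 | ⟨-, h7⟩ <;> simp [h7]
    · rw [so z hz]
  · intro z; by_cases hz : z = i
    · rw [hz, sw, idle]; rcases h7 with h7 | ⟨-, h7⟩ <;> simp [h7]
    · rw [so z hz]
  · intro z t'; by_cases hz : z = i
    · rw [hz, sw]
      rcases h7 with h7 | ⟨h8, h7⟩
      · rw [h7]; intro h; cases h
      · rw [h7]; rintro ⟨rfl⟩; exact Or.inl h8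
    · rw [so z hz]; exact Or.inr
  · intro b t' hb
    rcases hb with hb | hb
    · exact Or.inl (hmem b t' hb)
    · by_cases hz : b = i
      · subst hz
        rw [sw] at hb
        rcases h7 with h7 | ⟨h8, h7⟩
        · rw [h7] at hb; cases hb
        · rw [h7] at hb
          cases hb
          left; rw [hin]; exact Multiset.mem_cons_self _ _
      · rw [so b hz] at hb; exact Or.inr hb

lemma ControlInv.processSpec [NeZero N] {s : State N} (h : ControlInv s) {w : Fin N} {t : Token N}
    (hw : (s.nodes w).alive = true) (hp : (s.nodes w).phase = .waitToken t) :
    AnnounceSpec w t (s.nodes w) (processToken w t (s.nodes w)) ∨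
      AloneSpec w t (s.nodes w) (processToken w t (s.nodes w)) ∨
      ForwardSpec w t (s.nodes w) (processToken w t (s.nodes w)) :=
  processToken_spec (h.notMem hw) (h.notMem_token (Or.inr hp) hw)
    (h.good w hw (by rw [hp]; simp))

lemma ControlInv.dead_process {s : State N} (h : ControlInv s) {w : Fin N} {t : Token N}
    (hp : (s.nodes w).phase = .waitToken t) :
    ∀ z ∈ ((s.nodes w).crashed ∪ t.crashed) ∪ ((s.nodes w).report \ (t.crashed \ (s.nodes w).crashed)),
      (s.nodes z).alive = false := by
  intro z hz
  simp only [mem_union, mem_sdiff] at hz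
  rcases hz with (hz | hz) | hz
  · exact h.dead w z (mem_union_left _ hz)
  · exact h.token_dead w t (Or.inr hp) z hz
  · exact h.dead w z (mem_union_right _ hz.1)

lemma ControlInv.others_dead {s : State N} (h : ControlInv s) {w : Fin N}
    (hw : (s.nodes w).alive = true) (hp : (s.nodes w).phase = .waitAlone) {z : Fin N}
    (hz : z ≠ w) : z ∈ (s.nodes w).crashed ∪ (s.nodes w).report := by
  apply (h.good w hw (by rw [hp]; simp)).gap
  rw [h.alone w hp, sdist_self]
  by_contra hc
  exact hz (eq_of_sdist (not_lt.mp hc))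

lemma ControlInv.step [NeZero N] {s s' : State N} (h : ControlInv s) (st : Step s s') :
    ControlInv s' := by
  cases st with
  | becomePassive i alive active =>
    exact h.quiet (quiet_setNode s i { s.nodes i with active := false } id rfl rfl rfl rfl rfl
      rfl s.msgs)
  | sendBasic i j ne alive active known =>
    exact h.quiet (quiet_setNode s i { s.nodes i with
      count := Function.update (s.nodes i).count j ((s.nodes i).count j + 1) } id rfl rfl rfl rfl
      rfl rfl _)
  | receiveBasic m rest inTransit alive =>
    exact h.quiet (quiet_receiveBasic s m rest)
  | crash i alive =>
    exact h.quiet (quiet_setNode s i { s.nodes i with alive := false } (fun _ => alive) rfl rfl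
      rfl rfl rfl rfl s.msgs)
  | detect i j alive crashed running => exact h.detect alive crashed running
  | receiveToken i t rest inTransit alive idle =>
    exact h.quiet (quiet_receiveToken s i t rest inTransit idle)
  | processToken i t alive passive waiting =>
    have hv := h.valid_of_held alive waiting
    rcases h.processSpec alive waiting with a | a | a
    · refine h.of_stopSpec alive (setNodeSend_self s i _) (fun z hz => setNodeSend_of_ne s _ hz) ?_
        a.stopSpec ?_ (Or.inl ⟨t, hv⟩)
      · simp [State.setNodeSend, a.send]
      · rw [a.crashed, a.report]; exact h.dead_process waiting
    · refine h.of_stopSpec alive (setNodeSend_self s i _) (fun z hz => setNodeSend_of_ne s _ hz) ?_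
        a.stopSpec ?_ (Or.inl ⟨t, hv⟩)
      · simp [State.setNodeSend, a.send]
      · rw [a.crashed, a.report]; exact h.dead_process waiting
    · exact h.forward alive waiting a
  | announceAlone i alive passive waiting =>
    refine h.of_stopSpec alive (setNode_self s i _) (fun z hz => setNode_of_ne s _ hz) rfl
      ⟨rfl, rfl, rfl, subset_union_left, ?_, Or.inr rfl, Or.inl rfl⟩ ?_ (Or.inr ?_)
    · intro z; simp
    · intro z hz
      simp only [union_empty] at hz
      exact h.dead i z hz
    · intro z hz
      by_contra hne
      have := h.dead i z (h.others_dead alive waiting hne)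
      rw [hz] at this
      cases this

lemma lastNode_val [NeZero N] : (lastNode N).val = N - 1 := rfl

lemma sdist_next_init [NeZero N] (p : Fin N) : sdist p (p + 1) = 1 := by
  have hp := p.isLt
  have hv : (p + 1).val = if p.val + 1 = N then 0 else p.val + 1 := by
    rw [Fin.val_add, Fin.val_one', Nat.add_mod_mod]
    split_ifs with h1
    · rw [h1]; simp
    · exact Nat.mod_eq_of_lt (by omega)
  unfold sdist
  rw [hv]
  split_ifs <;> omega

lemma ControlInv.init [NeZero N] {s : State N} (h : IsInit s) : ControlInv s := by
  obtain ⟨⟨act, hn⟩, hm, ht⟩ := h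
  have ph : ∀ z t, (s.nodes z).phase = .waitToken t →
      z = 0 ∧ t = ⟨0, lastNode N, 1, ∅⟩ := by
    intro z t
    rw [hn, initNode]
    dsimp only
    split_ifs with h1
    · intro h2; cases h2; exact ⟨h1, rfl⟩
    · intro h2; cases h2
  have tokAt : ∀ b t, TokenAt s b t → b = 0 ∧ t = ⟨0, lastNode N, 1, ∅⟩ := by
    rintro b t (h1 | h1)
    · rw [ht] at h1; simp at h1
    · exact ph b t h1
  have cr : ∀ z, (s.nodes z).crashed = ∅ := fun z => by rw [hn]; rfl
  have re : ∀ z, (s.nodes z).report = ∅ := fun z => by rw [hn]; rfl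
  have sq : ∀ z, (s.nodes z).seq = 0 := fun z => by rw [hn]; rfl
  have nx : ∀ z, (s.nodes z).next = z + 1 := fun z => by rw [hn]; rfl
  have stc : ∀ z, (s.nodes z).stored.crashed = ∅ := fun z => by rw [hn]; rfl
  have z0 : ∀ z : Fin N, ¬ z < 0 := fun z hz => by simp at hz
  refine ⟨?_, ?_, ?_, ?_, ?_, ?_, ?_, ?_, ?_, ?_, ?_, ?_, ?_, ?_, ?_⟩
  · intro i z hz; simp [cr, re] at hz
  · intro b t hat z hz
    rw [(tokAt b t hat).2] at hz; simp at hz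
  · intro p; rw [stc]; exact empty_subset _
  · intro p _ _
    refine ⟨?_, ?_⟩
    · intro z hz
      rw [nx, sdist_next_init] at hz
      have := sdist_pos p z
      omega
    · simp [cr, re]
  · intro p hp
    rw [hn, initNode] at hp
    dsimp only at hp
    split_ifs at hp
  · intro p t hp
    rw [(ph p t hp).2, sq]
  · intro p _ h0
    rw [sq] at h0; omega
  · intro b z _ _; rw [sq]; omega
  · intro b z _; rw [sq]; omega
  · intro b z _ _ _; rw [sq]; omega
  · intro b z _ _; rw [sq]; omega
  · intro b t hat; rw [ht] at hat; simp at hat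
  · intro b t hv
    obtain ⟨rfl, rfl⟩ := tokAt b t hv.2.2
    constructor
    · intro z _ hz; exact absurd hz (z0 z)
    · intro z _; rw [sq]; omega
    · intro z _ x _; simp [cr]
    · intro z _ z' _ x hx; simp at hx
  · intro b t hv
    obtain ⟨rfl, rfl⟩ := tokAt b t hv.2.2
    intro z _ _
    exact empty_subset _
  · intro p b _ _ _
    constructor
    · intro z _ z' _ x hx; rw [stc] at hx; simp at hx
    · intro z _ x hx; rw [re] at hx; simp at hx
    · intro z _ x _ _ _; rw [cr, cr]

lemma ControlInv.sent_token {s : State N} (h : ControlInv s) {p b : Fin N}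
    (hp : (s.nodes p).Running) (hb : (s.nodes b).Running) (hn : b = (s.nodes p).next)
    (sub : (s.nodes p).report ⊆ (s.nodes p).stored.crashed) (due : Due s p b) {z : Fin N}
    (hz : z ∉ (s.nodes b).crashed ∪ (s.nodes p).stored.crashed) :
    z ∉ (s.nodes p).crashed ∪ (s.nodes p).report ∧ sdist p b ≤ sdist p z := by
  refine (tokenCore_of_stored h.dead ?_ (fun z => h.lower_lt p z hp.1)
    (fun z => h.lower p z hp.1) sub (h.stored p b hp hb due) due hb.1).2 z hz
  rw [hn]
  exact (h.good p hp.1 ((running_iff _).mp hp).2.2).gap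

/-! ### The message log and its cuts. -/

/-- The basic messages that were sent, that were received (with the sequence number of the
receiver at that time), and that were ignored. -/
structure Log (N : ℕ) where
  sent : Multiset (BasicMsg N)
  received : Multiset (BasicMsg N × ℕ)
  ignored : Multiset (BasicMsg N)

/-- The number of messages from `k` to `y` sent while the sequence number of `k` was below `c`. -/
def Log.sentBefore (L : Log N) (k y : Fin N) (c : ℕ) : ℕ :=
  L.sent.countP fun m => m.sender = k ∧ m.receiver = y ∧ m.seq < c

/-- The number of messages from `y` received by `k` while its sequence number was below `c`. -/
def Log.receivedBefore (L : Log N) (k y : Fin N) (c : ℕ) : ℕ :=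
  L.received.countP fun e => e.1.receiver = k ∧ e.1.sender = y ∧ e.2 < c

/-- The value of `count y` at `k` when its sequence number became `c`. -/
def Log.countAt (L : Log N) (k y : Fin N) (c : ℕ) : ℤ :=
  (L.sentBefore k y c : ℤ) - L.receivedBefore k y c

/-- In `count` the bound `c` exceeds the current number, so the cut comes after everything that `k`
has done. The field `received_known` is limited to the current interval of a node that has not
stopped, because crash sets change only at a visit or when a node stops. -/
structure LogInv (s : State N) (L : Log N) : Prop where
  count : ∀ k y c, (s.nodes k).seq < c → (s.nodes k).count y = L.countAt k y c
  split : L.sent = s.msgs + L.received.map Prod.fst + L.ignored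
  sent_seq : ∀ m ∈ L.sent, m.seq ≤ (s.nodes m.sender).seq
  sent_ne : ∀ m ∈ L.sent, m.receiver ≠ m.sender
  received_seq : ∀ e ∈ L.received, e.2 ≤ (s.nodes e.1.receiver).seq
  received_lt : ∀ e ∈ L.received, e.1.sender < e.1.receiver → e.1.seq ≤ e.2 + 1
  received_gt : ∀ e ∈ L.received, e.1.receiver < e.1.sender → e.1.seq ≤ e.2
  ignored : ∀ m ∈ L.ignored, m.sender ∈ (s.nodes m.receiver).crashed
  -- When the token reaches the receiver, these are the messages that may have been sent after the
  -- latest visit of their sender. Such a message would cross the new cut backwards, and the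
  -- receiver must be black at least up to the sender.
  black : ∀ e ∈ L.received, (s.nodes e.1.receiver).alive = true →
    e.2 = (s.nodes e.1.receiver).seq →
    (e.1.seq = e.2 + 1 ∨ (e.1.receiver < e.1.sender ∧ e.1.seq = e.2)) →
    cdist e.1.receiver e.1.sender ≤ cdist e.1.receiver (s.nodes e.1.receiver).black
  received_known : ∀ e ∈ L.received, (s.nodes e.1.receiver).phase ≠ .announced →
    (s.nodes e.1.receiver).phase ≠ .waitAlone → e.2 = (s.nodes e.1.receiver).seq →
    e.1.sender ∉ (s.nodes e.1.receiver).crashed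
  alone_dead : ∀ k, (s.nodes k).phase = .waitAlone → ∀ z ≠ k, (s.nodes z).alive = false
  /-- Nodes become active again after a cut only by a message that crosses the cut. -/
  inactive : ∀ (U : Finset (Fin N)) (c : Fin N → ℕ),
    (∀ k ∈ U, 1 ≤ c k ∧ c k ≤ (s.nodes k).seq) →
    (∀ e ∈ L.received, e.1.receiver ∈ U → c e.1.receiver ≤ e.2 →
      e.1.sender ∈ U ∧ c e.1.sender ≤ e.1.seq) →
    (∀ k ∈ U, (s.nodes k).active = false) ∧ ∀ m ∈ L.sent, m.sender ∈ U → m.seq < c m.sender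

/-- The node was visited since the last time that the token was black at its destination, and it
is not known to have crashed. -/
def InWindow (s : State N) (b : Fin N) (t : Token N) (z : Fin N) : Prop :=
  z ∉ (s.nodes b).crashed ∪ t.crashed ∧ cdist b t.black < cdist b z

/-- The counts in the token are those of a cut that no message crosses backwards, as far as the
nodes in the window of the token are concerned. -/
structure TokenLog (s : State N) (L : Log N) (b : Fin N) (t : Token N) : Prop where
  back : ∀ e ∈ L.received, InWindow s b t e.1.receiver → InWindow s b t e.1.sender →
    e.2 < (s.nodes e.1.receiver).seq → e.1.seq < (s.nodes e.1.sender).seq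
  count : ∀ k, InWindow s b t k → t.count k =
    countOutside (s.nodes k).crashed fun y => L.countAt k y (s.nodes k).seq
  pos : ∀ k, InWindow s b t k → 1 ≤ (s.nodes k).seq

/-- A step that does not involve basic messages. -/
structure NoBasic (s s' : State N) : Prop where
  msgs : s'.msgs = s.msgs
  count : ∀ k, (s'.nodes k).count = (s.nodes k).count
  alive : ∀ k, (s'.nodes k).alive = true → (s.nodes k).alive = true
  active : ∀ k, (s'.nodes k).active = true → (s.nodes k).active = true
  crashed : ∀ k, (s.nodes k).crashed ⊆ (s'.nodes k).crashed
  seq : ∀ k, (s'.nodes k).seq = (s.nodes k).seq ∨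
    ((s.nodes k).seq < (s'.nodes k).seq ∧ (s'.nodes k).active = false)
  black : ∀ k, (s'.nodes k).seq = (s.nodes k).seq →
    cdist k (s.nodes k).black ≤ cdist k (s'.nodes k).black
  known : ∀ k, (s'.nodes k).seq = (s.nodes k).seq → (s'.nodes k).phase ≠ .announced →
    (s'.nodes k).phase ≠ .waitAlone → (s'.nodes k).crashed = (s.nodes k).crashed ∧
      (s.nodes k).phase ≠ .announced ∧ (s.nodes k).phase ≠ .waitAlone
  alone : ∀ k, (s'.nodes k).phase = .waitAlone → (s.nodes k).phase = .waitAlone ∨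
    ((s'.nodes k).alive = true)

lemma LogInv.received_sent {s : State N} {L : Log N} (h : LogInv s L) {e : BasicMsg N × ℕ}
    (he : e ∈ L.received) : e.1 ∈ L.sent := by
  rw [h.split]
  exact Multiset.mem_add.mpr (Or.inl (Multiset.mem_add.mpr (Or.inr (Multiset.mem_map_of_mem _ he))))

lemma LogInv.noBasic {s s' : State N} {L : Log N} (h : LogInv s L) (q : NoBasic s s')
    (hc : ControlInv s') : LogInv s' L := by
  have sq : ∀ k, (s.nodes k).seq ≤ (s'.nodes k).seq := by
    intro k; rcases q.seq k with h1 | h1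
    · exact h1.ge
    · exact h1.1.le
  refine ⟨?_, ?_, ?_, h.sent_ne, ?_, h.received_lt, h.received_gt, ?_, ?_, ?_, ?_, ?_⟩
  · intro k y c hlt
    rw [q.count]; exact h.count k y c ((sq k).trans_lt hlt)
  · rw [q.msgs]; exact h.split
  · intro m hm; exact (h.sent_seq m hm).trans (sq _)
  · intro e he; exact (h.received_seq e he).trans (sq _)
  · intro m hm; exact q.crashed _ (h.ignored m hm)
  · intro e he hal heq hor
    have h1 := h.received_seq e he
    have h2 := sq e.1.receiver
    exact (h.black e he (q.alive _ hal) (by omega) hor).trans (q.black _ (by omega))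
  · intro e he hp1 hp2 heq
    have h1 := h.received_seq e he
    have h2 := sq e.1.receiver
    obtain ⟨h3, h4, h5⟩ := q.known e.1.receiver (by omega) hp1 hp2
    rw [h3]
    exact h.received_known e he h4 h5 (by omega)
  · intro k hk z hz
    rcases q.alone k hk with h1 | h1
    · exact dead_of_alive_imp (q.alive z) (h.alone_dead k h1 z hz)
    · exact hc.dead k z (hc.others_dead h1 hk hz)
  · intro U c hU hrec
    -- The nodes of `U` left out by the filter reach their cut in this very step: they are passive,
    -- and all their messages have smaller numbers.
    obtain ⟨h1, h2⟩ := h.inactive (U.filter fun k => c k ≤ (s.nodes k).seq) c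
      (fun k hk => ⟨(hU k (mem_filter.mp hk).1).1, (mem_filter.mp hk).2⟩) (by
        intro e he hr hle
        obtain ⟨h3, h4⟩ := hrec e he (mem_filter.mp hr).1 hle
        exact ⟨mem_filter.mpr ⟨h3, h4.trans (h.sent_seq _ (h.received_sent he))⟩, h4⟩)
    refine ⟨?_, ?_⟩
    · intro k hk
      by_cases hck : c k ≤ (s.nodes k).seq
      · have := h1 k (mem_filter.mpr ⟨hk, hck⟩)
        by_contra hact
        rw [Bool.not_eq_false] at hact
        rw [q.active k hact] at this
        cases this
      · rcases q.seq k with h3 | h3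
        · have := (hU k hk).2; omega
        · exact h3.2
    · intro m hm hs
      by_cases hck : c m.sender ≤ (s.nodes m.sender).seq
      · exact h2 m hm (mem_filter.mpr ⟨hs, hck⟩)
      · have := h.sent_seq m hm; omega

lemma countP_add_singleton {α : Type*} (p : α → Prop) [DecidablePred p] (S : Multiset α) (a : α) :
    (S + {a}).countP p = S.countP p + if p a then 1 else 0 := by
  rw [Multiset.countP_add]
  congr 1
  rw [← Multiset.cons_zero, Multiset.countP_cons, Multiset.countP_zero, zero_add]

lemma LogInv.send {s : State N} {L : Log N} (h : LogInv s L) {i j : Fin N} (ne : j ≠ i)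
    (active : (s.nodes i).active = true) {s' : State N}
    (sw : s'.nodes i = { s.nodes i with
            count := Function.update (s.nodes i).count j ((s.nodes i).count j + 1) })
    (so : ∀ z ≠ i, s'.nodes z = s.nodes z)
    (hm : s'.msgs = s.msgs + {⟨i, j, (s.nodes i).seq⟩}) :
    LogInv s' { L with sent := L.sent + {⟨i, j, (s.nodes i).seq⟩} } := by
  have key : ∀ z, (s'.nodes z).seq = (s.nodes z).seq ∧ (s'.nodes z).alive = (s.nodes z).alive ∧
      (s'.nodes z).crashed = (s.nodes z).crashed ∧ (s'.nodes z).black = (s.nodes z).black ∧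
      (s'.nodes z).phase = (s.nodes z).phase ∧ (s'.nodes z).active = (s.nodes z).active := by
    intro z
    by_cases hz : z = i
    · rw [hz, sw]; simp
    · rw [so z hz]; simp
  have msg : ∀ m ∈ L.sent + {⟨i, j, (s.nodes i).seq⟩}, m ∈ L.sent ∨
      m = ⟨i, j, (s.nodes i).seq⟩ := by
    intro m hm
    simpa using hm
  refine ⟨?_, ?_, ?_, ?_, ?_, h.received_lt, h.received_gt, ?_, ?_, ?_, ?_, ?_⟩
  · intro k y c hlt
    rw [(key k).1] at hlt
    have h1 := h.count k y c hlt
    simp only [Log.countAt, Log.sentBefore, Log.receivedBefore, countP_add_singleton] at h1 ⊢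
    by_cases hk : k = i
    · subst hk
      rw [sw]
      by_cases hy : y = j
      · subst hy
        simp only [Function.update_self, h1]
        rw [if_pos ⟨trivial, trivial, hlt⟩]
        push_cast
        ring
      · simp only [Function.update_of_ne hy, h1]
        rw [if_neg (by rintro ⟨-, h3, -⟩; exact hy h3.symm)]
        simp
    · rw [so k hk, h1]
      rw [if_neg (by rintro ⟨h3, -, -⟩; exact hk h3.symm)]
      simp
  · rw [hm]
    dsimp only
    rw [h.split]
    abel
  · intro m hm
    rw [(key _).1]
    rcases msg m hm with h1 | rfl
    · exact h.sent_seq m h1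
    · exact le_rfl
  · intro m hm
    rcases msg m hm with h1 | rfl
    · exact h.sent_ne m h1
    · exact ne
  · intro e he; rw [(key _).1]; exact h.received_seq e he
  · intro m hm; rw [(key _).2.2.1]; exact h.ignored m hm
  · intro e he; rw [(key _).1, (key _).2.1, (key _).2.2.2.1]; exact h.black e he
  · intro e he; rw [(key _).1, (key _).2.2.1, (key _).2.2.2.2.1]; exact h.received_known e he
  · intro k hk z hz
    rw [(key _).2.2.2.2.1] at hk
    rw [(key _).2.1]; exact h.alone_dead k hk z hz
  · intro U c hU hrec
    obtain ⟨h1, h2⟩ := h.inactive U c (fun k hk => by have := hU k hk; rwa [(key k).1] at this) hrec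
    refine ⟨fun k hk => by rw [(key k).2.2.2.2.2]; exact h1 k hk, ?_⟩
    intro m hm hs
    rcases msg m hm with h3 | rfl
    · exact h2 m h3 hs
    -- The sender is active, so it cannot belong to `U`.
    · have := h1 i hs
      rw [active] at this
      cases this

lemma LogInv.ignore {s : State N} {L : Log N} (h : LogInv s L) {m : BasicMsg N}
    {rest : Multiset (BasicMsg N)} (hin : s.msgs = m ::ₘ rest)
    (hk : m.sender ∈ (s.nodes m.receiver).crashed) {s' : State N}
    (hs : s'.nodes = s.nodes) (hm : s'.msgs = rest) :
    LogInv s' { L with ignored := m ::ₘ L.ignored } := by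
  refine ⟨?_, ?_, ?_, ?_, ?_, h.received_lt, h.received_gt, ?_, ?_, ?_, ?_, ?_⟩
  · rw [hs]; exact h.count
  · dsimp only
    rw [hm, h.split, hin, ← Multiset.singleton_add, ← Multiset.singleton_add]
    abel
  · rw [hs]; exact h.sent_seq
  · exact h.sent_ne
  · rw [hs]; exact h.received_seq
  · rw [hs]
    intro m' hm'
    rcases Multiset.mem_cons.mp hm' with rfl | h1
    · exact hk
    · exact h.ignored m' h1
  · rw [hs]; exact h.black
  · rw [hs]; exact h.received_known
  · rw [hs]; exact h.alone_dead
  · rw [hs]; exact h.inactive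

lemma LogInv.receive {s : State N} {L : Log N} (h : LogInv s L) (hcon : ControlInv s)
    {m : BasicMsg N} {rest : Multiset (BasicMsg N)} (hin : s.msgs = m ::ₘ rest)
    (alive : (s.nodes m.receiver).alive = true)
    (hk : m.sender ∉ (s.nodes m.receiver).crashed) {s' : State N}
    (sw : s'.nodes m.receiver = receiveBasic m.receiver m.sender m.seq (s.nodes m.receiver))
    (so : ∀ z ≠ m.receiver, s'.nodes z = s.nodes z) (hm : s'.msgs = rest) :
    LogInv s' { L with received := L.received + {(m, (s.nodes m.receiver).seq)} } := by
  have hms : m ∈ L.sent := by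
    rw [h.split, hin]; simp
  have hne := h.sent_ne m hms
  have hsq := h.sent_seq m hms
  obtain ⟨f1, f2, f3, f4, f5, f6, f7⟩ :=
    receiveBasic_fields m.receiver m.sender m.seq (s.nodes m.receiver)
  have key : ∀ z, (s'.nodes z).seq = (s.nodes z).seq ∧ (s'.nodes z).alive = (s.nodes z).alive ∧
      (s'.nodes z).crashed = (s.nodes z).crashed ∧
      (s'.nodes z).phase = (s.nodes z).phase := by
    intro z
    by_cases hz : z = m.receiver
    · rw [hz, sw, f1, f2, f4, f7]; simp
    · rw [so z hz]; simp
  have hbl : ∀ z, cdist z (s.nodes z).black ≤ cdist z (s'.nodes z).black := by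
    intro z
    by_cases hz : z = m.receiver
    · rw [hz, sw]
      unfold receiveBasic
      rw [if_neg hk]
      dsimp only
      split_ifs
      · rw [cdist_furthest]; exact le_max_left _ _
      · exact le_rfl
    · rw [so z hz]
  have msg : ∀ e ∈ L.received + {(m, (s.nodes m.receiver).seq)}, e ∈ L.received ∨
      e = (m, (s.nodes m.receiver).seq) := by
    intro e he
    simpa using he
  refine ⟨?_, ?_, ?_, h.sent_ne, ?_, ?_, ?_, ?_, ?_, ?_, ?_, ?_⟩
  · intro k y c hlt
    rw [(key k).1] at hlt
    have h1 := h.count k y c hlt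
    simp only [Log.countAt, Log.sentBefore, Log.receivedBefore, countP_add_singleton] at h1 ⊢
    by_cases hk' : k = m.receiver
    · subst hk'
      rw [sw]
      unfold receiveBasic
      rw [if_neg hk]
      by_cases hy : y = m.sender
      · subst hy
        simp only [Function.update_self, h1]
        rw [if_pos ⟨trivial, trivial, hlt⟩]
        push_cast
        ring
      · simp only [Function.update_of_ne hy, h1]
        rw [if_neg (by rintro ⟨-, h3, -⟩; exact hy h3.symm)]
        simp
    · rw [so k hk', h1]
      rw [if_neg (by rintro ⟨h3, -, -⟩; exact hk' h3.symm)]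
      simp
  · dsimp only
    rw [hm, h.split, hin, Multiset.map_add, Multiset.map_singleton, ← Multiset.singleton_add]
    abel
  · intro m' hm'; rw [(key _).1]; exact h.sent_seq m' hm'
  · intro e he
    rw [(key _).1]
    rcases msg e he with h1 | rfl
    · exact h.received_seq e h1
    · exact le_rfl
  · intro e he
    rcases msg e he with h1 | rfl
    · exact h.received_lt e h1
    · intro _
      exact hsq.trans (hcon.upper _ _ alive)
  · intro e he
    rcases msg e he with h1 | rfl
    · exact h.received_gt e h1
    · intro hlt
      exact hsq.trans (hcon.upper_lt _ _ alive hlt)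
  · intro m' hm'; rw [(key _).2.2.1]; exact h.ignored m' hm'
  · intro e he
    rw [(key _).1, (key _).2.1]
    rcases msg e he with h1 | rfl
    · intro h2 h3 h4
      exact (h.black e h1 h2 h3 h4).trans (hbl _)
    · intro _ _ h4
      dsimp only at h4 ⊢
      rw [sw]
      unfold receiveBasic
      rw [if_neg hk]
      dsimp only
      rw [if_pos h4, cdist_furthest]
      exact le_max_right _ _
  · intro e he
    rw [(key _).1, (key _).2.2.1, (key _).2.2.2]
    rcases msg e he with h1 | rfl
    · exact h.received_known e h1
    · intro _ _ _; exact hk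
  · intro k hk' z hz
    rw [(key _).2.2.2] at hk'
    rw [(key _).2.1]; exact h.alone_dead k hk' z hz
  · intro U c hU hrec
    have hU' : ∀ k ∈ U, 1 ≤ c k ∧ c k ≤ (s.nodes k).seq :=
      fun k hk => by have := hU k hk; rwa [(key k).1] at this
    obtain ⟨h1, h2⟩ := h.inactive U c hU' (fun e he => hrec e (Multiset.mem_add.mpr (Or.inl he)))
    refine ⟨?_, h2⟩
    intro k hkU
    by_cases hkr : k = m.receiver
    -- Applied to the message just received, the hypothesis makes its sender a node of `U` that sent
    -- after its cut, which was impossible before the step.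
    · exfalso
      subst hkr
      obtain ⟨h3, h4⟩ := hrec (m, (s.nodes m.receiver).seq) (by simp) hkU (hU' _ hkU).2
      have := h2 m hms h3
      dsimp only at h4
      omega
    · rw [so k hkr]; exact h1 k hkU

/-- A new event carries the current number, so it lies after every cut reached so far. -/
lemma countAt_send {L : Log N} {i j k y : Fin N} {q c : ℕ} (hc : k = i → c ≤ q) :
    Log.countAt { L with sent := L.sent + {⟨i, j, q⟩} } k y c = L.countAt k y c := by
  simp only [Log.countAt, Log.sentBefore, Log.receivedBefore, countP_add_singleton]
  rw [if_neg]
  · simp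
  · rintro ⟨h1, -, h2⟩
    have := hc h1.symm
    omega

lemma countAt_receive {L : Log N} {m : BasicMsg N} {k y : Fin N} {q c : ℕ}
    (hc : k = m.receiver → c ≤ q) :
    Log.countAt { L with received := L.received + {(m, q)} } k y c = L.countAt k y c := by
  simp only [Log.countAt, Log.sentBefore, Log.receivedBefore, countP_add_singleton]
  rw [if_neg]
  · simp
  · rintro ⟨h1, -, h2⟩
    have := hc h1.symm
    omega

lemma TokenLog.mono {s s' : State N} {L L' : Log N} {b : Fin N} {t : Token N}
    (h : TokenLog s L b t) (sq : ∀ z, (s'.nodes z).seq = (s.nodes z).seq)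
    (cr : ∀ z, (s'.nodes z).crashed = (s.nodes z).crashed)
    (hcount : ∀ k y, L'.countAt k y (s.nodes k).seq = L.countAt k y (s.nodes k).seq)
    (hrec : ∀ e ∈ L'.received, e ∈ L.received ∨ e.2 = (s.nodes e.1.receiver).seq) :
    TokenLog s' L' b t := by
  have hw : ∀ z, InWindow s' b t z ↔ InWindow s b t z := by
    intro z; simp only [InWindow, cr]
  refine ⟨?_, ?_, ?_⟩
  · intro e he
    rw [hw, hw, sq, sq]
    rcases hrec e he with h1 | h1
    · exact h.back e h1
    · intro _ _ h2; omega
  · intro k hk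
    rw [hw] at hk
    rw [h.count k hk, cr, sq]
    simp only [hcount]
  · intro k hk
    rw [hw] at hk
    rw [sq]; exact h.pos k hk

/-- This covers the initial token, backup tokens and tokens made black by a report, whose counts
need not be trusted. -/
lemma TokenLog.of_window_empty {s : State N} {b : Fin N} {t : Token N} (L : Log N)
    (h : ∀ z, ¬ InWindow s b t z) : TokenLog s L b t :=
  ⟨fun _ _ h1 => absurd h1 (h _), fun _ h1 => absurd h1 (h _), fun _ h1 => absurd h1 (h _)⟩

/-- The local part of `NoBasic`. -/
structure NoBasicAt (w : Fin N) (x y : NodeState N) : Prop where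
  count : y.count = x.count
  alive : y.alive = true → x.alive = true
  active : y.active = true → x.active = true
  crashed : x.crashed ⊆ y.crashed
  seq : y.seq = x.seq ∨ (x.seq < y.seq ∧ y.active = false)
  black : y.seq = x.seq → cdist w x.black ≤ cdist w y.black
  known : y.seq = x.seq → y.phase ≠ .announced → y.phase ≠ .waitAlone →
    y.crashed = x.crashed ∧ x.phase ≠ .announced ∧ x.phase ≠ .waitAlone
  alone : y.phase = .waitAlone → x.phase = .waitAlone ∨ y.alive = true

lemma NoBasicAt.refl (w : Fin N) (x : NodeState N) : NoBasicAt w x x :=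
  ⟨rfl, id, id, Subset.rfl, Or.inl rfl, fun _ => le_rfl, fun _ h1 h2 => ⟨rfl, h1, h2⟩, Or.inl⟩

lemma NoBasicAt.noBasic {s s' : State N} {w : Fin N} {y : NodeState N}
    (h : NoBasicAt w (s.nodes w) y) (sw : s'.nodes w = y)
    (so : ∀ z ≠ w, s'.nodes z = s.nodes z) (hm : s'.msgs = s.msgs) : NoBasic s s' := by
  have key : ∀ z, NoBasicAt z (s.nodes z) (s'.nodes z) := by
    intro z
    by_cases hz : z = w
    · rw [hz, sw]; exact h
    · rw [so z hz]; exact NoBasicAt.refl _ _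
  exact ⟨hm, fun k => (key k).count, fun k => (key k).alive, fun k => (key k).active,
    fun k => (key k).crashed, fun k => (key k).seq, fun k => (key k).black,
    fun k => (key k).known, fun k => (key k).alone⟩

lemma DetectSpec.noBasicAt {w j : Fin N} {x : NodeState N}
    {r : NodeState N × Option (Fin N × Token N)} (a : DetectSpec w j x r) (hx : x.alive = true) :
    NoBasicAt w x r.1 where
  count := a.count
  alive := by rw [a.alive]; exact id
  active := by rw [a.active]; exact id
  crashed := by rw [a.crashed]
  seq := Or.inl a.seq
  black := fun _ => a.black
  known := by
    intro _ h1 h2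
    rcases a.phase with h | h
    · exact absurd h.2 h2
    · rw [h] at h1 h2; exact ⟨a.crashed, h1, h2⟩
  alone := fun _ => Or.inr (by rw [a.alive, hx])

lemma AnnounceSpec.noBasicAt {w : Fin N} {t : Token N} {x : NodeState N}
    {r : NodeState N × Option (Fin N × Token N)} (a : AnnounceSpec w t x r) :
    NoBasicAt w x r.1 where
  count := a.count
  alive := by rw [a.alive]; exact id
  active := by rw [a.active]; exact id
  crashed := a.stopSpec.crashed
  seq := Or.inl a.seq
  black := by intro _; rw [a.black, cdist_self]; omega
  known := fun _ h => absurd a.phase h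
  alone := by intro h; rw [a.phase] at h; cases h

lemma AloneSpec.noBasicAt {w : Fin N} {t : Token N} {x : NodeState N}
    {r : NodeState N × Option (Fin N × Token N)} (a : AloneSpec w t x r) (hx : x.alive = true) :
    NoBasicAt w x r.1 where
  count := a.count
  alive := by rw [a.alive]; exact id
  active := by rw [a.active]; exact id
  crashed := a.stopSpec.crashed
  seq := Or.inl a.seq
  black := fun _ => a.black
  known := fun _ _ h => absurd a.phase h
  alone := fun _ => Or.inr (by rw [a.alive, hx])

lemma ForwardSpec.noBasicAt {w : Fin N} {t : Token N} {x : NodeState N}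
    {r : NodeState N × Option (Fin N × Token N)} (a : ForwardSpec w t x r)
    (hx : x.active = false) : NoBasicAt w x r.1 where
  count := a.count
  alive := by rw [a.alive]; exact id
  active := by rw [a.active]; exact id
  crashed := by rw [a.crashed]; exact subset_union_left.trans subset_union_left
  seq := Or.inr ⟨by rw [a.seq]; omega, by rw [a.active, hx]⟩
  black := by intro h; rw [a.seq] at h; omega
  known := by intro h; rw [a.seq] at h; omega
  alone := by intro h; rw [a.phase] at h; cases h

/-- A step either does not involve basic messages, or it sends or receives one. -/
lemma ControlInv.noBasic_or [NeZero N] {s s' : State N} (h : ControlInv s) (st : Step s s') :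
    NoBasic s s' ∨
    (∃ i j, j ≠ i ∧ (s.nodes i).alive = true ∧ (s.nodes i).active = true ∧
      s' = { s.setNode i { s.nodes i with
              count := Function.update (s.nodes i).count j ((s.nodes i).count j + 1) } with
            msgs := s.msgs + {⟨i, j, (s.nodes i).seq⟩} }) ∨
    (∃ m rest, s.msgs = m ::ₘ rest ∧ (s.nodes m.receiver).alive = true ∧
      s' = { s.setNode m.receiver
              (FTSafra.receiveBasic m.receiver m.sender m.seq (s.nodes m.receiver)) with
            msgs := rest }) := by
  cases st with
  | sendBasic i j ne alive active known =>
    exact Or.inr (Or.inl ⟨i, j, ne, alive, active, rfl⟩)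
  | receiveBasic m rest inTransit alive =>
    exact Or.inr (Or.inr ⟨m, rest, inTransit, alive, rfl⟩)
  | becomePassive i alive active =>
    left
    refine NoBasicAt.noBasic (w := i) ?_ (setNode_self s i _) (fun z hz => setNode_of_ne s _ hz) rfl
    exact ⟨rfl, id, by simp, Subset.rfl, Or.inl rfl, fun _ => le_rfl,
      fun _ h1 h2 => ⟨rfl, h1, h2⟩, Or.inl⟩
  | crash i alive =>
    left
    refine NoBasicAt.noBasic (w := i) ?_ (setNode_self s i _) (fun z hz => setNode_of_ne s _ hz) rfl
    exact ⟨rfl, by simp, id, Subset.rfl, Or.inl rfl, fun _ => le_rfl,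
      fun _ h1 h2 => ⟨rfl, h1, h2⟩, Or.inl⟩
  | detect i j alive crashed running =>
    left
    by_cases hn : j ∈ (s.nodes i).crashed ∪ (s.nodes i).report
    · rw [detectCrash_of_mem hn, setNodeSend_none]
      exact NoBasicAt.noBasic (w := i) (NoBasicAt.refl _ _) rfl (fun _ _ => rfl) rfl
    · exact NoBasicAt.noBasic ((h.detectSpec alive crashed running hn).noBasicAt alive)
        (setNodeSend_self s i _) (fun z hz => setNodeSend_of_ne s _ hz) rfl
  | receiveToken i t rest inTransit alive idle =>
    left
    refine NoBasicAt.noBasic (w := i) ?_ (setNode_self s i _) (fun z hz => setNode_of_ne s _ hz) rfl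
    unfold acceptToken
    split_ifs
    · exact ⟨rfl, id, id, Subset.rfl, Or.inl rfl, fun _ => le_rfl,
        fun _ _ _ => ⟨rfl, by simp [idle], by simp [idle]⟩, fun h => by cases h⟩
    · exact NoBasicAt.refl _ _
  | processToken i t alive passive waiting =>
    left
    refine NoBasicAt.noBasic ?_ (setNodeSend_self s i _) (fun z hz => setNodeSend_of_ne s _ hz) rfl
    rcases h.processSpec alive waiting with a | a | a
    · exact a.noBasicAt
    · exact a.noBasicAt alive
    · exact a.noBasicAt passive
  | announceAlone i alive passive waiting =>
    left
    refine NoBasicAt.noBasic (w := i) ?_ (setNode_self s i _) (fun z hz => setNode_of_ne s _ hz) rfl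
    exact ⟨rfl, id, id, subset_union_left, Or.inl rfl, fun _ => le_rfl,
      fun _ h1 => absurd rfl h1, fun h => by cases h⟩

/-- No alive node can send, and every message that can still arrive is ignored. -/
lemma Terminated.step [NeZero N] {s s' : State N} (ht : Terminated s) (h : ControlInv s)
    (st : Step s s') : Terminated s' := by
  rcases h.noBasic_or st with q | ⟨i, j, -, hal, hac, -⟩ | ⟨m, rest, hin, hal, rfl⟩
  · refine ⟨fun i hi => ?_, fun m hm => ?_⟩
    · by_contra hc
      rw [Bool.not_eq_false] at hc
      have := ht.1 i (q.alive i hi)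
      rw [q.active i hc] at this
      cases this
    · rw [q.msgs] at hm
      rcases ht.2 m hm with h1 | h1
      · exact Or.inl (dead_of_alive_imp (q.alive _) h1)
      · exact Or.inr (q.crashed _ h1)
  · have := ht.1 i hal
    rw [hac] at this
    cases this
  · have hk : m.sender ∈ (s.nodes m.receiver).crashed := by
      rcases ht.2 m (by rw [hin]; exact Multiset.mem_cons_self _ _) with h1 | h1
      · rw [hal] at h1; cases h1
      · exact h1
    have hrb : receiveBasic m.receiver m.sender m.seq (s.nodes m.receiver) =
        s.nodes m.receiver := by unfold receiveBasic; rw [if_pos hk]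
    rw [hrb]
    have hs : s.setNode m.receiver (s.nodes m.receiver) = s := by simp [State.setNode]
    rw [hs]
    refine ⟨ht.1, fun m' hm' => ht.2 m' ?_⟩
    rw [hin]; exact Multiset.mem_cons_of_mem hm'

/-! ### From the counts in the token to termination. -/

/-- The messages that `w` received since it last forwarded a token do not cross the cut
backwards, if their senders are beyond the node where `w` becomes white. -/
lemma LogInv.back_at {s : State N} {L : Log N} (hL : LogInv s L) (h : ControlInv s) {w : Fin N}
    {t : Token N} (hv : Valid s w t) {e : BasicMsg N × ℕ} (he : e ∈ L.received)
    (hr : e.1.receiver = w) (hj : e.1.sender ∉ (s.nodes w).crashed ∪ t.crashed)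
    (hlt : cdist w (s.nodes w).black < cdist w e.1.sender) :
    e.1.seq < (s.nodes e.1.sender).seq := by
  have core := h.token w t hv
  have hne : e.1.sender ≠ w := by
    intro he'; rw [he', cdist_self] at hlt; omega
  have h1 := hL.received_seq e he
  by_contra hge
  rw [not_lt] at hge
  have hb := hL.black e he (by rw [hr]; exact hv.1.1)
  rw [hr] at h1 hb
  rcases lt_or_gt_of_ne hne with h2 | h2
  · have h3 := core.seq_lt _ hj h2
    have h4 := hL.received_lt e he (by rw [hr]; exact h2)
    have := hb (by omega) (Or.inl (by omega))
    omega
  · have h3 := core.seq_le _ hj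
    have h4 := hL.received_gt e he (by rw [hr]; exact h2)
    have := hb (by omega) (Or.inr ⟨h2, by omega⟩)
    omega

lemma countP_le_of_imp {α : Type*} {p q : α → Prop} [DecidablePred p] [DecidablePred q]
    {S : Multiset α} (h : ∀ a ∈ S, p a → q a) : S.countP p ≤ S.countP q := by
  induction S using Multiset.induction with
  | empty => simp
  | cons a S ih =>
    have h1 := ih (fun b hb => h b (Multiset.mem_cons_of_mem hb))
    have h2 := h a (Multiset.mem_cons_self a S)
    rw [Multiset.countP_cons, Multiset.countP_cons]
    by_cases hp : p a
    · rw [if_pos hp, if_pos (h2 hp)]; omega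
    · rw [if_neg hp]; omega

lemma imp_of_countP_le {α : Type*} {p q : α → Prop} [DecidablePred p] [DecidablePred q]
    {S : Multiset α} (h : ∀ a ∈ S, p a → q a) (hle : S.countP q ≤ S.countP p) :
    ∀ a ∈ S, q a → p a := by
  induction S using Multiset.induction with
  | empty => simp
  | cons a S ih =>
    have h0 : ∀ b ∈ S, p b → q b := fun b hb => h b (Multiset.mem_cons_of_mem hb)
    have h1 := countP_le_of_imp h0
    have h2 := h a (Multiset.mem_cons_self a S)
    rw [Multiset.countP_cons, Multiset.countP_cons] at hle
    intro b hb hq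
    by_cases hp : p a
    · rw [if_pos hp, if_pos (h2 hp)] at hle
      rcases Multiset.mem_cons.mp hb with rfl | hb
      · exact hp
      · exact ih h0 (by omega) b hb hq
    · rw [if_neg hp] at hle
      by_cases hqa : q a
      · rw [if_pos hqa] at hle; omega
      · rw [if_neg hqa] at hle
        rcases Multiset.mem_cons.mp hb with rfl | hb
        · exact absurd hq hqa
        · exact ih h0 (by omega) b hb hq

/-- If no message between nodes of `U` crosses the cut `c` backwards, and the counts at the cut
add up to `0`, then no message between these nodes crosses the cut forwards. -/
lemma LogInv.no_forward {s : State N} {L : Log N} (hL : LogInv s L) (U : Finset (Fin N))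
    (c : Fin N → ℕ)
    (back : ∀ e ∈ L.received, e.1.receiver ∈ U → e.1.sender ∈ U → e.2 < c e.1.receiver →
      e.1.seq < c e.1.sender)
    (sum : ∑ k ∈ U, ∑ y ∈ U, L.countAt k y (c k) = 0) :
    (∀ m ∈ s.msgs, m.receiver ∈ U → m.sender ∈ U → c m.sender ≤ m.seq) ∧
    ∀ e ∈ L.received, e.1.receiver ∈ U → e.1.sender ∈ U → e.1.seq < c e.1.sender →
      e.2 < c e.1.receiver := by
  -- Of the messages from `j` to `k` sent before the cut, `X` counts those received, `Y` those in
  -- transit, and `Z` those ignored.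
  set X : Fin N → Fin N → ℕ := fun j k =>
    L.received.countP fun e => e.1.sender = j ∧ e.1.receiver = k ∧ e.1.seq < c j with hX
  set Y : Fin N → Fin N → ℕ := fun j k =>
    s.msgs.countP fun m => m.sender = j ∧ m.receiver = k ∧ m.seq < c j with hY
  set Z : Fin N → Fin N → ℕ := fun j k =>
    L.ignored.countP fun m => m.sender = j ∧ m.receiver = k ∧ m.seq < c j with hZ
  have hsent : ∀ j k, L.sentBefore j k (c j) = Y j k + X j k + Z j k := by
    intro j k
    simp only [Log.sentBefore, hX, hY, hZ]
    rw [hL.split, Multiset.countP_add, Multiset.countP_add, Multiset.countP_map,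
      ← Multiset.countP_eq_card_filter]
  have himp : ∀ j ∈ U, ∀ k ∈ U, ∀ e ∈ L.received,
      (e.1.receiver = k ∧ e.1.sender = j ∧ e.2 < c k) →
      (e.1.sender = j ∧ e.1.receiver = k ∧ e.1.seq < c j) := by
    rintro j hj k hk e he ⟨rfl, rfl, h3⟩
    exact ⟨rfl, rfl, back e he hk hj h3⟩
  have hle : ∀ j ∈ U, ∀ k ∈ U, L.receivedBefore k j (c k) ≤ X j k :=
    fun j hj k hk => countP_le_of_imp (himp j hj k hk)
  -- The double sum is regrouped to set what `j` sent to `k` against what `k` received from `j`.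
  -- Without backward messages each such term is nonnegative, while a count kept by a single node
  -- can have either sign.
  have hsum : ∑ j ∈ U, ∑ k ∈ U,
      ((L.sentBefore j k (c j) : ℤ) - L.receivedBefore k j (c k)) = 0 := by
    rw [← sum]
    simp only [Log.countAt, sum_sub_distrib]
    congr 1
    rw [sum_comm]
  have hnn : ∀ j ∈ U, ∀ k ∈ U,
      0 ≤ ((L.sentBefore j k (c j) : ℤ) - L.receivedBefore k j (c k)) := by
    intro j hj k hk
    have := hle j hj k hk
    rw [hsent]; push_cast; omega
  have hz : ∀ j ∈ U, ∀ k ∈ U, Y j k = 0 ∧ X j k ≤ L.receivedBefore k j (c k) := by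
    intro j hj k hk
    have h1 := (sum_eq_zero_iff_of_nonneg
      (fun j hj => sum_nonneg (fun k hk => hnn j hj k hk))).mp hsum j hj
    have h2 := (sum_eq_zero_iff_of_nonneg (fun k hk => hnn j hj k hk)).mp h1 k hk
    have h3 := hle j hj k hk
    rw [hsent] at h2; push_cast at h2
    omega
  refine ⟨?_, ?_⟩
  · intro m hm hr hs
    have h1 := (hz _ hs _ hr).1
    rw [hY] at h1
    have := Multiset.countP_eq_zero.mp h1 m hm
    by_contra hlt
    exact this ⟨rfl, rfl, not_le.mp hlt⟩
  · intro e he hr hs hlt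
    exact (imp_of_countP_le (himp _ hs _ hr) (hz _ hs _ hr).2 e he ⟨rfl, rfl, hlt⟩).2.2

/-- A white token at `w` has all of `U` except `w` in its window, and there `TokenCore.agree` and
`TokenWindow` make all crash sets equal to `A`. So all the counts added up refer to the same set
`U`, which may contain crashed nodes not yet known. -/
lemma terminated_of_announce {s : State N} {L : Log N} (hL : LogInv s L)
    (h : ControlInv s) {w : Fin N} {t : Token N} (hw : (s.nodes w).alive = true)
    (hp : (s.nodes w).phase = .waitToken t) (passive : (s.nodes w).active = false)
    (hT : TokenLog s L w t) (hno : ∀ i, ¬ Announced s i)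
    {r : NodeState N × Option (Fin N × Token N)} (a : AnnounceSpec w t (s.nodes w) r) :
    Terminated (s.setNodeSend w r) := by
  have hv := h.valid_of_held hw hp
  have core := h.token w t hv
  have win := h.window w t hv
  set A := (s.nodes w).crashed ∪ t.crashed with hA
  set U := univ \ A with hU
  have memU : ∀ z, z ∈ U ↔ z ∉ A := by intro z; simp [hU]
  have hwA : w ∉ A := h.notMem_excluded hv.2.2 hw
  have aliveU : ∀ z, (s.nodes z).alive = true → z ∈ U :=
    fun z hz => (memU z).mpr (h.notMem_excluded hv.2.2 hz)
  have inW : ∀ z ∈ U, z ≠ w → InWindow s w t z := by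
    intro z hz hzw
    refine ⟨(memU z).mp hz, ?_⟩
    rw [a.tokenBlack, cdist_self]
    by_contra hc
    exact hzw (cdist_eq_zero.mp (by omega))
  have crA : ∀ z ∈ U, z ≠ w → (s.nodes z).crashed = A := by
    intro z hz hzw
    have h1 := win z ((memU z).mp hz) (inW z hz hzw).2
    ext x
    have h2 := core.agree z ((memU z).mp hz) x
    rw [hA, mem_union]
    by_cases hx : x ∈ t.crashed
    · simp only [hx, or_true, iff_true]; exact h1 hx
    · rw [h2 hx]; tauto
  -- The cut is at the present moment for `w`, all of whose events have a number at most `seq`, and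
  -- at the latest visit for every other node.
  set c : Fin N → ℕ := fun z => if z = w then (s.nodes w).seq + 1 else (s.nodes z).seq with hc
  have cw : c w = (s.nodes w).seq + 1 := by simp [hc]
  have co : ∀ z ≠ w, c z = (s.nodes z).seq := fun z hz => by simp [hc, hz]
  have sum : ∑ k ∈ U, ∑ y ∈ U, L.countAt k y (c k) = 0 := by
    have hs := a.sum
    unfold countOutside at hs
    rw [← hA, ← hU] at hs
    rw [← hs]
    refine sum_congr rfl (fun k hk => ?_)
    by_cases hkw : k = w
    · subst hkw
      rw [Function.update_self]
      exact sum_congr rfl (fun y _ => (hL.count k y _ (by rw [cw]; omega)).symm)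
    · rw [Function.update_of_ne hkw, hT.count k (inW k hk hkw), crA k hk hkw, co k hkw]
      rfl
  have back : ∀ e ∈ L.received, e.1.receiver ∈ U → e.1.sender ∈ U → e.2 < c e.1.receiver →
      e.1.seq < c e.1.sender := by
    intro e he hr hs hlt
    by_cases hsw : e.1.sender = w
    · have := hL.sent_seq _ (hL.received_sent he)
      rw [hsw] at this ⊢
      rw [cw]; omega
    · rw [co _ hsw]
      by_cases hrw : e.1.receiver = w
      · refine hL.back_at h hv he hrw ((memU _).mp hs) ?_
        rw [a.black, cdist_self]
        by_contra hc
        exact hsw (cdist_eq_zero.mp (by omega))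
      · rw [co _ hrw] at hlt
        exact hT.back e he (inW _ hr hrw) (inW _ hs hsw) hlt
  obtain ⟨fmsgs, frec⟩ := hL.no_forward U c back sum
  -- Node `w` is left out because its number has not reached the cut. It is passive by assumption
  -- and has sent nothing after its cut.
  obtain ⟨act, snt⟩ := hL.inactive (U.erase w) c (by
      intro k hk
      rw [mem_erase] at hk
      rw [co k hk.1]
      exact ⟨hT.pos k (inW k hk.2 hk.1), le_rfl⟩) (by
      intro e he hr hle
      rw [mem_erase] at hr
      rw [co _ hr.1] at hle
      have h1 := hL.received_seq e he
      have h2 : e.1.sender ∈ U := by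
        rw [memU, ← crA _ hr.2 hr.1]
        -- Here it matters that nobody has announced before: an announcing node enlarges its crash
        -- set without a visit.
        refine hL.received_known e he (hno _) ?_ (by omega)
        intro hal
        have := hL.alone_dead _ hal w (Ne.symm hr.1)
        rw [hw] at this
        cases this
      have h3 : c e.1.sender ≤ e.1.seq := by
        by_contra hlt
        have := frec e he hr.2 h2 (not_le.mp hlt)
        rw [co _ hr.1] at this
        omega
      refine ⟨mem_erase.mpr ⟨?_, h2⟩, h3⟩
      intro hsw
      have := hL.sent_seq _ (hL.received_sent he)
      rw [hsw] at this h3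
      omega)
  have sw : (s.setNodeSend w r).nodes w = r.1 := setNodeSend_self s w r
  have so : ∀ z ≠ w, (s.setNodeSend w r).nodes z = s.nodes z :=
    fun z hz => setNodeSend_of_ne s r hz
  refine ⟨fun k hk => ?_, fun m hm => ?_⟩
  · by_cases hkw : k = w
    · rw [hkw, sw, a.active]; exact passive
    · rw [so k hkw] at hk ⊢
      exact act k (mem_erase.mpr ⟨hkw, aliveU k hk⟩)
  · have hm' : m ∈ s.msgs := hm
    have hms : m ∈ L.sent := by rw [hL.split]; simp [hm']
    by_contra hcon
    rw [not_or, Bool.not_eq_false] at hcon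
    have hrU : m.receiver ∈ U := by
      apply aliveU
      by_cases hkw : m.receiver = w
      · rw [hkw]; exact hw
      · rw [so _ hkw] at hcon; exact hcon.1
    have hsU : m.sender ∈ U := by
      rw [memU]
      by_cases hkw : m.receiver = w
      · rw [hkw, sw, a.crashed] at hcon; exact hcon.2
      · rw [so _ hkw, crA _ hrU hkw] at hcon; exact hcon.2
    have h1 := fmsgs m hm' hrU hsU
    by_cases hsw : m.sender = w
    · have := hL.sent_seq m hms
      rw [hsw] at this h1
      omega
    · have := snt m hms (mem_erase.mpr ⟨hsw, hsU⟩)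
      omega

lemma terminated_of_announceAlone {s : State N} {L : Log N} (hL : LogInv s L)
    (h : ControlInv s) {w : Fin N} (hw : (s.nodes w).alive = true)
    (hp : (s.nodes w).phase = .waitAlone) (passive : (s.nodes w).active = false)
    {s' : State N} {y : NodeState N} (sw : s'.nodes w = y) (hya : y.active = (s.nodes w).active)
    (hyc : y.crashed = (s.nodes w).crashed ∪ (s.nodes w).report)
    (so : ∀ z ≠ w, s'.nodes z = s.nodes z) (hm : s'.msgs = s.msgs) : Terminated s' := by
  have dead : ∀ z ≠ w, (s.nodes z).alive = false := fun z hz => h.dead w z (h.others_dead hw hp hz)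
  refine ⟨fun k hk => ?_, fun m hms => ?_⟩
  · by_cases hkw : k = w
    · rw [hkw, sw, hya]; exact passive
    · rw [so k hkw, dead k hkw] at hk; cases hk
  · rw [hm] at hms
    by_cases hkw : m.receiver = w
    · right
      rw [hkw, sw, hyc]
      apply h.others_dead hw hp
      have := hL.sent_ne m (by rw [hL.split]; simp [hms])
      rw [hkw] at this
      exact Ne.symm this
    · left; rw [so _ hkw]; exact dead _ hkw

/-- Apart from `w`, the new window is contained in the old one and lies beyond the black mark of
`w`. Hence messages received by `w` are covered by `LogInv.back_at`, and the other pairs by the old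
token. -/
lemma TokenLog.forward {s : State N} {L : Log N} (hL : LogInv s L)
    (h : ControlInv s) {w : Fin N} {t : Token N} (hv : Valid s w t)
    (hT : TokenLog s L w t)
    {r : NodeState N × Option (Fin N × Token N)} (a : ForwardSpec w t (s.nodes w) r)
    (h' : ControlInv (s.setNodeSend w r)) {b : Fin N} {t' : Token N}
    (hv' : Valid (s.setNodeSend w r) b t') : TokenLog (s.setNodeSend w r) L b t' := by
  obtain ⟨hb, ht', hbw, hdue⟩ := h.valid_forward hv a hv'
  set s' := s.setNodeSend w r with hs'
  have sw : s'.nodes w = r.1 := setNodeSend_self s w r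
  have so : ∀ z ≠ w, s'.nodes z = s.nodes z := fun z hz => setNodeSend_of_ne s r hz
  have sqw : (s'.nodes w).seq = (s.nodes w).seq + 1 := by rw [sw, a.seq]
  have hrun : (s'.nodes w).Running := by
    rw [sw]; exact ⟨by rw [a.alive]; exact hv.1.1, Or.inl a.phase⟩
  have sent : ∀ z ∉ (s'.nodes b).crashed ∪ t'.crashed,
      z ∉ (s'.nodes w).crashed ∧ sdist w b ≤ sdist w z := by
    intro z hz
    have := h'.sent_token hrun hv'.1 (by rw [sw]; exact hb)
      (by rw [sw, a.report]; exact empty_subset _) hdue (z := z) (by rw [sw, ← ht']; exact hz)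
    exact ⟨fun hm => this.1 (mem_union_left _ hm), this.2⟩
  rcases a.tokenBlack with hbl | ⟨hsub, hb1, hb2, hb3, hcnt⟩
  · apply TokenLog.of_window_empty
    rintro z ⟨hz, hlt⟩
    rw [ht', hbl] at hlt
    exact not_lt_cdist_of_sdist_le (sent z hz).2 hlt
  have hne : t'.black ≠ w := by
    intro he
    rw [← ht', he, cdist_self, ← hb] at hb3
    exact hbw (cdist_eq_zero.mp (by omega))
  rw [← ht'] at hb1 hb2 hb3 hcnt
  rw [← hb] at hb3
  have win : ∀ z, InWindow s' b t' z → z ≠ w → InWindow s w t z ∧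
      cdist w (s.nodes w).black < cdist w z := by
    rintro z ⟨hz, hlt⟩ hzw
    obtain ⟨h1, h2⟩ := sent z hz
    have hb4 := hb3
    rw [← sdist_eq_cdist hbw, ← sdist_eq_cdist hne] at hb4
    rw [cdist_of_sdist_le hb4, cdist_of_sdist_le h2, sdist_eq_cdist hne,
      sdist_eq_cdist hzw] at hlt
    refine ⟨⟨fun hm => h1 ?_, by omega⟩, by omega⟩
    rw [sw, a.crashed]; exact mem_union_left _ hm
  have crw : (s'.nodes w).crashed = (s.nodes w).crashed ∪ t.crashed := by
    rw [sw, a.crashed]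
    exact union_eq_left.mpr (hsub.trans (sdiff_subset.trans subset_union_right))
  refine ⟨?_, ?_, ?_⟩
  · intro e he hr hs hlt
    by_cases hsw : e.1.sender = w
    · have := hL.sent_seq _ (hL.received_sent he)
      rw [hsw] at this ⊢
      rw [sqw]; omega
    · rw [so _ hsw]
      obtain ⟨hs1, hs2⟩ := win _ hs hsw
      by_cases hrw : e.1.receiver = w
      · exact hL.back_at h hv he hrw hs1.1 hs2
      · rw [so _ hrw] at hlt
        exact hT.back e he (win _ hr hrw).1 hs1 hlt
  · intro k hk
    by_cases hkw : k = w
    · subst hkw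
      rw [hcnt, crw]
      unfold countOutside
      refine sum_congr rfl (fun y _ => ?_)
      exact hL.count k y _ (by rw [sqw]; omega)
    · rw [so k hkw, ht', a.tokenCount k hkw]
      exact hT.count k (win k hk hkw).1
  · intro k hk
    by_cases hkw : k = w
    · rw [hkw, sqw]; omega
    · rw [so k hkw]; exact hT.pos k (win k hk hkw).1

/-! ### The combined invariant and safety. -/

/-- The invariant of the system. -/
structure Inv (s : State N) : Prop where
  control : ControlInv s
  log : ∃ L, LogInv s L ∧ ∀ b t, Valid s b t → TokenLog s L b t

lemma TokenLog.quiet {s s' : State N} {L L' : Log N}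
    (hT : ∀ b t, Valid s b t → TokenLog s L b t) (q : Quiet s s')
    (hcount : ∀ k y, L'.countAt k y (s.nodes k).seq = L.countAt k y (s.nodes k).seq)
    (hrec : ∀ e ∈ L'.received, e ∈ L.received ∨ e.2 = (s.nodes e.1.receiver).seq) :
    ∀ b t, Valid s' b t → TokenLog s' L' b t :=
  fun b t hv => (hT b t (q.valid hv)).mono q.seq q.crashed hcount hrec

lemma Inv.step [NeZero N] {s s' : State N} (h : Inv s) (st : Step s s') : Inv s' := by
  have hcon := h.control
  have hcon' := hcon.step st
  refine ⟨hcon', ?_⟩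
  obtain ⟨L, hL, hT⟩ := h.log
  have hcases := hcon.noBasic_or st
  have same : ∀ e ∈ L.received, e ∈ L.received ∨ e.2 = (s.nodes e.1.receiver).seq :=
    fun e he => Or.inl he
  cases st with
  | sendBasic i j ne alive active known =>
    refine ⟨_, hL.send (i := i) (j := j) ne active (setNode_self s i _)
      (fun z hz => setNode_of_ne s _ hz) rfl, ?_⟩
    refine TokenLog.quiet hT (quiet_setNode s i { s.nodes i with
      count := Function.update (s.nodes i).count j ((s.nodes i).count j + 1) } id rfl rfl rfl rfl
      rfl rfl _) ?_ same
    intro k y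
    exact countAt_send (by rintro rfl; exact le_rfl)
  | receiveBasic m rest inTransit alive =>
    by_cases hk : m.sender ∈ (s.nodes m.receiver).crashed
    · refine ⟨_, hL.ignore inTransit hk ?_ rfl,
        TokenLog.quiet hT (quiet_receiveBasic s m rest) (fun _ _ => rfl) same⟩
      unfold FTSafra.receiveBasic
      rw [if_pos hk]
      simp [State.setNode]
    · refine ⟨_, hL.receive hcon inTransit alive hk (setNode_self s _ _)
        (fun z hz => setNode_of_ne s _ hz) rfl,
        TokenLog.quiet hT (quiet_receiveBasic s m rest) ?_ ?_⟩
      · intro k y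
        exact countAt_receive (by rintro rfl; exact le_rfl)
      · intro e he
        rcases Multiset.mem_add.mp he with h1 | h1
        · exact Or.inl h1
        · right
          rw [Multiset.mem_singleton] at h1
          rw [h1]
  | becomePassive i alive active =>
    have q := quiet_setNode s i { s.nodes i with active := false } id rfl rfl rfl rfl rfl rfl s.msgs
    refine ⟨L, hL.noBasic ?_ hcon', TokenLog.quiet hT q (fun _ _ => rfl) same⟩
    refine NoBasicAt.noBasic (w := i) ?_ (setNode_self s i _) (fun z hz => setNode_of_ne s _ hz) rfl
    exact ⟨rfl, id, by simp, Subset.rfl, Or.inl rfl, fun _ => le_rfl,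
      fun _ h1 h2 => ⟨rfl, h1, h2⟩, Or.inl⟩
  | crash i alive =>
    have q := quiet_setNode s i { s.nodes i with alive := false } (fun _ => alive) rfl rfl rfl rfl
      rfl rfl s.msgs
    refine ⟨L, hL.noBasic ?_ hcon', TokenLog.quiet hT q (fun _ _ => rfl) same⟩
    refine NoBasicAt.noBasic (w := i) ?_ (setNode_self s i _) (fun z hz => setNode_of_ne s _ hz) rfl
    exact ⟨rfl, by simp, id, Subset.rfl, Or.inl rfl, fun _ => le_rfl,
      fun _ h1 h2 => ⟨rfl, h1, h2⟩, Or.inl⟩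
  | receiveToken i t rest inTransit alive idle =>
    refine ⟨L, hL.noBasic ?_ hcon',
      TokenLog.quiet hT (quiet_receiveToken s i t rest inTransit idle) (fun _ _ => rfl) same⟩
    refine NoBasicAt.noBasic (w := i) ?_ (setNode_self s i _) (fun z hz => setNode_of_ne s _ hz) rfl
    unfold acceptToken
    split_ifs
    · exact ⟨rfl, id, id, Subset.rfl, Or.inl rfl, fun _ => le_rfl,
        fun _ _ _ => ⟨rfl, by simp [idle], by simp [idle]⟩, fun h => by cases h⟩
    · exact NoBasicAt.refl _ _
  | detect i j alive crashed running =>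
    by_cases hn : j ∈ (s.nodes i).crashed ∪ (s.nodes i).report
    · rw [detectCrash_of_mem hn, setNodeSend_none]
      exact ⟨L, hL, hT⟩
    · have spec := hcon.detectSpec alive crashed running hn
      have so : ∀ z ≠ i, (s.setNodeSend i (detectCrash i j (s.nodes i))).nodes z = s.nodes z :=
        fun z hz => setNodeSend_of_ne s _ hz
      refine ⟨L, hL.noBasic (NoBasicAt.noBasic (spec.noBasicAt alive)
        (setNodeSend_self s i _) so rfl) hcon', ?_⟩
      intro b t hv
      rcases hcon.detect_valid alive crashed running hn rfl hv with
        h1 | ⟨hb, ht, hrw, hdue, hsub, hbl⟩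
      · refine (hT b t h1).mono ?_ ?_ (fun _ _ => rfl) same
        · intro z; by_cases hz : z = i
          · rw [hz, setNodeSend_self, spec.seq]
          · rw [so z hz]
        · intro z; by_cases hz : z = i
          · rw [hz, setNodeSend_self, spec.crashed]
          · rw [so z hz]
      · apply TokenLog.of_window_empty
        rintro z ⟨hz, hlt⟩
        rw [ht] at hz
        have := (hcon'.sent_token hrw hv.1 hb hsub hdue hz).2
        rw [ht, hbl] at hlt
        exact not_lt_cdist_of_sdist_le this hlt
  | processToken i t alive passive waiting =>
    have hv := hcon.valid_of_held alive waiting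
    rcases hcon.processSpec alive waiting with a | a | a
    · refine ⟨L, hL.noBasic (a.noBasicAt.noBasic (setNodeSend_self s i _)
        (fun z hz => setNodeSend_of_ne s _ hz) rfl) hcon', ?_⟩
      intro b t' hv'
      refine absurd hv' (hcon.not_valid_of_stopSpec (setNodeSend_self s i _)
        (fun z hz => setNodeSend_of_ne s _ hz) ?_ a.stopSpec (Or.inl ⟨t, hv⟩) b t')
      simp [State.setNodeSend, a.send]
    · refine ⟨L, hL.noBasic ((a.noBasicAt alive).noBasic (setNodeSend_self s i _)
        (fun z hz => setNodeSend_of_ne s _ hz) rfl) hcon', ?_⟩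
      intro b t' hv'
      refine absurd hv' (hcon.not_valid_of_stopSpec (setNodeSend_self s i _)
        (fun z hz => setNodeSend_of_ne s _ hz) ?_ a.stopSpec (Or.inl ⟨t, hv⟩) b t')
      simp [State.setNodeSend, a.send]
    · refine ⟨L, hL.noBasic ((a.noBasicAt passive).noBasic (setNodeSend_self s i _)
        (fun z hz => setNodeSend_of_ne s _ hz) rfl) hcon', ?_⟩
      intro b t' hv'
      exact TokenLog.forward hL hcon hv (hT i t hv) a hcon' hv'
  | announceAlone i alive passive waiting =>
    have others : ∀ z, (s.nodes z).alive = true → z = i := by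
      intro z hz
      by_contra hne
      have := hcon.dead i z (hcon.others_dead alive waiting hne)
      rw [hz] at this
      cases this
    refine ⟨L, hL.noBasic ?_ hcon', ?_⟩
    · refine NoBasicAt.noBasic (w := i) ?_ (setNode_self s i _)
        (fun z hz => setNode_of_ne s _ hz) rfl
      exact ⟨rfl, id, id, subset_union_left, Or.inl rfl, fun _ => le_rfl,
        fun _ h1 => absurd rfl h1, fun h => by cases h⟩
    · intro b t' hv'
      exfalso
      revert hv'
      refine hcon.not_valid_of_stopSpec (y := { s.nodes i with
        crashed := (s.nodes i).crashed ∪ (s.nodes i).report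
        report := ∅
        phase := .announced }) (setNode_self s i _) (fun z hz => setNode_of_ne s _ hz) rfl
        ⟨rfl, rfl, rfl, subset_union_left, ?_, Or.inr rfl, Or.inl rfl⟩ (Or.inr others) b t'
      intro z; simp

lemma Inv.init [NeZero N] {s : State N} (h : IsInit s) : Inv s := by
  refine ⟨ControlInv.init h, ⟨0, 0, 0⟩, ?_, ?_⟩
  · obtain ⟨⟨act, hn⟩, hm, ht⟩ := h
    refine ⟨?_, ?_, ?_, ?_, ?_, ?_, ?_, ?_, ?_, ?_, ?_, ?_⟩
    · intro k y c _
      rw [hn]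
      simp [initNode, Log.countAt, Log.sentBefore, Log.receivedBefore]
    · simp [hm]
    · intro m hm; simp at hm
    · intro m hm; simp at hm
    · intro m hm; simp at hm
    · intro m hm; simp at hm
    · intro m hm; simp at hm
    · intro m hm; simp at hm
    · intro m hm; simp at hm
    · intro m hm; simp at hm
    · intro k hk
      rw [hn, initNode] at hk
      dsimp only at hk
      split_ifs at hk
    · intro U c hU _
      refine ⟨fun k hk => ?_, fun m hm => by simp at hm⟩
      have := hU k hk
      rw [hn, initNode] at this
      dsimp only at this
      omega
  · intro b t hv
    -- The initial token is black up to the last node, the furthest one from node `0`.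
    apply TokenLog.of_window_empty
    obtain ⟨⟨act, hn⟩, hm, ht⟩ := h
    rintro z ⟨-, hlt⟩
    rcases hv.2.2 with h1 | h1
    · rw [ht] at h1; simp at h1
    · rw [hn, initNode] at h1
      dsimp only at h1
      split_ifs at h1 with h0
      cases h1
      have hz := z.isLt
      rw [h0] at hlt
      unfold cdist at hlt
      simp only [Fin.val_zero, lastNode_val, Nat.zero_le, if_true] at hlt
      omega

lemma announce_step [NeZero N] {s s' : State N} (h : Inv s) (st : Step s s')
    (hno : ∀ i, ¬ Announced s i) : (∀ i, ¬ Announced s' i) ∨ Terminated s' := by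
  have hcon := h.control
  obtain ⟨L, hL, hT⟩ := h.log
  have quiet : ∀ {s'}, Quiet s s' → (∀ i, ¬ Announced s' i) ∨ Terminated s' :=
    fun q => Or.inl fun i hi => hno i ((q.announced i).mp hi)
  have node : ∀ {s'} {w : Fin N} {y : NodeState N}, s'.nodes w = y →
      (∀ z ≠ w, s'.nodes z = s.nodes z) → y.phase ≠ .announced →
      (∀ i, ¬ Announced s' i) ∨ Terminated s' := by
    intro s' w y sw so hy
    left
    intro i hi
    unfold Announced at hi
    by_cases hiw : i = w
    · rw [hiw, sw] at hi; exact hy hi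
    · rw [so i hiw] at hi; exact hno i hi
  cases st with
  | becomePassive i alive active =>
    exact quiet (quiet_setNode s i { s.nodes i with active := false } id rfl rfl rfl rfl rfl rfl
      s.msgs)
  | sendBasic i j ne alive active known =>
    exact quiet (quiet_setNode s i { s.nodes i with
      count := Function.update (s.nodes i).count j ((s.nodes i).count j + 1) } id rfl rfl rfl rfl
      rfl rfl _)
  | receiveBasic m rest inTransit alive => exact quiet (quiet_receiveBasic s m rest)
  | crash i alive =>
    exact quiet (quiet_setNode s i { s.nodes i with alive := false } (fun _ => alive) rfl rfl rfl
      rfl rfl rfl s.msgs)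
  | detect i j alive crashed running =>
    by_cases hn : j ∈ (s.nodes i).crashed ∪ (s.nodes i).report
    · rw [detectCrash_of_mem hn, setNodeSend_none]; exact Or.inl hno
    · refine node (setNodeSend_self s i _) (fun z hz => setNodeSend_of_ne s _ hz) ?_
      rcases (hcon.detectSpec alive crashed running hn).phase with h1 | h1
      · rw [h1.2]; simp
      · rw [h1]; exact running
  | receiveToken i t rest inTransit alive idle =>
    exact quiet (quiet_receiveToken s i t rest inTransit idle)
  | processToken i t alive passive waiting =>
    rcases hcon.processSpec alive waiting with a | a | a
    · exact Or.inr (terminated_of_announce hL hcon alive waiting passive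
        (hT i t (hcon.valid_of_held alive waiting)) hno a)
    · exact node (setNodeSend_self s i _) (fun z hz => setNodeSend_of_ne s _ hz)
        (by rw [a.phase]; simp)
    · exact node (setNodeSend_self s i _) (fun z hz => setNodeSend_of_ne s _ hz)
        (by rw [a.phase]; simp)
  | announceAlone i alive passive waiting =>
    exact Or.inr (terminated_of_announceAlone hL hcon alive waiting passive (setNode_self s i _)
      rfl rfl (fun z hz => setNode_of_ne s _ hz) rfl)

lemma IsRun.inv [NeZero N] {σ : ℕ → State N} (run : IsRun σ) (n : ℕ) : Inv (σ n) := by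
  induction n with
  | zero => exact Inv.init run.1
  | succ n ih =>
    rcases run.2 n with h | h
    · rw [h]; exact ih
    · exact ih.step h

/-- In the form of a disjunction the claim is inductive: a step from a state without announcements
is handled by `announce_step`, and afterwards termination persists. -/
theorem IsRun.safety [NeZero N] {σ : ℕ → State N} (run : IsRun σ) (n : ℕ) :
    (∀ i, ¬ Announced (σ n) i) ∨ Terminated (σ n) := by
  induction n with
  | zero =>
    left
    intro i hi
    obtain ⟨⟨act, hn⟩, -, -⟩ := run.1
    unfold Announced at hi
    rw [hn, initNode] at hi
    dsimp only at hi
    split_ifs at hi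
  | succ n ih =>
    rcases run.2 n with h | h
    · rw [h]; exact ih
    · rcases ih with h1 | h1
      · exact announce_step (run.inv n) h h1
      · exact Or.inr (h1.step (run.inv n).control h)

/-! ### Liveness: the token does not get lost. -/

/-- The invariant that the token does not get lost. -/
structure LiveInv (s : State N) : Prop where
  token : ∀ p b, (s.nodes p).Running → (s.nodes b).Running → b = (s.nodes p).next → Due s p b →
    ∃ t, Valid s b t
  -- A node that becomes its own successor by crashes waits alone and is not running.
  self : ∀ p, (s.nodes p).Running → (s.nodes p).next = p → N = 1
  single : N = 1 → ∀ p, (s.nodes p).phase ≠ .idle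

/-- A step that does not involve the control algorithm, except that a token may be accepted, or
ignored by a node with another sequence number. -/
structure Calm (s s' : State N) : Prop extends Quiet s s' where
  keep : ∀ z t, (s.nodes z).phase = .waitToken t → (s'.nodes z).phase = .waitToken t
  keep_token : ∀ b t, (b, t) ∈ s.tokens → (b, t) ∈ s'.tokens ∨
    (s'.nodes b).phase = .waitToken t ∨ t.seq ≠ (s.nodes b).seq + 1

lemma Calm.refl (s : State N) : Calm s s where
  alive _ := id
  seq _ := rfl
  next _ := rfl
  crashed _ := rfl
  report _ := rfl
  stored _ := rfl
  alone _ := Iff.rfl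
  announced _ := Iff.rfl
  held _ _ := Or.inr
  tokens _ _ := id
  tokenAt _ _ := id
  keep _ _ := id
  keep_token _ _ := Or.inl

lemma Calm.valid_keep {s s' : State N} (q : Calm s s') {b : Fin N} {t : Token N}
    (hv : Valid s b t) (hb : (s'.nodes b).Running) : Valid s' b t := by
  refine ⟨hb, by rw [q.seq]; exact hv.2.1, ?_⟩
  rcases hv.2.2 with h1 | h1
  · rcases q.keep_token b t h1 with h2 | h2 | h2
    · exact Or.inl h2
    · exact Or.inr h2
    · exact absurd hv.2.1 h2
  · exact Or.inr (q.keep b t h1)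

lemma calm_setNode (s : State N) (i : Fin N) (y : NodeState N)
    (halive : y.alive = true → (s.nodes i).alive = true)
    (hseq : y.seq = (s.nodes i).seq) (hnext : y.next = (s.nodes i).next)
    (hcr : y.crashed = (s.nodes i).crashed) (hre : y.report = (s.nodes i).report)
    (hst : y.stored = (s.nodes i).stored) (hph : y.phase = (s.nodes i).phase)
    (msgs : Multiset (BasicMsg N)) :
    Calm s { s.setNode i y with msgs := msgs } where
  toQuiet := quiet_setNode s i y halive hseq hnext hcr hre hst hph msgs
  keep z t hz := by
    by_cases hzi : z = i
    · subst hzi; rw [← hz, ← hph]; simp [State.setNode]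
    · rw [← hz]; simp [State.setNode, hzi]
  keep_token _ _ h := Or.inl h

lemma calm_receiveBasic (s : State N) (m : BasicMsg N) (rest : Multiset (BasicMsg N)) :
    Calm s { s.setNode m.receiver
            (FTSafra.receiveBasic m.receiver m.sender m.seq (s.nodes m.receiver)) with
          msgs := rest } := by
  obtain ⟨h1, h2, h3, h4, h5, h6, h7⟩ :=
    receiveBasic_fields m.receiver m.sender m.seq (s.nodes m.receiver)
  exact calm_setNode s _ _ (by rw [h1]; exact id) h2 h3 h4 h5 h6 h7 rest

lemma calm_receiveToken (s : State N) (i : Fin N) (t : Token N)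
    (rest : Multiset (Fin N × Token N)) (hin : s.tokens = (i, t) ::ₘ rest)
    (idle : (s.nodes i).phase = .idle) :
    Calm s { s.setNode i (acceptToken t (s.nodes i)) with tokens := rest } where
  toQuiet := quiet_receiveToken s i t rest hin idle
  keep z t' hz := by
    by_cases hzi : z = i
    · subst hzi; rw [idle] at hz; cases hz
    · rw [← hz]; simp [State.setNode, hzi]
  keep_token b t' hb := by
    rw [hin, Multiset.mem_cons] at hb
    rcases hb with h1 | h1
    · cases h1
      by_cases hs : t.seq = (s.nodes i).seq + 1
      · right; left
        simp [State.setNode, acceptToken, hs]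
      · exact Or.inr (Or.inr hs)
    · exact Or.inl h1

/-- The ways in which a step affects the control algorithm. -/
lemma ControlInv.step_cases [NeZero N] {s s' : State N} (h : ControlInv s) (st : Step s s') :
    (Calm s s' ∧ (Terminated s → ∀ i, (s'.nodes i).count = (s.nodes i).count ∧
      (s'.nodes i).black = (s.nodes i).black)) ∨
    (∃ w j, (s.nodes w).alive = true ∧ (s.nodes j).alive = false ∧
      (s.nodes w).phase ≠ .announced ∧ j ∉ (s.nodes w).crashed ∪ (s.nodes w).report ∧
      s' = s.setNodeSend w (detectCrash w j (s.nodes w))) ∨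
    (∃ w y, (s.nodes w).alive = true ∧ s'.nodes w = y ∧ (∀ z ≠ w, s'.nodes z = s.nodes z) ∧
      s'.tokens = s.tokens ∧ StopSpec w (s.nodes w) y ∧ (s.nodes w).phase ≠ .announced) ∨
    ∃ w t, (s.nodes w).alive = true ∧ (s.nodes w).active = false ∧
      (s.nodes w).phase = .waitToken t ∧
      ForwardSpec w t (s.nodes w) (processToken w t (s.nodes w)) ∧
      s' = s.setNodeSend w (processToken w t (s.nodes w)) := by
  have same : ∀ {s' : State N} {w : Fin N} {y : NodeState N}, s'.nodes w = y →
      (∀ z ≠ w, s'.nodes z = s.nodes z) → y.count = (s.nodes w).count →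
      y.black = (s.nodes w).black → ∀ i, (s'.nodes i).count = (s.nodes i).count ∧
      (s'.nodes i).black = (s.nodes i).black := by
    intro s' w y sw so h1 h2 i
    by_cases hi : i = w
    · rw [hi, sw]; exact ⟨h1, h2⟩
    · rw [so i hi]; exact ⟨rfl, rfl⟩
  cases st with
  | becomePassive i alive active =>
    exact Or.inl ⟨calm_setNode s i { s.nodes i with active := false } id rfl rfl rfl rfl rfl rfl
      s.msgs, fun _ => same (setNode_self s i _) (fun z hz => setNode_of_ne s _ hz) rfl rfl⟩
  | sendBasic i j ne alive active known =>
    refine Or.inl ⟨calm_setNode s i { s.nodes i with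
      count := Function.update (s.nodes i).count j ((s.nodes i).count j + 1) } id rfl rfl rfl rfl
      rfl rfl _, fun ht => ?_⟩
    have := ht.1 i alive
    rw [active] at this
    cases this
  | receiveBasic m rest inTransit alive =>
    refine Or.inl ⟨calm_receiveBasic s m rest, fun ht => ?_⟩
    have hk : m.sender ∈ (s.nodes m.receiver).crashed := by
      rcases ht.2 m (by rw [inTransit]; exact Multiset.mem_cons_self _ _) with h1 | h1
      · rw [alive] at h1; cases h1
      · exact h1
    refine same (setNode_self s m.receiver _) (fun z hz => setNode_of_ne s _ hz) ?_ ?_ <;>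
      (unfold FTSafra.receiveBasic; rw [if_pos hk])
  | crash i alive =>
    exact Or.inl ⟨calm_setNode s i { s.nodes i with alive := false } (fun _ => alive) rfl rfl rfl
      rfl rfl rfl s.msgs,
      fun _ => same (setNode_self s i _) (fun z hz => setNode_of_ne s _ hz) rfl rfl⟩
  | detect i j alive crashed running =>
    by_cases hn : j ∈ (s.nodes i).crashed ∪ (s.nodes i).report
    · rw [detectCrash_of_mem hn, setNodeSend_none]
      exact Or.inl ⟨Calm.refl s, fun _ _ => ⟨rfl, rfl⟩⟩
    · exact Or.inr (Or.inl ⟨i, j, alive, crashed, running, hn, rfl⟩)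
  | receiveToken i t rest inTransit alive idle =>
    refine Or.inl ⟨calm_receiveToken s i t rest inTransit idle, fun _ => ?_⟩
    refine same (setNode_self s i _) (fun z hz => setNode_of_ne s _ hz) ?_ ?_ <;>
      (unfold acceptToken; split_ifs <;> rfl)
  | processToken i t alive passive waiting =>
    rcases h.processSpec alive waiting with a | a | a
    · exact Or.inr (Or.inr (Or.inl ⟨i, _, alive, setNodeSend_self s i _,
        fun z hz => setNodeSend_of_ne s _ hz, by simp [State.setNodeSend, State.setNode, a.send],
        a.stopSpec, by rw [waiting]; simp⟩))
    · exact Or.inr (Or.inr (Or.inl ⟨i, _, alive, setNodeSend_self s i _,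
        fun z hz => setNodeSend_of_ne s _ hz, by simp [State.setNodeSend, State.setNode, a.send],
        a.stopSpec, by rw [waiting]; simp⟩))
    · exact Or.inr (Or.inr (Or.inr ⟨i, t, alive, passive, waiting, a, rfl⟩))
  | announceAlone i alive passive waiting =>
    refine Or.inr (Or.inr (Or.inl ⟨i, _, alive, setNode_self s i _,
      fun z hz => setNode_of_ne s _ hz, rfl,
      ⟨rfl, rfl, rfl, subset_union_left, ?_, Or.inr rfl, Or.inl rfl⟩, by rw [waiting]; simp⟩))
    intro z; simp

lemma ControlInv.known_mono [NeZero N] {s s' : State N} (h : ControlInv s) (st : Step s s')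
    (i : Fin N) : (s.nodes i).crashed ∪ (s.nodes i).report ⊆
      (s'.nodes i).crashed ∪ (s'.nodes i).report := by
  rcases h.step_cases st with ⟨q, -⟩ | ⟨w, j, h1, h2, h3, h4, rfl⟩ | ⟨w, y, h1, h2, h3, h4, h5, h6⟩ |
    ⟨w, t, h1, h2, h3, a, rfl⟩
  · rw [q.crashed, q.report]
  · by_cases hi : i = w
    · subst hi
      have a := h.detectSpec h1 h2 h3 h4
      rw [setNodeSend_self, a.crashed, a.report]
      intro z; simp only [mem_union, mem_insert]; tauto
    · rw [setNodeSend_of_ne _ _ hi]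
  · by_cases hi : i = w
    · subst hi; rw [h2]; exact h5.known
    · rw [h3 i hi]
  · by_cases hi : i = w
    · subst hi
      rw [setNodeSend_self, a.crashed, a.report]
      intro z; simp only [mem_union]; tauto
    · rw [setNodeSend_of_ne _ _ hi]

lemma ControlInv.alive_anti [NeZero N] {s s' : State N} (h : ControlInv s) (st : Step s s')
    {i : Fin N} (hi : (s'.nodes i).alive = true) : (s.nodes i).alive = true := by
  rcases h.step_cases st with ⟨q, -⟩ | ⟨w, j, h1, h2, h3, h4, rfl⟩ | ⟨w, y, h1, h2, h3, h4, h5, h6⟩ |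
    ⟨w, t, h1, h2, h3, a, rfl⟩
  · exact q.alive i hi
  all_goals
    by_cases hiw : i = w
    · rw [hiw]; exact h1
    · first
        | rw [setNodeSend_of_ne _ _ hiw] at hi; exact hi
        | rw [h3 i hiw] at hi; exact hi

lemma ControlInv.announced_mono [NeZero N] {s s' : State N} (h : ControlInv s) (st : Step s s')
    {i : Fin N} (hi : Announced s i) : Announced s' i := by
  unfold Announced at *
  rcases h.step_cases st with ⟨q, -⟩ | ⟨w, j, h1, h2, h3, h4, rfl⟩ | ⟨w, y, h1, h2, h3, h4, h5, h6⟩ |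
    ⟨w, t, h1, h2, h3, a, rfl⟩
  · exact (q.announced i).mpr hi
  · have hiw : i ≠ w := by rintro rfl; exact h3 hi
    rw [setNodeSend_of_ne _ _ hiw]; exact hi
  · by_cases hiw : i = w
    · subst hiw
      exact absurd hi h6
    · rw [h3 i hiw]; exact hi
  · have hiw : i ≠ w := by rintro rfl; rw [h3] at hi; cases hi
    rw [setNodeSend_of_ne _ _ hiw]; exact hi

lemma LogInv.no_self {s : State N} {L : Log N} (hL : LogInv s L) (k : Fin N) :
    (s.nodes k).count k = 0 := by
  rw [hL.count k k ((s.nodes k).seq + 1) (Nat.lt_succ_self _)]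
  have h1 : L.sentBefore k k ((s.nodes k).seq + 1) = 0 := by
    rw [Log.sentBefore, Multiset.countP_eq_zero]
    rintro m hm ⟨h2, h3, -⟩
    exact hL.sent_ne m hm (h3.trans h2.symm)
  have h2 : L.receivedBefore k k ((s.nodes k).seq + 1) = 0 := by
    rw [Log.receivedBefore, Multiset.countP_eq_zero]
    rintro e he ⟨h2, h3, -⟩
    exact hL.sent_ne _ (hL.received_sent he) (h2.trans h3.symm)
  simp [Log.countAt, h1, h2]

/-- A single node is always white and sends no messages, so it announces when it processes its
token. This excludes the stale token that it would otherwise send to itself. -/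
lemma not_forward_single {s : State N} (h : Inv s) (hN : N = 1) {w : Fin N} {t : Token N}
    {r : NodeState N × Option (Fin N × Token N)} (hw : (s.nodes w).alive = true)
    (hp : (s.nodes w).phase = .waitToken t)
    (a : ForwardSpec w t (s.nodes w) r) : False := by
  obtain ⟨L, hL, -⟩ := h.log
  subst hN
  have h0 : ∀ z : Fin 1, z = w := fun z => Subsingleton.elim _ _
  refine a.not_announce (h0 _) (h0 _) ?_
  unfold countOutside
  refine sum_eq_zero fun z _ => ?_
  rw [h0 z, Function.update_self]
  refine sum_eq_zero fun y _ => ?_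
  rw [h0 y]
  exact hL.no_self w

/-- A running successor becomes due when a token is forwarded to it, or when it replaces a crashed
successor, in which case the backup is sent. Conversely, a valid token at `b` is used up only if `b`
forwards it, whereupon `b` is no longer due, or if `b` stops running. -/
lemma LiveInv.step [NeZero N] {s s' : State N} (h : Inv s) (l : LiveInv s) (st : Step s s') :
    LiveInv s' := by
  have hcon := h.control
  rcases hcon.step_cases st with ⟨q, -⟩ | ⟨w, j, h1, h2, h3, h4, hs'⟩ | ⟨w, y, h1, h2, h3, h4, h5, -⟩ |
    ⟨w, t, h1, h2, h3, a, hs'⟩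
  · refine ⟨?_, ?_, ?_⟩
    · intro p b hp hb hn hd
      rw [q.next] at hn
      obtain ⟨t, ht⟩ := l.token p b (q.running hp) (q.running hb) hn
        (by simpa only [Due, q.seq] using hd)
      exact ⟨t, q.valid_keep ht hb⟩
    · intro p hp hn
      rw [q.next] at hn
      exact l.self p (q.running hp) hn
    · intro hN p hp
      cases hph : (s.nodes p).phase with
      | idle => exact l.single hN p hph
      | waitToken t => have := q.keep p t hph; rw [hp] at this; cases this
      | waitAlone => have := (q.alone p).mpr hph; rw [hp] at this; cases this
      | announced => have := (q.announced p).mpr hph; rw [hp] at this; cases this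
  · have a := hcon.detectSpec h1 h2 h3 h4
    set r := detectCrash w j (s.nodes w) with hr
    have sw : s'.nodes w = r.1 := by rw [hs']; exact setNodeSend_self s w r
    have so : ∀ z ≠ w, s'.nodes z = s.nodes z := by
      intro z hz; rw [hs']; exact setNodeSend_of_ne s r hz
    have mem : ∀ b t, (b, t) ∈ s'.tokens ↔ (b, t) ∈ s.tokens ∨ r.2 = some (b, t) := by
      intro b t; rw [hs']; exact mem_setNodeSend s r
    have sq : ∀ z, (s'.nodes z).seq = (s.nodes z).seq := by
      intro z; by_cases hz : z = w
      · rw [hz, sw, a.seq]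
      · rw [so z hz]
    have hwr : (s.nodes w).Running := by
      rw [running_iff]; exact ⟨h1, hcon.detect_ne_alone h1 h2 h4, h3⟩
    have run : ∀ z, (s'.nodes z).Running → (s.nodes z).Running := by
      intro z; by_cases hz : z = w
      · rw [hz]; exact fun _ => hwr
      · rw [so z hz]; exact id
    have ph : ∀ z, (s'.nodes z).Running → (s'.nodes z).phase = (s.nodes z).phase := by
      intro z hz; by_cases hzw : z = w
      · subst hzw
        rw [running_iff, sw] at hz
        rw [sw]
        rcases a.phase with h6 | h6
        · exact absurd h6.2 hz.2.1
        · exact h6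
      · rw [so z hzw]
    have keep : ∀ b t, (s'.nodes b).Running → Valid s b t → Valid s' b t := by
      intro b t hb hv
      refine ⟨hb, by rw [sq]; exact hv.2.1, ?_⟩
      rcases hv.2.2 with h6 | h6
      · exact Or.inl ((mem b t).mpr (Or.inl h6))
      · exact Or.inr ((ph b hb).trans h6)
    refine ⟨?_, ?_, ?_⟩
    · intro p b hp hb hn hd
      have hd' : Due s p b := by simpa only [Due, sq] using hd
      by_cases hpw : p = w
      · subst hpw
        rw [sw] at hn
        rw [running_iff, sw] at hp
        rcases a.send with ⟨-, -, h6⟩ | ⟨h6, hne, hcr, hbl, hs, hfur, hseq⟩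
        · rcases h6 with h6 | h6 | ⟨h6, h7⟩
          · exact absurd h6.2 hp.2.1
          · obtain ⟨t, ht⟩ := l.token p b hwr (run b hb) (hn.trans h6) hd'
            exact ⟨t, keep b t hb ht⟩
          -- No backup was sent because `p` has number `0`; a successor above `p` would need a
          -- negative number to be due.
          · rw [← hn] at h7
            have h8 := hd'.2.2 (lt_of_le_of_ne (not_lt.mp h7) (Ne.symm hd.1))
            omega
        · refine ⟨r.1.stored, hb, ?_, Or.inl ((mem _ _).mpr (Or.inr (by rw [h6, hn])))⟩
          rw [sq]
          rcases hcon.backup_due h1 hne hfur hs hseq with ⟨h7, h8⟩ | ⟨h7, h8⟩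
          · rw [← hn] at h7
            have := hd'.2.1 h7; omega
          · rw [← hn] at h7
            have := hd'.2.2 h7; omega
      · rw [so p hpw] at hp hn
        obtain ⟨t, ht⟩ := l.token p b hp (run b hb) hn hd'
        exact ⟨t, keep b t hb ht⟩
    · intro p hp hn
      by_cases hpw : p = w
      · subst hpw
        rw [sw] at hn
        rw [running_iff, sw] at hp
        rcases a.self hn with h6 | h6
        · exact absurd h6 hp.2.1
        · exact l.self p hwr h6
      · rw [so p hpw] at hp hn; exact l.self p hp hn
    · intro hN p hp
      by_cases hpw : p = w
      · subst hpw
        rw [sw] at hp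
        rcases a.phase with h6 | h6
        · rw [hp] at h6; cases h6.2
        · rw [h6] at hp; exact l.single hN p hp
      · rw [so p hpw] at hp; exact l.single hN p hp
  · have nr : ¬ (s'.nodes w).Running := by
      rw [running_iff, h2]
      rcases h5.phase with h6 | h6
      · simp [h6]
      · simp [h6.1]
    have ne : ∀ p, (s'.nodes p).Running → p ≠ w := by rintro p hp rfl; exact nr hp
    refine ⟨?_, ?_, ?_⟩
    · intro p b hp hb hn hd
      have hpw := ne p hp
      have hbw := ne b hb
      have hb' := hb
      rw [h3 p hpw] at hp hn
      rw [h3 b hbw] at hb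
      obtain ⟨t, -, hsq, hat⟩ := l.token p b hp hb hn
        (by simpa only [Due, h3 p hpw, h3 b hbw] using hd)
      refine ⟨t, hb', by rw [h3 b hbw]; exact hsq, ?_⟩
      unfold TokenAt
      rw [h4, h3 b hbw]
      exact hat
    · intro p hp hn
      have hpw := ne p hp
      rw [h3 p hpw] at hp hn
      exact l.self p hp hn
    · intro hN p hp
      by_cases hpw : p = w
      · rw [hpw, h2] at hp
        rcases h5.phase with h6 | h6
        · rw [hp] at h6; cases h6
        · rw [hp] at h6; cases h6.1
      · rw [h3 p hpw] at hp; exact l.single hN p hp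
  · have hv := hcon.valid_of_held h1 h3
    set r := processToken w t (s.nodes w) with hr
    have sw : s'.nodes w = r.1 := by rw [hs']; exact setNodeSend_self s w r
    have so : ∀ z ≠ w, s'.nodes z = s.nodes z := by
      intro z hz; rw [hs']; exact setNodeSend_of_ne s r hz
    have mem : ∀ b t, (b, t) ∈ s'.tokens ↔ (b, t) ∈ s.tokens ∨ r.2 = some (b, t) := by
      intro b t; rw [hs']; exact mem_setNodeSend s r
    refine ⟨?_, ?_, fun hN => (not_forward_single h hN h1 h3 a).elim⟩
    · intro p b hp hb hn hd
      by_cases hpw : p = w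
      · subst hpw
        rw [sw] at hn
        refine ⟨r.1.stored, hb, ?_, Or.inl ((mem _ _).mpr (Or.inr (by rw [a.send, hn])))⟩
        obtain ⟨hne, hd1, hd2⟩ := hd
        rw [sw, a.seq] at hd1 hd2
        rw [a.tokenSeq, hv.2.1, ← hn]
        rcases lt_or_gt_of_ne hne with hlt | hlt
        · have := hd1 hlt
          rw [if_pos hlt]; omega
        · have := hd2 hlt
          rw [if_neg (lt_asymm hlt)]; omega
      · rw [so p hpw] at hp hn
        by_cases hbw : b = w
        · exfalso
          obtain ⟨hne, hd1, hd2⟩ := hd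
          rw [hbw, sw, a.seq, so p hpw] at hd1 hd2
          rcases lt_or_gt_of_ne hpw with hlt | hlt
          · have := h.control.seq_of_lt hv hp.1 hlt; have := hd2 hlt; omega
          · have := h.control.seq_of_gt hv hp.1 hlt; have := hd1 hlt; omega
        · have hb' := hb
          rw [so b hbw] at hb
          obtain ⟨t', -, hsq, hat⟩ := l.token p b hp hb hn
            (by simpa only [Due, so p hpw, so b hbw] using hd)
          refine ⟨t', hb', by rw [so b hbw]; exact hsq, ?_⟩
          rcases hat with h6 | h6
          · exact Or.inl ((mem _ _).mpr (Or.inl h6))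
          · right; rw [so b hbw]; exact h6
    · intro p hp hn
      by_cases hpw : p = w
      · subst hpw
        rw [sw] at hn
        exact l.self p hv.1 (a.self hn)
      · rw [so p hpw] at hp hn; exact l.self p hp hn

lemma LiveInv.init [NeZero N] {s : State N} (h : IsInit s) : LiveInv s := by
  obtain ⟨⟨act, hn⟩, hm, ht⟩ := h
  have sq : ∀ z, (s.nodes z).seq = 0 := fun z => by rw [hn]; rfl
  have nx : ∀ z, (s.nodes z).next = z + 1 := fun z => by rw [hn]; rfl
  have hval : ∀ p : Fin N, (p + 1).val = if p.val + 1 = N then 0 else p.val + 1 := by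
    intro p
    have hp := p.isLt
    rw [Fin.val_add, Fin.val_one', Nat.add_mod_mod]
    split_ifs with h1
    · rw [h1]; simp
    · exact Nat.mod_eq_of_lt (by omega)
  refine ⟨?_, ?_, ?_⟩
  · intro p b _ hb hbn ⟨hne, hd1, hd2⟩
    rw [sq, sq] at hd2
    -- With all numbers `0`, the only successor that is due is node `0`, after the last node, and it
    -- holds the token.
    have hlt : b < p := by
      rcases lt_or_gt_of_ne hne with hlt | hlt
      · exact hlt
      · have := hd2 hlt; omega
    rw [nx] at hbn
    have h0 : b = 0 := by
      apply Fin.ext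
      have := hval p
      rw [← hbn] at this
      simp only [Fin.lt_def] at hlt
      rw [Fin.val_zero]
      split_ifs at this
      · exact this
      · omega
    refine ⟨⟨0, lastNode N, 1, ∅⟩, hb, by rw [sq], Or.inr ?_⟩
    rw [hn, h0]
    simp [initNode]
  · intro p _ hp
    rw [nx] at hp
    have := hval p
    rw [hp] at this
    split_ifs at this <;> omega
  · intro hN p hp
    subst hN
    have : p = 0 := Subsingleton.elim _ _
    rw [hn, this] at hp
    simp [initNode] at hp

/-! ### Liveness: the token in a settled run. -/

/-- If the basic algorithm has terminated, the counts of alive nodes for each other add up to 0. -/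
lemma Inv.total_count {s : State N} (h : Inv s) (ht : Terminated s) {G : Finset (Fin N)}
    (hG : ∀ z ∈ G, (s.nodes z).alive = true) :
    ∑ z ∈ G, ∑ y ∈ G, (s.nodes z).count y = 0 := by
  obtain ⟨L, hL, -⟩ := h.log
  have hc : ∀ z y, (s.nodes z).count y = L.countAt z y ((s.nodes z).seq + 1) :=
    fun z y => hL.count z y _ (Nat.lt_succ_self _)
  have key : ∀ z ∈ G, ∀ y ∈ G, L.sentBefore z y ((s.nodes z).seq + 1) =
      L.receivedBefore y z ((s.nodes y).seq + 1) := by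
    intro z hz y hy
    have hzc : z ∉ (s.nodes y).crashed := h.control.notMem_crashed (hG z hz)
    have h1 : s.msgs.countP (fun m => m.sender = z ∧ m.receiver = y ∧
        m.seq < (s.nodes z).seq + 1) = 0 := by
      rw [Multiset.countP_eq_zero]
      rintro m hm ⟨rfl, rfl, -⟩
      rcases ht.2 m hm with h2 | h2
      · rw [hG _ hy] at h2; cases h2
      · exact hzc h2
    have h2 : L.ignored.countP (fun m => m.sender = z ∧ m.receiver = y ∧
        m.seq < (s.nodes z).seq + 1) = 0 := by
      rw [Multiset.countP_eq_zero]
      rintro m hm ⟨rfl, rfl, -⟩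
      exact hzc (hL.ignored m hm)
    rw [Log.sentBefore, hL.split, Multiset.countP_add, Multiset.countP_add, h1, h2,
      Multiset.countP_map, ← Multiset.countP_eq_card_filter, zero_add, add_zero,
      Log.receivedBefore]
    apply Multiset.countP_congr rfl
    intro e he
    apply propext
    have h3 := hL.sent_seq _ (hL.received_sent he)
    have h4 := hL.received_seq e he
    constructor
    · rintro ⟨rfl, rfl, -⟩; exact ⟨rfl, rfl, by omega⟩
    · rintro ⟨rfl, rfl, -⟩; exact ⟨rfl, rfl, by omega⟩
  simp only [hc, Log.countAt, sum_sub_distrib]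
  rw [sub_eq_zero, sum_comm (s := G) (t := G) (f := fun z y =>
    ((L.receivedBefore z y ((s.nodes z).seq + 1) : ℕ) : ℤ))]
  exact sum_congr rfl fun z hz => sum_congr rfl fun y hy => by rw [key z hz y hy]

/-- From time `n` on, exactly the nodes in `G` are alive, they know all crashes, the basic
algorithm has terminated, and it is not announced. -/
structure Settled [NeZero N] (σ : ℕ → State N) (G : Finset (Fin N)) (n : ℕ) : Prop where
  run : IsRun σ
  fair : Fair σ
  correct : ∀ i ∈ G, Correct σ i
  alive : ∀ m ≥ n, ∀ i, ((σ m).nodes i).alive = true → i ∈ G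
  known : ∀ m ≥ n, ∀ i ∈ G, ∀ z ∉ G, z ∈ ((σ m).nodes i).crashed ∪ ((σ m).nodes i).report
  terminated : ∀ m ≥ n, Terminated (σ m)
  silent : ∀ m ≥ n, ∀ i ∈ G, ¬ Announced (σ m) i

lemma IsRun.liveInv [NeZero N] {σ : ℕ → State N} (run : IsRun σ) (n : ℕ) : LiveInv (σ n) := by
  induction n with
  | zero => exact LiveInv.init run.1
  | succ n ih =>
    rcases run.2 n with h | h
    · rw [h]; exact ih
    · exact ih.step (run.inv n) h

/-- Node `w` processes and forwards the token `t` in the step after time `m`. -/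
structure Forwards [NeZero N] (σ : ℕ → State N) (m : ℕ) (w : Fin N) (t : Token N) : Prop where
  phase : ((σ m).nodes w).phase = .waitToken t
  spec : ForwardSpec w t ((σ m).nodes w) (processToken w t ((σ m).nodes w))
  eq : σ (m + 1) = (σ m).setNodeSend w (processToken w t ((σ m).nodes w))

lemma cdist_sub {w b x : Fin N} (h : cdist w b ≤ cdist w x) :
    cdist b x = cdist w x - cdist w b := by
  have hw := w.isLt; have hb := b.isLt; have hx := x.isLt
  unfold cdist at *
  split_ifs at * <;> omega

section Settled
variable [NeZero N] {σ : ℕ → State N} {G : Finset (Fin N)} {n : ℕ}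

lemma Settled.dead (h : Settled σ G n) {m : ℕ} {z : Fin N}
    (hz : ((σ m).nodes z).alive = false) : z ∉ G := by
  intro hzG
  rw [h.correct z hzG m] at hz
  cases hz

lemma Settled.mem_known (h : Settled σ G n) {m : ℕ} (hm : n ≤ m) {i z : Fin N} (hi : i ∈ G) :
    z ∈ ((σ m).nodes i).crashed ∪ ((σ m).nodes i).report ↔ z ∉ G :=
  ⟨fun hz => h.dead ((h.run.inv m).control.dead i z hz), h.known m hm i hi z⟩

lemma Settled.passive (h : Settled σ G n) {m : ℕ} (hm : n ≤ m) {i : Fin N} (hi : i ∈ G) :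
    ((σ m).nodes i).active = false :=
  (h.terminated m hm).1 i (h.correct i hi m)

/-- A node waiting alone is passive and could leave this phase only by announcing, so it would wait
forever, against `Fair.progress`. -/
lemma Settled.running (h : Settled σ G n) {m : ℕ} (hm : n ≤ m) {i : Fin N} (hi : i ∈ G) :
    ((σ m).nodes i).Running := by
  rw [running_iff]
  refine ⟨h.correct i hi m, ?_, h.silent m hm i hi⟩
  intro hal
  have forever : ∀ m' ≥ m, ((σ m').nodes i).phase = .waitAlone := by
    intro m' hm'
    induction m', hm' using Nat.le_induction with
    | base => exact hal
    | succ k hk ih =>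
      rcases h.run.2 k with h1 | h1
      · rw [h1]; exact ih
      have hnk : n ≤ k := hm.trans hk
      rcases (h.run.inv k).control.step_cases h1 with ⟨q, -⟩ | ⟨w, j, h1, h2, h3, h4, h5⟩ |
        ⟨w, y, h1, h2, h3, h4, h5, h6⟩ | ⟨w, t, h1, h2, h3, a, h4⟩
      · exact (q.alone i).mpr ih
      · exact absurd (h.known k hnk w (h.alive k hnk w h1) j (h.dead h2)) h4
      · by_cases hiw : i = w
        · subst hiw
          rw [h2]
          rcases h5.phase with h7 | h7
          · exact absurd (by unfold Announced; rw [h2]; exact h7)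
              (h.silent (k + 1) (by omega) i hi)
          · exact h7.1
        · rw [h3 i hiw]; exact ih
      · have hiw : i ≠ w := by rintro rfl; rw [ih] at h3; cases h3
        rw [h4, setNodeSend_of_ne _ _ hiw]; exact ih
  exact h.fair.progress i (h.correct i hi) ⟨m, fun m' hm' =>
    ⟨Or.inl (forever m' hm'), h.passive (hm.trans hm') hi⟩⟩

/-- Nothing is left to detect and no node stops, so the only steps that matter are those forwarding
a token. -/
lemma Settled.trans (h : Settled σ G n) {m : ℕ} (hm : n ≤ m) :
    (Calm (σ m) (σ (m + 1)) ∧ ∀ i, ((σ (m + 1)).nodes i).count = ((σ m).nodes i).count ∧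
      ((σ (m + 1)).nodes i).black = ((σ m).nodes i).black) ∨
    ∃ w ∈ G, ∃ t, Forwards σ m w t := by
  rcases h.run.2 m with h1 | h1
  · left; rw [h1]; exact ⟨Calm.refl _, fun _ => ⟨rfl, rfl⟩⟩
  rcases (h.run.inv m).control.step_cases h1 with ⟨q, hq⟩ | ⟨w, j, h1, h2, h3, h4, h5⟩ |
    ⟨w, y, h1, h2, h3, h4, h5, h6⟩ | ⟨w, t, h1, h2, h3, a, h4⟩
  · exact Or.inl ⟨q, hq (h.terminated m hm)⟩
  · exact absurd (h.known m hm w (h.alive m hm w h1) j (h.dead h2)) h4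
  · exfalso
    have := h.running (m := m + 1) (by omega) (h.alive m hm w h1)
    rw [running_iff, h2] at this
    rcases h5.phase with h7 | h7
    · exact this.2.2 h7
    · exact this.2.1 h7.1
  · exact Or.inr ⟨w, h.alive m hm w h1, t, h3, a, h4⟩

lemma Settled.next_mem (h : Settled σ G n) {m : ℕ} (hm : n ≤ m) {i : Fin N} (hi : i ∈ G) :
    ((σ m).nodes i).next ∈ G := by
  have := ((h.run.inv m).control.good i (h.correct i hi m) (h.silent m hm i hi)).notMem
  rw [h.mem_known hm hi, not_not] at this
  exact this

/-- The frontier is found at the node with the lexicographically greatest pair of number and index,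
encoded as `seq * N + index`. Its successor is due unless the ring has one node, which always holds
a token. -/
lemma Settled.exists_valid (h : Settled σ G n) (hne : G.Nonempty) {m : ℕ} (hm : n ≤ m) :
    ∃ b ∈ G, ∃ t, Valid (σ m) b t := by
  have hc := (h.run.inv m).control
  have hl := h.run.liveInv m
  obtain ⟨p, hp, hmax⟩ := G.exists_max_image (fun p => ((σ m).nodes p).seq * N + p.val) hne
  by_cases hN : N = 1
  · have h1 := h.running hm hp
    rcases h1.2 with h2 | ⟨t, h2⟩
    · exact absurd h2 (hl.single hN p)
    · exact ⟨p, hp, t, hc.valid_of_held h1.1 h2⟩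
  have hb := h.next_mem hm hp
  have hbp : ((σ m).nodes p).next ≠ p := fun he => hN (hl.self p (h.running hm hp) he)
  set b := ((σ m).nodes p).next with hbdef
  have hpN := p.isLt
  have hbN := b.isLt
  have hle : ((σ m).nodes b).seq ≤ ((σ m).nodes p).seq := by
    by_contra hlt
    have h1 := hmax b hb
    have h2 : (((σ m).nodes p).seq + 1) * N ≤ ((σ m).nodes b).seq * N :=
      Nat.mul_le_mul_right N (by omega)
    rw [Nat.add_mul] at h2
    omega
  have hdue : Due (σ m) p b := by
    refine ⟨hbp, ?_, ?_⟩
    · intro hlt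
      exact le_antisymm hle (hc.upper_lt b p (h.correct b hb m) hlt)
    · intro hlt
      have h1 := hmax b hb
      have h2 := hc.upper b p (h.correct b hb m)
      rw [Fin.lt_def] at hlt
      have h3 : ((σ m).nodes b).seq ≠ ((σ m).nodes p).seq := by
        intro he; rw [he] at h1; omega
      omega
  obtain ⟨t, ht⟩ := hl.token p b (h.running hm hp) (h.running hm hb) rfl hdue
  exact ⟨b, hb, t, ht⟩

/-- Otherwise a valid token would stay valid forever: either its node waits forever while passive,
against `Fair.progress`, or the token stays in transit to a node that is always idle, against
`Fair.delivery`. -/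
lemma Settled.exists_forwards (h : Settled σ G n) (hne : G.Nonempty) {m : ℕ} (hm : n ≤ m) :
    ∃ m' ≥ m, ∃ w ∈ G, ∃ t, Forwards σ m' w t := by
  by_contra hno
  push Not at hno
  have calm : ∀ m' ≥ m, Calm (σ m') (σ (m' + 1)) := by
    intro m' hm'
    rcases h.trans (hm.trans hm') with h1 | ⟨w, hw, t, ht⟩
    · exact h1.1
    · exact absurd ht (hno m' hm' w hw t)
  obtain ⟨b, hb, t, hv⟩ := h.exists_valid hne hm
  have valid : ∀ m' ≥ m, Valid (σ m') b t := by
    intro m' hm'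
    induction m', hm' using Nat.le_induction with
    | base => exact hv
    | succ k hk ih =>
      exact (calm k hk).valid_keep ih (h.running (by omega) hb)
  by_cases hw : ∃ m1 ≥ m, ∃ t1, ((σ m1).nodes b).phase = .waitToken t1
  · obtain ⟨m1, hm1, t1, ht1⟩ := hw
    have wait : ∀ m' ≥ m1, ((σ m').nodes b).phase = .waitToken t1 := by
      intro m' hm'
      induction m', hm' using Nat.le_induction with
      | base => exact ht1
      | succ k hk ih => exact (calm k (hm1.trans hk)).keep b t1 ih
    exact h.fair.progress b (h.correct b hb) ⟨m1, fun m' hm' =>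
      ⟨Or.inr ⟨t1, wait m' hm'⟩, h.passive (by omega) hb⟩⟩
  · push Not at hw
    have idle : ∀ m' ≥ m, ((σ m').nodes b).phase = .idle := by
      intro m' hm'
      rcases (h.running (hm.trans hm') hb).2 with h1 | ⟨t1, h1⟩
      · exact h1
      · exact absurd h1 (hw m' hm' t1)
    refine h.fair.delivery b (h.correct b hb) t ⟨⟨m, fun m' hm' => ?_⟩, fun k => ?_⟩
    · rcases (valid m' hm').2.2 with h1 | h1
      · exact h1
      · exact absurd h1 (hw m' hm' t)
    · exact ⟨max k m, le_max_left _ _, idle _ (le_max_right _ _)⟩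

lemma Settled.seq_step (h : Settled σ G n) {m : ℕ} (hm : n ≤ m) (i : Fin N) :
    (((σ (m + 1)).nodes i).seq = ((σ m).nodes i).seq ∧
      ((σ (m + 1)).nodes i).report = ((σ m).nodes i).report ∧
      ((σ (m + 1)).nodes i).black = ((σ m).nodes i).black) ∨
    (((σ (m + 1)).nodes i).seq = ((σ m).nodes i).seq + 1 ∧
      ((σ (m + 1)).nodes i).report = ∅ ∧ ((σ (m + 1)).nodes i).black = i) := by
  rcases h.trans hm with ⟨q, hq⟩ | ⟨w, hw, t, ht⟩
  · exact Or.inl ⟨q.seq i, q.report i, (hq i).2⟩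
  · rw [ht.eq]
    by_cases hi : i = w
    · subst hi
      rw [setNodeSend_self]
      exact Or.inr ⟨ht.spec.seq, ht.spec.report, ht.spec.black⟩
    · rw [setNodeSend_of_ne _ _ hi]
      exact Or.inl ⟨rfl, rfl, rfl⟩

lemma Settled.seq_mono (h : Settled σ G n) {m : ℕ} (hm : n ≤ m) (i : Fin N) {m' : ℕ}
    (hm' : m ≤ m') : ((σ m).nodes i).seq ≤ ((σ m').nodes i).seq := by
  induction m', hm' using Nat.le_induction with
  | base => exact le_rfl
  | succ k hk ih =>
    rcases h.seq_step (hm.trans hk) i with h1 | h1 <;> omega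

lemma Settled.count_eq (h : Settled σ G n) {m : ℕ} (hm : n ≤ m) (i : Fin N) {m' : ℕ}
    (hm' : m ≤ m') : ((σ m').nodes i).count = ((σ m).nodes i).count := by
  induction m', hm' using Nat.le_induction with
  | base => rfl
  | succ k hk ih =>
    rw [← ih]
    rcases h.trans (hm.trans hk) with ⟨-, hq⟩ | ⟨w, hw, t, ht⟩
    · exact (hq i).1
    · rw [ht.eq]
      by_cases hi : i = w
      · subst hi; rw [setNodeSend_self]; exact ht.spec.count
      · rw [setNodeSend_of_ne _ _ hi]

lemma Settled.seq_unbounded (h : Settled σ G n) (hne : G.Nonempty) {m : ℕ} (hm : n ≤ m) (K : ℕ) :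
    ∃ m' ≥ m, ∀ i ∈ G, K ≤ ((σ m').nodes i).seq := by
  have grow : ∀ k, ∃ m' ≥ m, k ≤ ∑ i ∈ G, ((σ m').nodes i).seq := by
    intro k
    induction k with
    | zero => exact ⟨m, le_rfl, Nat.zero_le _⟩
    | succ k ih =>
      obtain ⟨m1, hm1, hk⟩ := ih
      obtain ⟨m2, hm2, w, hw, t, ht⟩ := h.exists_forwards hne (hm.trans hm1)
      refine ⟨m2 + 1, by omega, ?_⟩
      have h1 : ∑ i ∈ G, ((σ m1).nodes i).seq < ∑ i ∈ G, ((σ (m2 + 1)).nodes i).seq := by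
        refine sum_lt_sum (fun i _ => h.seq_mono (by omega) i (by omega)) ⟨w, hw, ?_⟩
        rw [ht.eq, setNodeSend_self, ht.spec.seq]
        have := h.seq_mono (m := m1) (by omega) w hm2
        omega
      omega
  -- If some node of `G` had a number below `K`, then by `upper` all numbers would be at most `K`,
  -- and their sum at most `G.card * K`.
  obtain ⟨m', hm', hk⟩ := grow (G.card * K + 1)
  refine ⟨m', hm', fun i hi => ?_⟩
  by_contra hlt
  have h1 : ∑ j ∈ G, ((σ m').nodes j).seq ≤ ∑ j ∈ G, K := by
    refine sum_le_sum fun j _ => ?_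
    have := (h.run.inv m').control.upper i j (h.correct i hi m')
    omega
  rw [sum_const, smul_eq_mul] at h1
  omega

/-- A visit empties `report` and makes the node white, and in a settled run nothing undoes this. It
is enough to wait until each node has been visited once. -/
lemma Settled.reported (h : Settled σ G n) (hne : G.Nonempty) :
    ∃ n' ≥ n, ∀ m ≥ n', ∀ i ∈ G, ((σ m).nodes i).report = ∅ ∧ ((σ m).nodes i).black = i := by
  obtain ⟨n', hn', hs⟩ := h.seq_unbounded hne le_rfl (∑ i ∈ G, ((σ n).nodes i).seq + 1)
  refine ⟨n', hn', fun m hm i hi => ?_⟩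
  have key : ∀ m' ≥ n, ((σ m').nodes i).seq = ((σ n).nodes i).seq ∨
      (((σ m').nodes i).report = ∅ ∧ ((σ m').nodes i).black = i) := by
    intro m' hm'
    induction m', hm' using Nat.le_induction with
    | base => exact Or.inl rfl
    | succ k hk ih =>
      rcases h.seq_step hk i with ⟨h1, h2, h3⟩ | h1
      · rw [h1, h2, h3]; exact ih
      · exact Or.inr h1.2
  refine (key m (hn'.trans hm)).resolve_left ?_
  have h1 := hs i hi
  have h2 := h.seq_mono hn' i hm
  have h3 : ((σ n).nodes i).seq ≤ ∑ i ∈ G, ((σ n).nodes i).seq :=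
    single_le_sum (f := fun i => ((σ n).nodes i).seq) (fun _ _ => Nat.zero_le _) hi
  omega

lemma Forwards.valid (h : Settled σ G n) {m : ℕ} {w : Fin N} {t : Token N}
    (hw : w ∈ G) (hf : Forwards σ m w t) : Valid (σ m) w t :=
  (h.run.inv m).control.valid_of_held (h.correct w hw m) hf.phase

lemma Forwards.valid_succ (h : Settled σ G n) {m : ℕ} {w : Fin N} {t : Token N}
    (hw : w ∈ G) (hf : Forwards σ m w t) {b : Fin N} {t' : Token N}
    (hv : Valid (σ (m + 1)) b t') :
    b = (processToken w t ((σ m).nodes w)).1.next ∧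
      t' = (processToken w t ((σ m).nodes w)).1.stored ∧ b ≠ w := by
  rw [hf.eq] at hv
  obtain ⟨h1, h2, h3, -⟩ :=
    (h.run.inv m).control.valid_forward (Forwards.valid h hw hf) hf.spec hv
  exact ⟨h1, h2, h3⟩

/-- The effect of forwarding a token when no crashes are to be reported. -/
lemma Settled.forwards_spec (h : Settled σ G n)
    (hrep : ∀ m ≥ n, ∀ i ∈ G, ((σ m).nodes i).report = ∅ ∧ ((σ m).nodes i).black = i)
    {m : ℕ} (hm : n ≤ m) {w : Fin N} {t : Token N} (hw : w ∈ G) (hf : Forwards σ m w t)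
    {b : Fin N} {t' : Token N} (hv : Valid (σ (m + 1)) b t') :
    cdist b t'.black ≤ cdist w t.black - 1 ∧
      (∀ k ≠ w, t'.count k = t.count k) ∧
      t'.count w = ∑ y ∈ G, ((σ m).nodes w).count y ∧
      (t.black = w → ∑ z ∈ G, Function.update t.count w
        (∑ y ∈ G, ((σ m).nodes w).count y) z ≠ 0) := by
  have hcon := (h.run.inv m).control
  have hvw := Forwards.valid h hw hf
  obtain ⟨hb, ht', hbw⟩ := Forwards.valid_succ h hw hf hv
  obtain ⟨hr, hbl⟩ := hrep m hm w hw
  have hnt : ((σ m).nodes w).next ∉ t.crashed := fun hmem =>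
    h.dead (hcon.token_dead w t hvw.2.2 _ hmem) (h.next_mem hm hw)
  have hcr : univ \ (((σ m).nodes w).crashed ∪ t.crashed) = G := by
    ext z
    have h1 := h.mem_known hm (z := z) hw
    rw [hr, union_empty] at h1
    simp only [mem_sdiff, mem_univ, true_and, mem_union, h1]
    have h2 : z ∈ t.crashed → z ∉ G := fun hz => h.dead (hcon.token_dead w t hvw.2.2 z hz)
    tauto
  obtain ⟨h1, h2, h3⟩ := hf.spec.reported hr hnt
  have hna := hf.spec.not_announce hbl
  unfold countOutside at h2 hna
  rw [hcr] at h2 hna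
  rw [← hb] at h1
  rw [← ht'] at h2 h3
  refine ⟨?_, fun k hk => by rw [ht']; exact hf.spec.tokenCount k hk, h2, hna⟩
  rw [hbl, cdist_self, ← h1] at h3
  have hpos : 0 < cdist w b := by
    rw [Nat.pos_iff_ne_zero, Ne, cdist_eq_zero]; exact hbw
  rw [cdist_sub (w := w) (b := b) (x := t'.black) (by omega)]
  omega

/-- White nodes with nothing to report never extend the black stretch, and each hop uses up at least
one unit of it. The truncated subtraction in `forwards_spec` keeps it at zero from then on, so `N`
hops suffice. -/
lemma Settled.white (h : Settled σ G n) (hne : G.Nonempty)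
    (hrep : ∀ m ≥ n, ∀ i ∈ G, ((σ m).nodes i).report = ∅ ∧ ((σ m).nodes i).black = i) :
    ∃ n' ≥ n, ∀ m ≥ n', ∀ b t, Valid (σ m) b t → t.black = b := by
  have stable : ∀ d m, n ≤ m → (∀ b t, Valid (σ m) b t → cdist b t.black ≤ d) →
      ∀ m' ≥ m, ∀ b t, Valid (σ m') b t → cdist b t.black ≤ d := by
    intro d m hm h0 m' hm'
    induction m', hm' using Nat.le_induction with
    | base => exact h0
    | succ k hk ih =>
      intro b t hv
      rcases h.trans (hm.trans hk) with ⟨q, -⟩ | ⟨w, hw, t0, hf⟩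
      · exact ih b t (q.valid hv)
      · have h1 := (h.forwards_spec hrep (hm.trans hk) hw hf hv).1
        have h2 := ih w t0 (Forwards.valid h hw hf)
        omega
  have down : ∀ d, ∃ m ≥ n, ∀ b t, Valid (σ m) b t → cdist b t.black ≤ N - d := by
    intro d
    induction d with
    | zero => exact ⟨n, le_rfl, fun b t _ => (cdist_lt b t.black).le⟩
    | succ d ih =>
      obtain ⟨m, hm, hd⟩ := ih
      obtain ⟨m', hm', w, hw, t0, hf⟩ := h.exists_forwards hne hm
      refine ⟨m' + 1, by omega, fun b t hv => ?_⟩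
      have h1 := (h.forwards_spec hrep (by omega) hw hf hv).1
      have h2 := stable _ m hm hd m' hm' w t0 (Forwards.valid h hw hf)
      omega
  obtain ⟨m, hm, hd⟩ := down N
  refine ⟨m, hm, fun m' hm' b t hv => ?_⟩
  have := stable _ m hm hd m' hm' b t hv
  exact cdist_eq_zero.mp (by omega)

lemma Settled.false (h : Settled σ G n) (hne : G.Nonempty) : False := by
  obtain ⟨n1, hn1, hrep⟩ := h.reported hne
  have h1 : Settled σ G n1 := ⟨h.run, h.fair, h.correct, fun m hm => h.alive m (hn1.trans hm),
    fun m hm => h.known m (hn1.trans hm), fun m hm => h.terminated m (hn1.trans hm),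
    fun m hm => h.silent m (hn1.trans hm)⟩
  obtain ⟨n2, hn2, white⟩ := h1.white hne hrep
  -- Local counts no longer change, so one visit after `n2` makes the entry of a node in the token
  -- right for good.
  have exact_count : ∀ m ≥ n2, ∀ b t, Valid (σ m) b t → ∀ z ∈ G,
      ((σ n2).nodes z).seq < ((σ m).nodes z).seq →
      t.count z = ∑ y ∈ G, ((σ n2).nodes z).count y := by
    intro m hm
    induction m, hm using Nat.le_induction with
    | base => intro b t _ z _ hlt; omega
    | succ k hk ih =>
      intro b t hv z hz hlt
      rcases h1.trans (hn2.trans hk) with ⟨q, -⟩ | ⟨w, hw, t0, hf⟩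
      · rw [q.seq] at hlt
        exact ih b t (q.valid hv) z hz hlt
      · obtain ⟨-, h3, h4, -⟩ := h1.forwards_spec hrep (hn2.trans hk) hw hf hv
        by_cases hzw : z = w
        · rw [hzw, h4, h1.count_eq hn2 w hk]
        · rw [h3 z hzw]
          rw [hf.eq, setNodeSend_of_ne _ _ hzw] at hlt
          exact ih w t0 (Forwards.valid h1 hw hf) z hz hlt
  obtain ⟨n3, hn3, hs⟩ := h1.seq_unbounded hne hn2 (∑ i ∈ G, ((σ n2).nodes i).seq + 1)
  obtain ⟨m, hm, w, hw, t, hf⟩ := h1.exists_forwards hne (hn2.trans hn3)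
  have hn2m : n2 ≤ m := hn3.trans hm
  have hvw := Forwards.valid h1 hw hf
  -- A valid token after the hop must be the one just sent, which makes `forwards_spec` applicable
  -- to this hop.
  obtain ⟨b, hb, t', hv'⟩ := h1.exists_valid hne (m := m + 1) (by omega)
  obtain ⟨-, -, -, h5⟩ := h1.forwards_spec hrep (hn2.trans hn2m) hw hf hv'
  refine h5 (white m hn2m w t hvw) ?_
  have htot := (h1.run.inv m).total_count (h1.terminated m (hn2.trans hn2m)) (G := G)
    (fun z hz => h1.correct z hz m)
  rw [← htot]
  refine sum_congr rfl fun z hz => ?_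
  by_cases hzw : z = w
  · rw [hzw, Function.update_self]
  · rw [Function.update_of_ne hzw, exact_count m hn2m w t hvw z hz ?_, h1.count_eq hn2 z hn2m]
    have h6 := hs z hz
    have h7 := h1.seq_mono (hn2.trans hn3) z hm
    have h8 : ((σ n2).nodes z).seq ≤ ∑ i ∈ G, ((σ n2).nodes i).seq :=
      single_le_sum (f := fun i => ((σ n2).nodes i).seq) (fun _ _ => Nat.zero_le _) hz
    omega

end Settled

/-- Crashes, known crashes, announcements and termination all persist. Since there are finitely many
nodes, a run without the desired announcement is settled from some time on. -/
theorem IsRun.liveness [NeZero N] {σ : ℕ → State N} (run : IsRun σ) (fair : Fair σ) (n : ℕ)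
    (ht : Terminated (σ n)) (hc : ∃ i, Correct σ i) :
    ∃ m ≥ n, ∃ i, ((σ m).nodes i).alive = true ∧ Announced (σ m) i := by
  classical
  by_contra hno
  push Not at hno
  set G : Finset (Fin N) := univ.filter fun i => Correct σ i with hG
  have memG : ∀ i, i ∈ G ↔ Correct σ i := by intro i; simp [hG]
  have step : ∀ k, σ (k + 1) = σ k ∨ Step (σ k) (σ (k + 1)) := run.2
  have dead_mono : ∀ i k, ((σ k).nodes i).alive = false → ∀ m ≥ k,
      ((σ m).nodes i).alive = false := by
    intro i k hk m hm
    induction m, hm using Nat.le_induction with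
    | base => exact hk
    | succ j hj ih =>
      rcases step j with h1 | h1
      · rw [h1]; exact ih
      · exact dead_of_alive_imp ((run.inv j).control.alive_anti h1) ih
  have known_mono : ∀ i k m, k ≤ m → ((σ k).nodes i).crashed ∪ ((σ k).nodes i).report ⊆
      ((σ m).nodes i).crashed ∪ ((σ m).nodes i).report := by
    intro i k m hm
    induction m, hm using Nat.le_induction with
    | base => exact Subset.rfl
    | succ j hj ih =>
      rcases step j with h1 | h1
      · rw [h1]; exact ih
      · exact ih.trans ((run.inv j).control.known_mono h1 i)
  have announced_mono : ∀ i k m, k ≤ m → Announced (σ k) i → Announced (σ m) i := by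
    intro i k m hm hk
    induction m, hm using Nat.le_induction with
    | base => exact hk
    | succ j hj ih =>
      rcases step j with h1 | h1
      · rw [h1]; exact ih
      · exact (run.inv j).control.announced_mono h1 ih
  have silent : ∀ i ∈ G, ∀ k, ¬ Announced (σ k) i := by
    intro i hi k hk
    exact hno (max n k) (le_max_left _ _) i ((memG i).mp hi _)
      (announced_mono i k _ (le_max_right _ _) hk)
  have dead_time : ∀ i, ∃ k, i ∉ G → ((σ k).nodes i).alive = false := by
    intro i
    by_cases hi : i ∈ G
    · exact ⟨0, fun h => absurd hi h⟩
    · rw [memG] at hi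
      unfold Correct at hi
      push Not at hi
      obtain ⟨k, hk⟩ := hi
      exact ⟨k, fun _ => by simpa using hk⟩
  choose dt hdt using dead_time
  have known_time : ∀ i z, ∃ k, i ∈ G → z ∉ G →
      z ∈ ((σ k).nodes i).crashed ∪ ((σ k).nodes i).report := by
    intro i z
    by_cases hi : i ∈ G
    · by_cases hz : z ∈ G
      · exact ⟨0, fun _ h => absurd hz h⟩
      · obtain ⟨k, hk⟩ := fair.detection i ((memG i).mp hi) z _ (hdt z hz)
        exact ⟨k, fun _ _ => hk.resolve_right (silent i hi k)⟩
    · exact ⟨0, fun h => absurd h hi⟩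
  choose kt hkt using known_time
  have term : ∀ m ≥ n, Terminated (σ m) := by
    intro m hm
    induction m, hm using Nat.le_induction with
    | base => exact ht
    | succ j hj ih =>
      rcases step j with h1 | h1
      · rw [h1]; exact ih
      · exact ih.step (run.inv j).control h1
  -- The sums merely serve as common upper bounds for the finitely many times `dt i` and `kt i z`.
  have hs : Settled σ G (n + ∑ i, dt i + ∑ i, ∑ z, kt i z) := by
    refine ⟨run, fair, fun i hi => (memG i).mp hi, ?_, ?_, fun m hm => term m (by omega),
      fun m _ i hi => silent i hi m⟩
    · intro m hm i hi
      by_contra hiG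
      have h1 : dt i ≤ ∑ i, dt i := single_le_sum (fun _ _ => Nat.zero_le _) (mem_univ i)
      rw [dead_mono i _ (hdt i hiG) m (by omega)] at hi
      cases hi
    · intro m hm i hi z hz
      have h1 : kt i z ≤ ∑ z, kt i z := single_le_sum (fun _ _ => Nat.zero_le _) (mem_univ z)
      have h2 : ∑ z, kt i z ≤ ∑ i, ∑ z, kt i z :=
        single_le_sum (f := fun i => ∑ z, kt i z) (fun _ _ => Nat.zero_le _) (mem_univ i)
      exact known_mono i (kt i z) m (by omega) (hkt i z hi hz)
  obtain ⟨i, hi⟩ := hc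
  exact hs.false ⟨i, (memG i).mpr hi⟩

end FTSafra

theorem theorem2 (N : ℕ) [NeZero N] (σ : ℕ → FTSafra.State N) (run : FTSafra.IsRun σ) :
    -- Liveness
    (FTSafra.Fair σ → ∀ n, FTSafra.Terminated (σ n) → (∃ i, FTSafra.Correct σ i) →
      ∃ m ≥ n, ∃ i, ((σ m).nodes i).alive = true ∧ FTSafra.Announced (σ m) i) ∧
    -- Safety
    (∀ n i, FTSafra.Announced (σ n) i → FTSafra.Terminated (σ n)) :=
  ⟨fun fair n ht hc => run.liveness fair n ht hc,
    fun n i hi => (run.safety n).resolve_left fun h => h i hi⟩
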